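/- Let $K$ be an integral domain of characteristic $0$ and let $q\in K$ be invertible. For a Coxeter system $(W,S)$, let $H(q)$ be its Hecke algebra, i.e. the associative unital $K$-algebra generated by $g_s$ ($s\in S$) with the relations $g_s^2=q+(q-1)g_s$ and the braid relations $g_sg_tg_s\cdots=g_tg_sg_t\cdots$ ($m$ factors on each side) whenever $st$ has finite order $m$; for $w\in W$ with reduced expression $s_1\cdots s_k$ put $g_w=g_{s_1}\cdots g_{s_k}$. The (generalized) Temperley–Lieb algebra $TL(q)$ of $(W,S)$ is the quotient of $H(q)$ by the two-sided ideal generated by the elements $L_{s,t}=\sum_{w\in\langle s,t\rangle}g_w$, for all non-commuting $s,t\in S$ such that $st$ has finite order. For $n\ge 2$, let $H\tilde C_n(q)$ and $TL\tilde C_n(q)$ be the Hecke and Temperley–Lieb algebras of the Coxeter group of type $\tilde C_n$, with generators $\sigma_0=t,\sigma_1,\dots,\sigma_{n-1},t_n$; its Coxeter diagram is the path with these vertices in this order, whose first and last edges have label $4$ and whose other edges have label $3$. Put $TL\tilde C_1(q)=K$. For $n\ge2$, writing $e_s$ for the generators of $H\tilde C_n(q)$ and $g_s$ for those of $H\tilde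 C_{n+1}(q)$, the assignment $e_{\sigma_i}\mapsto g_{\sigma_i}$ $(0\le i\le n-1)$, $e_{t_n}\mapsto g_{\sigma_n}g_{t_{n+1}}g_{\sigma_n}^{-1}$ defines a morphism of $K$-algebras $H\tilde C_n(q)\to H\tilde C_{n+1}(q)$, and this morphism induces a morphism of $K$-algebras $R_n:TL\tilde C_n(q)\to TL\tilde C_{n+1}(q)$. Let $R_1:K\to TL\tilde C_2(q)$ be the structure morphism. Then the tower $$TL\tilde C_1(q)\xrightarrow{R_1}TL\tilde C_2(q)\xrightarrow{R_2}TL\tilde C_3(q)\to\cdots\to TL\tilde C_n(q)\xrightarrow{R_n}TL\tilde C_{n+1}(q)\to\cdots$$ is a tower of faithful arrows: $R_n$ is injective for every $n\ge1$. -/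

import Mathlib

namespace AffineTL

/-- The alternating product `x * y * x * ⋯` with `k` factors, starting with `x`. -/
def alt {R : Type*} [Monoid R] (x y : R) : ℕ → R
  | 0 => 1
  | k + 1 => x * alt y x k

/-- The sum of the `2 * m` alternating products
`1, x, y, x * y, y * x, …` in which each length `0 < k < m` occurs twice and the lengths `0`
and `m` occur once. When `x = g_s`, `y = g_t` are generators of a Hecke algebra and `s * t` has
order `m`, these products are exactly the `g_w` for `w` in the dihedral group `⟨s, t⟩`. -/
def dihedralSum {R : Type*} [Semiring R] (x y : R) (m : ℕ) : R :=
  ∑ k ∈ Finset.range m, alt x y k + ∑ k ∈ Finset.range m, alt y x (k + 1)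

theorem dihedralSum_three {R : Type*} [Semiring R] (x y : R) :
    dihedralSum x y 3 = y * x * y + x * y + y * x + x + y + 1 := by
  simp only [dihedralSum, Finset.sum_range_succ, Finset.sum_range_zero, alt, mul_one, mul_assoc]
  abel

theorem dihedralSum_four {R : Type*} [Semiring R] (x y : R) :
    dihedralSum x y 4
      = y * x * y * x + x * y * x + y * x * y + x * y + y * x + x + y + 1 := by
  simp only [dihedralSum, Finset.sum_range_succ, Finset.sum_range_zero, alt, mul_one, mul_assoc]
  abel

section General

variable {B : Type*} {K : Type*} [CommRing K]

/-- Defining relations of the Hecke algebra of a Coxeter matrix: the quadratic relations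
`g_s ^ 2 = q + (q - 1) g_s`, and the braid relations (trivial when `M i j = 0`, that is, when
`s * t` has infinite order). -/
inductive HeckeRel (M : CoxeterMatrix B) (q : K) : FreeAlgebra K B → FreeAlgebra K B → Prop
  | quad (i : B) :
      HeckeRel M q (FreeAlgebra.ι K i * FreeAlgebra.ι K i)
        (algebraMap K (FreeAlgebra K B) q + (q - 1) • FreeAlgebra.ι K i)
  | braid (i j : B) :
      HeckeRel M q (alt (FreeAlgebra.ι K i) (FreeAlgebra.ι K j) (M i j))
        (alt (FreeAlgebra.ι K j) (FreeAlgebra.ι K i) (M i j))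

/-- The Hecke algebra of a Coxeter matrix, as a `K`-algebra given by generators and relations. -/
abbrev Hecke (M : CoxeterMatrix B) (q : K) : Type _ := RingQuot (HeckeRel M q)

/-- The generators `g_s` of the Hecke algebra. -/
def heckeGen (M : CoxeterMatrix B) (q : K) (i : B) : Hecke M q :=
  RingQuot.mkAlgHom K (HeckeRel M q) (FreeAlgebra.ι K i)

/-- The relations `L_{s,t} = 0`, where `L_{s,t} = ∑ g_w`, the sum being over `w ∈ ⟨s, t⟩`, for
non-commuting `s, t` such that `s * t` has finite order. -/
inductive TLRel (M : CoxeterMatrix B) (q : K) : Hecke M q → Hecke M q → Prop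
  | mk (i j : B) (h : 2 < M i j) :
      TLRel M q (dihedralSum (heckeGen M q i) (heckeGen M q j) (M i j)) 0

/-- Graham's generalized Temperley–Lieb algebra: the quotient of the Hecke algebra by the
two-sided ideal generated by the elements `L_{s,t}`. -/
abbrev TL (M : CoxeterMatrix B) (q : K) : Type _ := RingQuot (TLRel M q)

/-- The canonical surjection from the Hecke algebra onto the Temperley–Lieb algebra. -/
def toTL (M : CoxeterMatrix B) (q : K) : Hecke M q →ₐ[K] TL M q :=
  RingQuot.mkAlgHom K (TLRel M q)

/-- The generators `T_s` of the Temperley–Lieb algebra. -/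
def tlGen (M : CoxeterMatrix B) (q : K) (i : B) : TL M q := toTL M q (heckeGen M q i)

theorem map_alt {R S F : Type*} [Monoid R] [Monoid S] [FunLike F R S] [MonoidHomClass F R S]
    (f : F) (k : ℕ) (x y : R) : f (alt x y k) = alt (f x) (f y) k := by
  induction k generalizing x y with
  | zero => simp [alt]
  | succ k ih => simp [alt, ih]

theorem map_dihedralSum {R S F : Type*} [Semiring R] [Semiring S] [FunLike F R S]
    [RingHomClass F R S] (f : F) (x y : R) (m : ℕ) :
    f (dihedralSum x y m) = dihedralSum (f x) (f y) m := by
  simp [dihedralSum, map_alt]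

theorem alt_conj {R : Type*} [Monoid R] (c : Rˣ) (k : ℕ) (x y : R) :
    alt (↑c * x * ↑c⁻¹) (↑c * y * ↑c⁻¹) k = ↑c * alt x y k * ↑c⁻¹ := by
  induction k generalizing x y with
  | zero => simp [alt]
  | succ k ih => rw [alt, alt, ih]; simp [mul_assoc]

theorem dihedralSum_conj {R : Type*} [Semiring R] (c : Rˣ) (m : ℕ) (x y : R) :
    dihedralSum (↑c * x * ↑c⁻¹) (↑c * y * ↑c⁻¹) m = ↑c * dihedralSum x y m * ↑c⁻¹ := by
  simp only [dihedralSum, alt_conj, mul_add, add_mul, Finset.mul_sum, Finset.sum_mul]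

theorem heckeGen_quad (M : CoxeterMatrix B) (q : K) (i : B) :
    heckeGen M q i * heckeGen M q i
      = algebraMap K (Hecke M q) q + (q - 1) • heckeGen M q i := by
  have := RingQuot.mkAlgHom_rel K (HeckeRel.quad (M := M) (q := q) i)
  simp only [map_mul, map_add, map_smul, AlgHom.commutes] at this
  exact this

theorem heckeGen_braid (M : CoxeterMatrix B) (q : K) (i j : B) :
    alt (heckeGen M q i) (heckeGen M q j) (M i j)
      = alt (heckeGen M q j) (heckeGen M q i) (M i j) := by
  have := RingQuot.mkAlgHom_rel K (HeckeRel.braid (M := M) (q := q) i j)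
  simp only [map_alt] at this
  exact this

theorem toTL_dihedralSum (M : CoxeterMatrix B) (q : K) (i j : B) (h : 2 < M i j) :
    toTL M q (dihedralSum (heckeGen M q i) (heckeGen M q j) (M i j)) = 0 := by
  have := RingQuot.mkAlgHom_rel K (TLRel.mk (M := M) (q := q) i j h)
  rw [map_zero] at this
  exact this

/-- For invertible `q`, the generator `g_s` is a unit, with inverse `q⁻¹ g_s + (q⁻¹ - 1)`. -/
def heckeUnit (M : CoxeterMatrix B) (q : Kˣ) (i : B) : (Hecke M (q : K))ˣ where
  val := heckeGen M (q : K) i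
  inv := ((q⁻¹ : Kˣ) : K) • heckeGen M (q : K) i
    + algebraMap K (Hecke M (q : K)) (((q⁻¹ : Kˣ) : K) - 1)
  val_inv := by
    rw [mul_add, mul_smul_comm, heckeGen_quad, ← Algebra.commutes, ← Algebra.smul_def,
      Algebra.algebraMap_eq_smul_one, smul_add, smul_smul, smul_smul, add_assoc, ← add_smul]
    have : ((q⁻¹ : Kˣ) : K) * ((q : K) - 1) + (((q⁻¹ : Kˣ) : K) - 1) = 0 := by
      rw [mul_sub, Units.inv_mul]; ring
    rw [this, Units.inv_mul]; simp
  inv_val := by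
    rw [add_mul, smul_mul_assoc, heckeGen_quad, ← Algebra.smul_def,
      Algebra.algebraMap_eq_smul_one, smul_add, smul_smul, smul_smul, add_assoc, ← add_smul]
    have : ((q⁻¹ : Kˣ) : K) * ((q : K) - 1) + (((q⁻¹ : Kˣ) : K) - 1) = 0 := by
      rw [mul_sub, Units.inv_mul]; ring
    rw [this, Units.inv_mul]; simp

end General

/-- The Coxeter matrix of type `C̃ₙ` for `n ≥ 2`, on the `n + 1` generators
`σ₀ = t, σ₁, …, σₙ₋₁, tₙ`, indexed by `0, 1, …, n`. -/
def affineC (n : ℕ) : CoxeterMatrix (Fin (n + 1)) where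
  M := Matrix.of fun i j =>
    if i = j then 1
    else if (i : ℕ) + 1 = j ∨ (j : ℕ) + 1 = i then
      if (i : ℕ) = 0 ∨ (j : ℕ) = 0 ∨ (i : ℕ) = n ∨ (j : ℕ) = n then 4 else 3
    else 2
  isSymm := by
    ext i j
    simp only [Matrix.transpose_apply, Matrix.of_apply]
    grind
  diagonal := by intro i; simp
  off_diagonal := by
    intro i j h
    simp only [Matrix.of_apply]
    grind

theorem affineC_apply (n : ℕ) (i j : Fin (n + 1)) :
    affineC n i j = if i = j then 1
      else if (i : ℕ) + 1 = j ∨ (j : ℕ) + 1 = i then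
        if (i : ℕ) = 0 ∨ (j : ℕ) = 0 ∨ (i : ℕ) = n ∨ (j : ℕ) = n then 4 else 3
      else 2 := rfl

variable {K : Type*} [CommRing K]

/-- The Hecke algebra of type `C̃ₙ` (for `n ≥ 2`). -/
abbrev HeckeC (n : ℕ) (q : K) : Type _ := Hecke (affineC n) q

/-- The Temperley–Lieb algebra of type `C̃ₙ` (for `n ≥ 2`). -/
abbrev TLC (n : ℕ) (q : K) : Type _ := TL (affineC n) q

/-- The images of the generators under the Hecke map: `e_{σᵢ} ↦ g_{σᵢ}` for `i ≤ n - 1`, and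
`e_{tₙ} ↦ g_{σₙ} g_{tₙ₊₁} g_{σₙ}⁻¹`. -/
def heckeMapGen (n : ℕ) (q : Kˣ) (i : Fin (n + 1)) : HeckeC (n + 1) (q : K) :=
  if i = Fin.last n then
    heckeGen (affineC (n + 1)) (q : K) (Fin.last n).castSucc
      * heckeGen (affineC (n + 1)) (q : K) (Fin.last (n + 1))
      * ↑(heckeUnit (affineC (n + 1)) q (Fin.last n).castSucc)⁻¹
  else heckeGen (affineC (n + 1)) (q : K) i.castSucc

theorem heckeMapGen_conj (n : ℕ) (hn : 2 ≤ n) (q : Kˣ) (i j : Fin (n + 1)) :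
    ∃ (c : (HeckeC (n + 1) (q : K))ˣ) (a b : Fin (n + 2)),
      heckeMapGen n q i = ↑c * heckeGen (affineC (n + 1)) (q : K) a * ↑c⁻¹ ∧
      heckeMapGen n q j = ↑c * heckeGen (affineC (n + 1)) (q : K) b * ↑c⁻¹ ∧
      affineC (n + 1) a b = affineC n i j := by
  -- the mixed case, in which only the first index is the last one
  have key : ∀ j : Fin (n + 1), j ≠ Fin.last n →
      ∃ (c : (HeckeC (n + 1) (q : K))ˣ) (b : Fin (n + 2)),
      heckeMapGen n q (Fin.last n)
        = ↑c * heckeGen (affineC (n + 1)) (q : K) (Fin.last (n + 1)) * ↑c⁻¹ ∧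
      heckeMapGen n q j = ↑c * heckeGen (affineC (n + 1)) (q : K) b * ↑c⁻¹ ∧
      affineC (n + 1) (Fin.last (n + 1)) b = affineC n (Fin.last n) j := by
    intro j hj
    have hj' : (j : ℕ) < n := by
      have := j.2
      have : (j : ℕ) ≠ n := fun h => hj (Fin.ext (by simpa using h))
      omega
    set u := heckeUnit (affineC (n + 1)) q (Fin.last n).castSucc with hu
    set v := heckeUnit (affineC (n + 1)) q j.castSucc with hv
    have eu : (u : HeckeC (n + 1) (q : K))
        = heckeGen (affineC (n + 1)) (q : K) (Fin.last n).castSucc := rfl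
    have ev : (v : HeckeC (n + 1) (q : K))
        = heckeGen (affineC (n + 1)) (q : K) j.castSucc := rfl
    have hjne : j.castSucc ≠ Fin.last (n + 1) := by
      intro h; have := congrArg Fin.val h; simp at this; omega
    have hMt : affineC (n + 1) j.castSucc (Fin.last (n + 1)) = 2 := by
      rw [affineC_apply, if_neg hjne, if_neg]
      simp only [Fin.val_castSucc, Fin.val_last]; omega
    have hct : (v : HeckeC (n + 1) (q : K)) * heckeGen (affineC (n + 1)) (q : K) (Fin.last (n + 1))
        = heckeGen (affineC (n + 1)) (q : K) (Fin.last (n + 1)) * v := by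
      have := heckeGen_braid (affineC (n + 1)) (q : K) j.castSucc (Fin.last (n + 1))
      rw [hMt] at this
      simpa [alt, ev] using this
    by_cases h1 : (j : ℕ) + 1 = n
    · have hM3 : affineC (n + 1) j.castSucc (Fin.last n).castSucc = 3 := by
        rw [affineC_apply, if_neg, if_pos, if_neg]
        · simp only [Fin.val_castSucc, Fin.val_last]; omega
        · simp only [Fin.val_castSucc, Fin.val_last]; omega
        · intro h; have := congrArg Fin.val h; simp at this; omega
      have hb : v * u * v = u * v * u := by
        apply Units.ext
        have := heckeGen_braid (affineC (n + 1)) (q : K) j.castSucc (Fin.last n).castSucc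
        rw [hM3] at this
        simpa [alt, eu, ev, mul_assoc] using this
      refine ⟨u * v, (Fin.last n).castSucc, ?_, ?_, ?_⟩
      · rw [heckeMapGen, if_pos rfl, ← eu, ← hu]
        rw [mul_inv_rev, Units.val_mul, Units.val_mul, mul_assoc (u : HeckeC (n + 1) (q : K)) v,
          hct]
        simp [mul_assoc]
      · rw [heckeMapGen, if_neg hj, ← eu, ← ev, ← Units.val_mul, ← Units.val_mul]
        congr 1
        rw [eq_mul_inv_iff_mul_eq, ← hb, mul_assoc]
      · rw [affineC_apply, affineC_apply, if_neg, if_pos, if_pos, if_neg, if_pos, if_pos]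
        · simp
        · simp; omega
        · exact fun h => hj h.symm
        · simp
        · simp
        · intro h; have := congrArg Fin.val h; simp at this
    · have hM2 : affineC (n + 1) j.castSucc (Fin.last n).castSucc = 2 := by
        rw [affineC_apply, if_neg, if_neg]
        · simp; omega
        · intro h; have := congrArg Fin.val h; simp at this; omega
      have hb : v * u = u * v := by
        apply Units.ext
        have := heckeGen_braid (affineC (n + 1)) (q : K) j.castSucc (Fin.last n).castSucc
        rw [hM2] at this
        simpa [alt, eu, ev, mul_assoc] using this
      refine ⟨u, j.castSucc, ?_, ?_, ?_⟩
      · rw [heckeMapGen, if_pos rfl, ← eu, ← hu]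
      · rw [heckeMapGen, if_neg hj, ← ev, ← Units.val_mul, ← Units.val_mul]
        congr 1
        rw [eq_mul_inv_iff_mul_eq, hb]
      · rw [CoxeterMatrix.symmetric, hMt, affineC_apply, if_neg (fun h => hj h.symm), if_neg]
        simp; omega
  by_cases hi : i = Fin.last n
  · subst hi
    by_cases hj : j = Fin.last n
    · subst hj
      exact ⟨heckeUnit (affineC (n + 1)) q (Fin.last n).castSucc, Fin.last (n + 1),
        Fin.last (n + 1), by rw [heckeMapGen, if_pos rfl]; rfl,
        by rw [heckeMapGen, if_pos rfl]; rfl, by simp⟩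
    · obtain ⟨c, b, h1, h2, h3⟩ := key j hj
      exact ⟨c, _, b, h1, h2, h3⟩
  · by_cases hj : j = Fin.last n
    · subst hj
      obtain ⟨c, b, h1, h2, h3⟩ := key i hi
      exact ⟨c, b, _, h2, h1, by rw [CoxeterMatrix.symmetric, h3, CoxeterMatrix.symmetric]⟩
    · have hi' : (i : ℕ) ≠ n := fun h => hi (Fin.ext (by simpa using h))
      have hj' : (j : ℕ) ≠ n := fun h => hj (Fin.ext (by simpa using h))
      refine ⟨1, i.castSucc, j.castSucc, by simp [heckeMapGen, hi], by simp [heckeMapGen, hj], ?_⟩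
      rw [affineC_apply, affineC_apply]
      simp only [Fin.val_castSucc, Fin.castSucc_inj]
      have := i.2
      have := j.2
      grind

theorem heckeMapGen_quad (n : ℕ) (hn : 2 ≤ n) (q : Kˣ) (i : Fin (n + 1)) :
    heckeMapGen n q i * heckeMapGen n q i
      = algebraMap K (HeckeC (n + 1) (q : K)) q + ((q : K) - 1) • heckeMapGen n q i := by
  obtain ⟨c, a, -, h, -, -⟩ := heckeMapGen_conj n hn q i i
  have h2 : heckeMapGen n q i * heckeMapGen n q i
      = ↑c * (heckeGen (affineC (n + 1)) (q : K) a * heckeGen (affineC (n + 1)) (q : K) a)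
        * ↑c⁻¹ := by
    rw [h]; simp [mul_assoc]
  rw [h2, heckeGen_quad, mul_add, add_mul, ← Algebra.commutes, mul_assoc (algebraMap K _ _),
    Units.mul_inv, mul_one, mul_smul_comm, smul_mul_assoc, ← h]

/-- The morphism of Hecke algebras `Rₙ : H(C̃ₙ) → H(C̃ₙ₊₁)` with `e_{σᵢ} ↦ g_{σᵢ}` for
`i ≤ n - 1` and `e_{tₙ} ↦ g_{σₙ} g_{tₙ₊₁} g_{σₙ}⁻¹`. -/
def heckeMap (n : ℕ) (hn : 2 ≤ n) (q : Kˣ) :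
    HeckeC n (q : K) →ₐ[K] HeckeC (n + 1) (q : K) :=
  RingQuot.liftAlgHom K ⟨FreeAlgebra.lift K (heckeMapGen n q), by
    intro x y h
    cases h with
    | quad i =>
      simp only [map_mul, map_add, map_smul, AlgHom.commutes, FreeAlgebra.lift_ι_apply]
      exact heckeMapGen_quad n hn q i
    | braid i j =>
      simp only [map_alt, FreeAlgebra.lift_ι_apply]
      obtain ⟨c, a, b, h1, h2, h3⟩ := heckeMapGen_conj n hn q i j
      rw [h1, h2, alt_conj, alt_conj, ← h3, heckeGen_braid]⟩

theorem heckeMap_gen (n : ℕ) (hn : 2 ≤ n) (q : Kˣ) (i : Fin (n + 1)) :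
    heckeMap n hn q (heckeGen (affineC n) (q : K) i) = heckeMapGen n q i := by
  simp [heckeMap, heckeGen]

/-- The morphism of Temperley–Lieb algebras `Rₙ : TL(C̃ₙ) → TL(C̃ₙ₊₁)`, for `n ≥ 2`, induced
by the morphism `heckeMap` of Hecke algebras. -/
def R (n : ℕ) (hn : 2 ≤ n) (q : Kˣ) : TLC n (q : K) →ₐ[K] TLC (n + 1) (q : K) :=
  RingQuot.liftAlgHom K ⟨(toTL (affineC (n + 1)) (q : K)).comp (heckeMap n hn q), by
    intro x y h
    cases h with
    | mk i j hij =>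
      simp only [AlgHom.comp_apply, map_zero, map_dihedralSum, heckeMap_gen]
      rw [← map_dihedralSum]
      obtain ⟨c, a, b, h1, h2, h3⟩ := heckeMapGen_conj n hn q i j
      rw [h1, h2, dihedralSum_conj, ← h3, map_mul, map_mul,
        toTL_dihedralSum _ _ _ _ (by rw [h3]; exact hij)]
      simp⟩

/-- `R` is induced by the Hecke map: the square with the canonical surjections commutes. -/
theorem R_toTL (n : ℕ) (hn : 2 ≤ n) (q : Kˣ) (x : HeckeC n (q : K)) :
    R n hn q (toTL (affineC n) (q : K) x)
      = toTL (affineC (n + 1)) (q : K) (heckeMap n hn q x) := by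
  simp [R, toTL]

end AffineTL

/-! Put `b_s = g_s + 1`. The relations become `b_s ^ 2 = (q + 1) b_s`, commutation of distant
generators, `b_s b_t b_s = q b_s` across an edge labelled 3, and `b_s b_t b_s b_t = 2q b_s b_t`
across an edge labelled 4 (`IsTL`). The idea is to exhibit representations of the algebra of type
`C̃ₙ` that are jointly faithful, and to embed each of them into the restriction along `R` of a
representation of the algebra of type `C̃ₙ₊₁`. An element killed by `R` then acts as zero on all of
them (`eq_zero_of_intertwiner`), so it is zero (`eq_zero_of_reps`). Nothing about the size of the
larger algebra is needed.

There are two kinds of representations. In the path representations the basis consists of lattice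
paths over the columns `0, …, n`. A generator `b_i` kills a path for which `i` is on a slope. It
sends a path with a peak at `i` to itself plus the path lowered there, and a path with a valley at
`i` to `q` times itself plus the path raised there. Idempotents `e 0` and `e n` can switch off the
outer generators. In the zigzag representation a walker moves on `ℤ`, labelled by the periodic word
`⋯ 1 0 1 ⋯ n-1 n n-1 ⋯`, one step at a time.

Joint faithfulness needs a spanning family, not a basis. By induction on word length
(`wordSpan_le_span_isFam`, with `IsFam.closes` as the induction step) the algebra is spanned by two
types of words. The first are products along sequences that lower a path on an interval `[j, k]`,
where an end `j > 0` is used once and stands for the peak `b_j ⋯ b_0 ⋯ b_j`, and similarly for `k <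
n`. The second are zigzags of at least `2n + 1` letters.

Linear relations are excluded by leading coefficients. A word of length `N` moves the walker at most
`N` steps forward, and only one word attains the bound. Peak products either act as zero on the
walker or have at most `2n + 1` letters, so a longest zigzag is isolated and no zigzag can occur in
a relation (`isPeakSeq_of_zigOp`). Likewise a word of length `N` lowers the area under a path by at
most `2N`, with equality only for lowering sequences, and by `Low.prod_eq` such a product depends
only on how often each column is used. A peak acts on paths as a multiple of a single generator, so
peaks and plain letters have the same leading path. They are told apart by switching off outer
generators (`eq_empty_of_pathRep`). The multiples are, up to parameters, `2 q ^ j`, hence nonzero in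
characteristic `0` with `q` invertible.

For the embeddings, a path is extended by an up-step with an alternating sign. The walker's turning
point `n` goes to a difference of two neighbouring positions of the longer zigzag. The base ring
embeds because scalars act as scalars on the walker. -/

namespace AffineTL

/-! ### Lowering sequences of lattice paths -/

/-- The path `h` after each column `m` has been lowered by `2` once for each occurrence of `m`. -/
def ht (h : ℕ → ℤ) (l : List ℕ) (m : ℕ) : ℤ := h m - 2 * l.count m

/-- `i` is a local maximum of the path `g` on the columns `j, …, k`. -/
def IsMax (j k : ℕ) (g : ℕ → ℤ) (i : ℕ) : Prop :=
  (j < i → g (i - 1) = g i - 1) ∧ (i < k → g (i + 1) = g i - 1)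

/-- `i` is a local minimum of the path `g` on the columns `j, …, k`. -/
def IsMin (j k : ℕ) (g : ℕ → ℤ) (i : ℕ) : Prop :=
  (j < i → g (i - 1) = g i + 1) ∧ (i < k → g (i + 1) = g i + 1)

/-- `g` is a lattice path on the columns `j, …, k`. -/
def IsPath (j k : ℕ) (g : ℕ → ℤ) : Prop :=
  ∀ i, j ≤ i → i < k → g (i + 1) = g i + 1 ∨ g (i + 1) = g i - 1

/-- The letters of `l`, read from the right, successively lower local maxima of the path `h`. -/
def Low (j k : ℕ) (h : ℕ → ℤ) : List ℕ → Prop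
  | [] => True
  | i :: l => Low j k h l ∧ j ≤ i ∧ i ≤ k ∧ IsMax j k (ht h l) i

theorem ht_nil (h : ℕ → ℤ) : ht h [] = h := by
  funext m; simp [ht]

theorem ht_cons (h : ℕ → ℤ) (l : List ℕ) (i m : ℕ) :
    ht h (i :: l) m = ht h l m - if m = i then 2 else 0 := by
  simp only [ht, List.count_cons]
  grind

theorem ht_perm {h : ℕ → ℤ} {l l' : List ℕ} (H : l.Perm l') : ht h l = ht h l' := by
  funext m; simp [ht, H.count_eq]

theorem Low.mem {j k : ℕ} {h : ℕ → ℤ} {l : List ℕ} (H : Low j k h l) :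
    ∀ i ∈ l, j ≤ i ∧ i ≤ k := by
  induction l with
  | nil => simp
  | cons i l ih => obtain ⟨h1, h2, h3, -⟩ := H; grind

theorem Low.isPath {j k : ℕ} {h : ℕ → ℤ} {l : List ℕ} (H : Low j k h l) (hp : IsPath j k h) :
    IsPath j k (ht h l) := by
  induction l with
  | nil => rwa [ht_nil]
  | cons i l ih =>
    obtain ⟨h1, h2, h3, h4⟩ := H
    have := ih h1
    intro m hm hm'
    have := this m hm hm'
    simp only [ht_cons]
    simp only [IsMax] at h4
    grind

theorem Low.restrict {j k j' k' : ℕ} {h : ℕ → ℤ} {l : List ℕ} (H : Low j k h l) (hj : j ≤ j')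
    (hk : k' ≤ k) (hl : ∀ i ∈ l, j' ≤ i ∧ i ≤ k') : Low j' k' h l := by
  induction l with
  | nil => trivial
  | cons i l ih =>
    obtain ⟨h1, h2, h3, h4⟩ := H
    refine ⟨ih h1 (by grind), (hl i (by simp)).1, (hl i (by simp)).2, ?_⟩
    simp only [IsMax] at h4 ⊢
    grind

/-- Shifting a path by a function that is constant near each letter of a lowering sequence. -/
theorem Low.add {j k : ℕ} {h φ : ℕ → ℤ} {l : List ℕ} (H : Low j k h l)
    (hl : ∀ i ∈ l, (j < i → φ (i - 1) = φ i) ∧ (i < k → φ (i + 1) = φ i)) :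
    Low j k (fun m => h m + φ m) l := by
  induction l with
  | nil => trivial
  | cons i l ih =>
    obtain ⟨h1, h2, h3, h4⟩ := H
    refine ⟨ih h1 (by grind), h2, h3, ?_⟩
    have := hl i (by simp)
    simp only [IsMax, ht] at h4 ⊢
    grind

/-! ### Reordering lowering sequences -/

section Unflip

variable {A : Type*} [Monoid A] {β : ℕ → A} {j k : ℕ}

/-- If a column that has been lowered is now a local minimum, its last lowering may be taken to
be the last step of the sequence. -/
theorem Low.unflip (hc : ∀ x y, j ≤ x → x + 2 ≤ y → y ≤ k → β x * β y = β y * β x)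
    {h : ℕ → ℤ} {l : List ℕ} (H : Low j k h l) {i : ℕ} (hij : j ≤ i) (hik : i ≤ k)
    (hmin : IsMin j k (ht h l) i) (hi : i ∈ l) :
    ∃ l', Low j k h l' ∧ l.Perm (i :: l') ∧ (l.map β).prod = β i * (l'.map β).prod := by
  induction l with
  | nil => simp at hi
  | cons m l ih =>
    obtain ⟨h1, h2, h3, h4⟩ := H
    by_cases hm : m = i
    · subst hm
      exact ⟨l, h1, List.Perm.refl _, by simp⟩
    -- A neighbour of `i` lowered in the last step would lie below `i`, which is impossible at a
    -- local minimum. So the head commutes with `β i`, and `i` can be pulled out of the tail.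
    · have hfar : m + 2 ≤ i ∨ i + 2 ≤ m := by
        by_contra hcon
        have : m = i + 1 ∨ i = m + 1 := by omega
        simp only [IsMin, IsMax, ht_cons] at hmin h4
        rcases this with rfl | rfl
        · have a := hmin.2 (by omega)
          have b := h4.1 (by omega)
          simp at a b
          grind
        · have a := hmin.1 (by omega)
          have b := h4.2 (by omega)
          simp at a b
          grind
      obtain ⟨l', hl', hp, hprod⟩ := ih h1 (by
        simp only [IsMin, ht_cons] at hmin ⊢
        grind) (by grind)
      refine ⟨m :: l', ⟨hl', h2, h3, ?_⟩, ?_, ?_⟩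
      · rw [ht_perm hp] at h4
        simp only [IsMax, ht_cons] at h4 ⊢
        grind
      · exact (hp.cons m).trans (List.Perm.swap _ _ _)
      · have : β m * β i = β i * β m := by
          rcases hfar with hf | hf
          · exact hc _ _ h2 hf hik
          · exact (hc _ _ hij hf h3).symm
        simp only [List.map_cons, List.prod_cons, hprod]
        rw [← mul_assoc, this, mul_assoc]

theorem Low.isMin_cons {h : ℕ → ℤ} {l : List ℕ} {i : ℕ} (H : Low j k h (i :: l)) :
    IsMin j k (ht h (i :: l)) i := by
  have := H.2.2.2
  simp only [IsMin, IsMax, ht_cons] at this ⊢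
  grind

/-- The product along a lowering sequence only depends on how often each column is lowered. -/
theorem Low.prod_eq (hc : ∀ x y, j ≤ x → x + 2 ≤ y → y ≤ k → β x * β y = β y * β x)
    {h : ℕ → ℤ} {l l' : List ℕ} (H : Low j k h l) (H' : Low j k h l') (hp : l.Perm l') :
    (l.map β).prod = (l'.map β).prod := by
  induction l generalizing l' with
  | nil => rw [List.nil_perm.mp hp]
  | cons i l ih =>
    -- Both sequences end in the same path, where the head of the first has just become a local
    -- minimum. So the second sequence can be rearranged to end in the same step.
    obtain ⟨l'', h1, h2, h3⟩ := H'.unflip hc H.2.1 H.2.2.1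
      (by rw [← ht_perm hp]; exact H.isMin_cons) (hp.mem_iff.mp (by simp))
    rw [h3, List.map_cons, List.prod_cons, ih H.1 h1 ((hp.trans h2).cons_inv)]

end Unflip

/-! ### Left-right reflection of lowering sequences -/

theorem count_map_sub {n : ℕ} {l : List ℕ} (hl : ∀ i ∈ l, i ≤ n) {m : ℕ} (hm : m ≤ n) :
    (l.map (n - ·)).count m = l.count (n - m) := by
  induction l with
  | nil => simp
  | cons i l ih =>
    have := hl i (by simp)
    simp only [List.map_cons, List.count_cons, ih (by grind), beq_iff_eq]
    grind

/-- Reflection of lowering sequences. -/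
theorem Low.reflect {n j k : ℕ} {h : ℕ → ℤ} {l : List ℕ} (H : Low j k h l) (hk : k ≤ n) :
    Low (n - k) (n - j) (fun m => h (n - m)) (l.map (n - ·)) := by
  induction l with
  | nil => trivial
  | cons i l ih =>
    obtain ⟨h1, h2, h3, h4⟩ := H
    refine ⟨ih h1, Nat.sub_le_sub_left h3 n, Nat.sub_le_sub_left h2 n, ?_⟩
    have hmem := h1.mem
    have hht : ∀ m ≤ n, ht (fun m => h (n - m)) (l.map (n - ·)) m = ht h l (n - m) := by
      intro m hm
      simp only [ht, count_map_sub (fun i hi => (hmem i hi).2.trans hk) hm]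
    simp only [IsMax] at h4 ⊢
    constructor
    · intro hlt
      rw [hht _ (by omega), hht _ (by omega), show n - (n - i - 1) = i + 1 by omega,
        show n - (n - i) = i by omega]
      exact h4.2 (by omega)
    · intro hlt
      rw [hht _ (by omega), hht _ (by omega), show n - (n - i + 1) = i - 1 by omega,
        show n - (n - i) = i by omega]
      exact h4.1 (by omega)

/-! ### Algebras with Temperley–Lieb generators -/

section Algebras

variable {K A : Type*} [CommRing K] [Ring A] [Algebra K A]

/-- The defining relations of the Temperley–Lieb algebra of type `C̃ₙ` in the rescaled generators
`bᵢ = gᵢ + 1`. -/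
structure IsTL (n : ℕ) (q : K) (b : ℕ → A) : Prop where
  sq : ∀ i, i ≤ n → b i * b i = (q + 1) • b i
  comm : ∀ i j, i + 2 ≤ j → j ≤ n → b i * b j = b j * b i
  up : ∀ i, 1 ≤ i → i + 2 ≤ n → b i * b (i + 1) * b i = q • b i
  down : ∀ i, 1 ≤ i → i + 2 ≤ n → b (i + 1) * b i * b (i + 1) = q • b (i + 1)
  left01 : b 0 * b 1 * b 0 * b 1 = (2 * q) • (b 0 * b 1)
  left10 : b 1 * b 0 * b 1 * b 0 = (2 * q) • (b 1 * b 0)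
  right01 : b n * b (n - 1) * b n * b (n - 1) = (2 * q) • (b n * b (n - 1))
  right10 : b (n - 1) * b n * b (n - 1) * b n = (2 * q) • (b (n - 1) * b n)

theorem IsTL.reflect {n : ℕ} {q : K} {b : ℕ → A} (H : IsTL n q b) (hn : 2 ≤ n) :
    IsTL n q (fun i => b (n - i)) where
  sq i hi := H.sq _ (by omega)
  comm i j h1 h2 := (H.comm _ _ (by omega) (by omega)).symm
  up i h1 h2 := by
    have := H.down (n - (i + 1)) (by omega) (by omega)
    rwa [show n - (i + 1) + 1 = n - i by omega] at this
  down i h1 h2 := by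
    have := H.up (n - (i + 1)) (by omega) (by omega)
    rwa [show n - (i + 1) + 1 = n - i by omega] at this
  left01 := by simpa using H.right01
  left10 := by simpa using H.right10
  right01 := by simpa [show n - (n - 1) = 1 by omega] using H.left01
  right10 := by simpa [show n - (n - 1) = 1 by omega] using H.left10

/-- The span of the words of length at most `N` in the generators `b 0, …, b n`. -/
def wordSpan (K : Type*) {A : Type*} [CommRing K] [Ring A] [Algebra K A] (n : ℕ) (b : ℕ → A)
    (N : ℕ) : Submodule K A :=
  Submodule.span K {a | ∃ l : List ℕ, (∀ i ∈ l, i ≤ n) ∧ l.length ≤ N ∧ a = (l.map b).prod}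

theorem wordSpan_mono {n : ℕ} {b : ℕ → A} {N N' : ℕ} (h : N ≤ N') :
    wordSpan K n b N ≤ wordSpan K n b N' := by
  apply Submodule.span_mono
  rintro a ⟨l, h1, h2, h3⟩
  exact ⟨l, h1, h2.trans h, h3⟩

theorem one_mem_wordSpan {n : ℕ} {b : ℕ → A} {N : ℕ} : (1 : A) ∈ wordSpan K n b N :=
  Submodule.subset_span ⟨[], by simp, by simp, by simp⟩

theorem gen_mem_wordSpan {n : ℕ} {b : ℕ → A} {i : ℕ} (h : i ≤ n) : b i ∈ wordSpan K n b 1 :=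
  Submodule.subset_span ⟨[i], by simpa, by simp, by simp⟩

theorem mul_mem_wordSpan {n : ℕ} {b : ℕ → A} {M N P : ℕ} {x y : A} (hx : x ∈ wordSpan K n b M)
    (hy : y ∈ wordSpan K n b N) (h : M + N ≤ P) : x * y ∈ wordSpan K n b P := by
  unfold wordSpan at hx hy ⊢
  induction hx using Submodule.span_induction with
  | mem x hx =>
    induction hy using Submodule.span_induction with
    | mem y hy =>
      obtain ⟨l, h1, h2, rfl⟩ := hx
      obtain ⟨l', h1', h2', rfl⟩ := hy
      exact Submodule.subset_span ⟨l ++ l', by grind, by grind, by simp⟩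
    | zero => simp
    | add y z _ _ h1 h2 => rw [mul_add]; exact add_mem h1 h2
    | smul c y _ h1 => rw [mul_smul_comm]; exact Submodule.smul_mem _ _ h1
  | zero => simp
  | add y z _ _ h1 h2 => rw [add_mul]; exact add_mem h1 h2
  | smul c y _ h1 => rw [smul_mul_assoc]; exact Submodule.smul_mem _ _ h1

theorem wordSpan_reflect {n : ℕ} {b : ℕ → A} {N : ℕ} :
    wordSpan K n (fun i => b (n - i)) N ≤ wordSpan K n b N := by
  apply Submodule.span_mono
  rintro a ⟨l, h1, h2, h3⟩
  exact ⟨l.map (n - ·), by grind, by simpa using h2, by simp [h3, Function.comp_def]⟩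

/-! ### Peaks -/

/-- The peak `b_j ⋯ b_1 b_0 b_1 ⋯ b_j`. -/
def peakL (b : ℕ → A) : ℕ → A
  | 0 => b 0
  | j + 1 => b (j + 1) * peakL b j * b (j + 1)

/-- The peak `b_k ⋯ b_{n-1} b_n b_{n-1} ⋯ b_k`. -/
def peakR (b : ℕ → A) (n k : ℕ) : A := peakL (fun i => b (n - i)) (n - k)

/-- The generators with the ones at the ends of the interval `[j, k]` replaced by peaks. -/
def peakGen (b : ℕ → A) (n j k m : ℕ) : A :=
  if m = j then peakL b j else if m = k then peakR b n k else b m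

/-- The number of letters of `peakGen b n j k m`. -/
def peakLen (n j k m : ℕ) : ℕ :=
  if m = j then 2 * j + 1 else if m = k then 2 * (n - k) + 1 else 1

theorem peakL_congr {b b' : ℕ → A} {j : ℕ} (h : ∀ i ≤ j, b i = b' i) :
    peakL b j = peakL b' j := by
  induction j with
  | zero => exact h 0 le_rfl
  | succ j ih => rw [peakL, peakL, ih (fun i hi => h i (by omega)), h _ le_rfl]

theorem peakR_self (b : ℕ → A) (n : ℕ) : peakR b n n = b n := by simp [peakR, peakL]

theorem peakR_step (b : ℕ → A) {n k : ℕ} (h : k < n) :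
    peakR b n k = b k * peakR b n (k + 1) * b k := by
  have : n - k = (n - (k + 1)) + 1 := by omega
  rw [peakR, peakR, this, peakL, show n - (n - (k + 1) + 1) = k by omega]

theorem peakR_reflect (b : ℕ → A) {n j : ℕ} (h : j ≤ n) :
    peakR (fun i => b (n - i)) n (n - j) = peakL b j := by
  rw [peakR, show n - (n - j) = j by omega]
  exact peakL_congr fun i hi => by rw [show n - (n - i) = i by omega]

theorem peakL_reflect (b : ℕ → A) {n k : ℕ} :
    peakL (fun i => b (n - i)) (n - k) = peakR b n k := rfl

theorem peakL_mem_wordSpan {n : ℕ} {b : ℕ → A} {j : ℕ} (h : j ≤ n) :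
    peakL b j ∈ wordSpan K n b (2 * j + 1) := by
  induction j with
  | zero => exact gen_mem_wordSpan h
  | succ j ih =>
    exact mul_mem_wordSpan (mul_mem_wordSpan (gen_mem_wordSpan h) (ih (by omega)) le_rfl)
      (gen_mem_wordSpan h) (by omega)

theorem peakR_mem_wordSpan {n : ℕ} {b : ℕ → A} {k : ℕ} :
    peakR b n k ∈ wordSpan K n b (2 * (n - k) + 1) :=
  wordSpan_reflect (peakL_mem_wordSpan (by omega))

theorem peakGen_mem_wordSpan {n : ℕ} {b : ℕ → A} {j k m : ℕ} (hj : j ≤ n) (hm : m ≤ n) :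
    peakGen b n j k m ∈ wordSpan K n b (peakLen n j k m) := by
  unfold peakGen peakLen
  split_ifs
  · exact peakL_mem_wordSpan hj
  · exact peakR_mem_wordSpan
  · exact gen_mem_wordSpan hm

theorem peakProd_mem_wordSpan {n : ℕ} {b : ℕ → A} {j k : ℕ} (hj : j ≤ n) {l : List ℕ}
    (hl : ∀ i ∈ l, i ≤ n) :
    (l.map (peakGen b n j k)).prod ∈ wordSpan K n b (l.map (peakLen n j k)).sum := by
  induction l with
  | nil => exact one_mem_wordSpan
  | cons m l ih =>
    simp only [List.map_cons, List.prod_cons, List.sum_cons]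
    exact mul_mem_wordSpan (peakGen_mem_wordSpan hj (hl m (by simp))) (ih (by grind)) le_rfl

theorem peakL_comm {n : ℕ} {q : K} {b : ℕ → A} (H : IsTL n q b) {j y : ℕ} (h : j + 2 ≤ y)
    (hy : y ≤ n) : peakL b j * b y = b y * peakL b j := by
  induction j with
  | zero => exact H.comm _ _ h hy
  | succ j ih =>
    rw [peakL, mul_assoc, H.comm _ _ h hy, ← mul_assoc, mul_assoc (b (j + 1)), ih (by omega),
      ← mul_assoc, H.comm _ _ h hy]
    simp only [mul_assoc]

/-- Elements commuting with all letters of a peak commute with the peak. -/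
theorem peakL_comm_of {b : ℕ → A} {j : ℕ} {x : A} (h : ∀ i ≤ j, b i * x = x * b i) :
    peakL b j * x = x * peakL b j := by
  induction j with
  | zero => exact h 0 le_rfl
  | succ j ih =>
    rw [peakL, mul_assoc, h _ le_rfl, ← mul_assoc, mul_assoc (b (j + 1)),
      ih (fun i hi => h i (by omega)), ← mul_assoc, h _ le_rfl]
    simp only [mul_assoc]

theorem peakR_comm {n : ℕ} {q : K} {b : ℕ → A} (H : IsTL n q b) {k x : ℕ} (h : x + 2 ≤ k)
    (hk : k ≤ n) : b x * peakR b n k = peakR b n k * b x := by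
  refine (peakL_comm_of fun i hi => ?_).symm
  exact (H.comm _ _ (by omega) (by omega)).symm

theorem peakGen_comm {n : ℕ} {q : K} {b : ℕ → A} (H : IsTL n q b) {j k : ℕ} (hk : k ≤ n) :
    ∀ x y, j ≤ x → x + 2 ≤ y → y ≤ k →
      peakGen b n j k x * peakGen b n j k y = peakGen b n j k y * peakGen b n j k x := by
  intro x y h1 h2 h3
  have e2 : peakGen b n j k x = if x = j then peakL b j else b x := by
    unfold peakGen; grind
  have e3 : peakGen b n j k y = if y = k then peakR b n k else b y := by
    unfold peakGen; grind
  rw [e2, e3]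
  split_ifs with ha hb hb
  · exact peakL_comm_of fun i hi => peakR_comm H (by omega) hk
  · exact peakL_comm H (by omega) (by omega)
  · exact peakR_comm H (by omega) hk
  · exact H.comm _ _ h2 (by omega)

end Algebras

end AffineTL

namespace AffineTL

/-! ### Zigzags -/

/-- The representative of `r` modulo `2 * n` in the interval `(-n, n]`. -/
def zigMod (n : ℕ) (r : ℤ) : ℤ := (r + (n - 1)) % (2 * n) - (n - 1)

/-- The `r`-th letter of the periodic word `⋯ 1 0 1 2 ⋯ n-1 n n-1 ⋯ 1 0 1 ⋯`. -/
def zig (n : ℕ) (r : ℤ) : ℕ := (zigMod n r).natAbs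

theorem zigMod_eq {n : ℕ} (p m : ℤ) (h1 : -(n : ℤ) < m) (h2 : m ≤ n) :
    zigMod n (2 * n * p + m) = m := by
  have : 2 * n * p + m + (n - 1) = (m + (n - 1)) + 2 * n * p := by ring
  rw [zigMod, this, Int.add_mul_emod_self_left, Int.emod_eq_of_lt (by omega) (by omega)]
  ring

theorem exists_zigMod {n : ℕ} (hn : 0 < n) (r : ℤ) :
    ∃ p m : ℤ, -(n : ℤ) < m ∧ m ≤ n ∧ r = 2 * n * p + m := by
  refine ⟨(r + (n - 1)) / (2 * n), zigMod n r, ?_, ?_, ?_⟩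
  · have := Int.emod_nonneg (r + (n - 1)) (b := 2 * n) (by omega)
    rw [zigMod]; omega
  · have := Int.emod_lt_of_pos (r + (n - 1)) (b := 2 * n) (by omega)
    rw [zigMod]; omega
  · have := Int.mul_ediv_add_emod (r + (n - 1)) (2 * n)
    rw [zigMod]; linarith

theorem zig_eq {n : ℕ} (p m : ℤ) (h1 : -(n : ℤ) < m) (h2 : m ≤ n) :
    zig n (2 * n * p + m) = m.natAbs := by
  rw [zig, zigMod_eq p m h1 h2]

theorem zig_eq_self {n : ℕ} (m : ℤ) (h1 : -(n : ℤ) ≤ m) (h2 : m ≤ n) : zig n m = m.natAbs := by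
  rcases h1.lt_or_eq with h | h
  · simpa using zig_eq 0 m h h2
  · rcases Nat.eq_zero_or_pos n with rfl | hn
    · simp at h; subst h; simp [zig, zigMod]
    · have := zig_eq (-1) (n : ℤ) (by omega) le_rfl
      rw [show 2 * (n : ℤ) * (-1) + n = -n by ring] at this
      rw [← h, this]; omega

theorem zig_succ {n : ℕ} (p m : ℤ) (h1 : -(n : ℤ) < m) (h2 : m ≤ n) (hn : 0 < n) :
    zig n (2 * n * p + m + 1) = if m = n then n - 1 else (m + 1).natAbs := by
  split_ifs with h
  · subst h
    have := zig_eq (n := n) (p + 1) (-n + 1) (by omega) (by omega)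
    rw [show 2 * (n : ℤ) * (p + 1) + (-n + 1) = 2 * n * p + n + 1 by ring] at this
    rw [this]; omega
  · rw [add_assoc, zig_eq _ _ (by omega) (by omega)]

theorem zig_pred {n : ℕ} (p m : ℤ) (h1 : -(n : ℤ) < m) (h2 : m ≤ n) (hn : 0 < n) :
    zig n (2 * n * p + m - 1) = (m - 1).natAbs := by
  by_cases h : m = -n + 1
  · subst h
    have := zig_eq (n := n) (p - 1) n (by omega) (by omega)
    rw [show 2 * (n : ℤ) * (p - 1) + n = 2 * n * p + (-n + 1) - 1 by ring] at this
    rw [this]; omega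
  · rw [add_sub_assoc, zig_eq _ _ (by omega) (by omega)]

theorem zig_le {n : ℕ} (hn : 0 < n) (r : ℤ) : zig n r ≤ n := by
  obtain ⟨p, m, h1, h2, rfl⟩ := exists_zigMod hn r
  rw [zig_eq p m h1 h2]; omega

theorem zig_adj {n : ℕ} (hn : 0 < n) (r : ℤ) :
    zig n (r + 1) = zig n r + 1 ∨ zig n r = zig n (r + 1) + 1 := by
  obtain ⟨p, m, h1, h2, rfl⟩ := exists_zigMod hn r
  rw [zig_eq p m h1 h2, zig_succ p m h1 h2 hn]
  split_ifs <;> omega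

theorem zig_turn {n : ℕ} (hn : 0 < n) (r : ℤ) :
    (0 < zig n r ∧ zig n r < n ∧ zig n (r + 1) + zig n (r - 1) = 2 * zig n r) ∨
      (zig n r = 0 ∧ zig n (r + 1) = 1 ∧ zig n (r - 1) = 1) ∨
      (zig n r = n ∧ zig n (r + 1) + 1 = n ∧ zig n (r - 1) + 1 = n) := by
  obtain ⟨p, m, h1, h2, rfl⟩ := exists_zigMod hn r
  rw [zig_eq p m h1 h2, zig_succ p m h1 h2 hn, zig_pred p m h1 h2 hn]
  split_ifs <;> omega

theorem zig_add {n : ℕ} (hn : 0 < n) (r : ℤ) : zig n (r + n) = n - zig n r := by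
  obtain ⟨p, m, h1, h2, rfl⟩ := exists_zigMod hn r
  rw [zig_eq p m h1 h2]
  by_cases h : m ≤ 0
  · rw [add_assoc, zig_eq p _ (by omega) (by omega)]; omega
  · have := zig_eq (n := n) (p + 1) (m - n) (by omega) (by omega)
    rw [show 2 * (n : ℤ) * (p + 1) + (m - n) = 2 * n * p + m + n by ring] at this
    rw [this]; omega

theorem zig_period {n : ℕ} (hn : 0 < n) (r : ℤ) : zig n (r + 2 * n) = zig n r := by
  have := zig_le hn r
  rw [show r + 2 * (n : ℤ) = r + n + n by ring, zig_add hn, zig_add hn]; omega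

/-- Every letter occurs in each window of length `2 * n`. -/
theorem exists_zig_eq {n : ℕ} (hn : 0 < n) (s : ℤ) {i : ℕ} (hi : i ≤ n) :
    ∃ r, s < r ∧ r ≤ s + 2 * n ∧ zig n r = i := by
  obtain ⟨p, m, h1, h2, rfl⟩ := exists_zigMod hn s
  by_cases h : m < i
  · exact ⟨2 * n * p + i, by omega, by omega, by rw [zig_eq _ _ (by omega) (by omega)]; omega⟩
  · rcases (not_lt.mp h).eq_or_lt with rfl | h
    · exact ⟨2 * n * (p + 1) + i, by rw [mul_add]; omega, by rw [mul_add]; omega,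
        by rw [zig_eq _ _ (by omega) (by omega)]; omega⟩
    refine ⟨2 * n * (p + 1) + (-i), by rw [mul_add]; omega, by rw [mul_add]; omega, ?_⟩
    by_cases hi' : i = n
    · subst hi'
      have := zig_eq (n := i) p i (by omega) (by omega)
      rw [show 2 * (i : ℤ) * (p + 1) + -i = 2 * i * p + i by ring, this]; omega
    · rw [zig_eq _ _ (by omega) (by omega)]; omega

/-- The product of the letters `s, s + 1, …, s + L` of the periodic zigzag, from right to left. -/
def zigProd {A : Type*} [Monoid A] (n : ℕ) (b : ℕ → A) (s : ℤ) : ℕ → A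
  | 0 => b (zig n s)
  | L + 1 => b (zig n (s + (L + 1 : ℕ))) * zigProd n b s L

section Zigzag

variable {K A : Type*} [CommRing K] [Ring A] [Algebra K A]

theorem zigProd_append (n : ℕ) (b : ℕ → A) (s : ℤ) (L M : ℕ) :
    zigProd n b s (L + M + 1) = zigProd n b (s + L + 1) M * zigProd n b s L := by
  induction M with
  | zero => simp [zigProd, add_assoc]
  | succ M ih =>
    rw [← add_assoc, zigProd, ih, zigProd, mul_assoc]
    congr 3
    push_cast; ring

theorem zigProd_reflect {n : ℕ} (hn : 0 < n) (b : ℕ → A) (s : ℤ) (L : ℕ) :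
    zigProd n (fun i => b (n - i)) s L = zigProd n b (s + n) L := by
  induction L with
  | zero => simp only [zigProd, zig_add hn]
  | succ L ih =>
    simp only [zigProd, ih]
    rw [show s + n + ((L + 1 : ℕ) : ℤ) = s + (L + 1 : ℕ) + n by ring, zig_add hn]

theorem peakL_eq_zigProd {n : ℕ} (b : ℕ → A) {j : ℕ} (hj : j ≤ n) :
    peakL b j = zigProd n b (-j) (2 * j) := by
  induction j with
  | zero => simp [peakL, zigProd, zig_eq_self]
  | succ j ih =>
    have e := zigProd_append n b (-((j + 1 : ℕ) : ℤ)) 0 (2 * j)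
    rw [show 2 * (j + 1) = (0 + 2 * j + 1) + 1 by ring, zigProd, e, peakL, ih (by omega), zigProd,
      zig_eq_self _ (by omega) (by omega), zig_eq_self _ (by omega) (by omega), mul_assoc]
    congr 3
    · omega
    · push_cast; ring

theorem peakR_eq_zigProd {n : ℕ} (hn : 0 < n) (b : ℕ → A) {k : ℕ} (hk : k ≤ n) :
    peakR b n k = zigProd n b k (2 * (n - k)) := by
  rw [peakR, peakL_eq_zigProd _ (n := n) (by omega), zigProd_reflect hn]
  congr 1
  omega

theorem zigProd_mem_wordSpan {n : ℕ} (hn : 0 < n) (b : ℕ → A) (s : ℤ) (L : ℕ) :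
    zigProd n b s L ∈ wordSpan K n b (L + 1) := by
  induction L with
  | zero => exact gen_mem_wordSpan (zig_le hn _)
  | succ L ih => exact mul_mem_wordSpan (gen_mem_wordSpan (zig_le hn _)) ih (by omega)

/-- Read from the right, the left peak runs `j ⋯ 0 ⋯ j`, the right peak runs `j+1 ⋯ n ⋯ j+1`, and
the last `j` completes a full period. This is how a peak product on a two-column interval turns into
the shortest long zigzag. -/
theorem peakR_mul_peakL {n : ℕ} (b : ℕ → A) {j : ℕ} (hj : j < n) :
    b j * (peakR b n (j + 1) * peakL b j) = zigProd n b (-j) (2 * n) := by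
  have e := zigProd_append n b (-(j : ℤ)) (2 * j) (2 * (n - (j + 1)))
  obtain ⟨d, rfl⟩ : ∃ d, n = j + 1 + d := ⟨n - (j + 1), by omega⟩
  rw [peakR_eq_zigProd (by omega) _ (by omega), peakL_eq_zigProd (n := j + 1 + d) _ (by omega),
    show 2 * (j + 1 + d) = (2 * j + 2 * (j + 1 + d - (j + 1)) + 1) + 1 by omega, zigProd, e]
  have h1 : zig (j + 1 + d) (-(j : ℤ) + ((2 * j + 2 * (j + 1 + d - (j + 1)) + 1 + 1 : ℕ) : ℤ))
      = j := by
    have := zig_period (n := j + 1 + d) (by omega) (-j)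
    rw [zig_eq_self (-(j : ℤ)) (by omega) (by omega)] at this
    rw [show (-(j : ℤ) + ((2 * j + 2 * (j + 1 + d - (j + 1)) + 1 + 1 : ℕ) : ℤ))
      = -j + 2 * (j + 1 + d : ℕ) by omega, this]
    omega
  rw [h1]
  congr 3
  omega

/-- The other way a two-column interval produces a zigzag: its right end is `n`, which may have been
lowered once before the left peak, so the zigzag starts one letter earlier. -/
theorem peakL_mul_right {n : ℕ} (b : ℕ → A) {j : ℕ} (hj : j + 1 = n) :
    b j * (b n * (peakL b j * b n)) = zigProd n b (-n) (2 * n + 1) := by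
  have e := zigProd_append n b (-(n : ℤ)) 0 (2 * j)
  have h1 : zig n (-(n : ℤ) + ((0 + 2 * j + 1 + 1 : ℕ) : ℤ)) = n := by
    rw [zig_eq_self _ (by omega) (by omega)]; omega
  have h2 : zig n (-(n : ℤ) + ((0 + 2 * j + 1 + 1 + 1 : ℕ) : ℤ)) = j := by
    have := zig_period (n := n) (by omega) (-j)
    rw [zig_eq_self (-(j : ℤ)) (by omega) (by omega)] at this
    rw [show (-(n : ℤ) + ((0 + 2 * j + 1 + 1 + 1 : ℕ) : ℤ)) = -j + 2 * n by omega, this]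
    omega
  rw [show 2 * n + 1 = (0 + 2 * j + 1) + 1 + 1 by omega, zigProd, zigProd, e, h1, h2,
    peakL_eq_zigProd (n := n) _ (by omega), zigProd, zig_eq_self _ (by omega) (by omega)]
  congr 4
  · omega
  · omega

/-- Left multiplication of a long zigzag by a letter that does not extend it. -/
theorem mul_zigProd_mem_wordSpan {n : ℕ} {q : K} {b : ℕ → A} (H : IsTL n q b) (hn : 2 ≤ n)
    {i : ℕ} (hi : i ≤ n) (s : ℤ) (L : ℕ) (h1 : i ≠ zig n (s + L + 1))
    (h2 : ∃ r, s < r ∧ r ≤ s + L ∧ zig n r = i) :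
    b i * zigProd n b s L ∈ wordSpan K n b (L + 1) := by
  have hn0 : 0 < n := by omega
  induction L with
  | zero => obtain ⟨r, h, h', -⟩ := h2; simp at h'; omega
  | succ L ih =>
    rw [zigProd]
    have hle := zig_le hn0 (s + (L + 1 : ℕ))
    have hturn := zig_turn hn0 (s + (L + 1 : ℕ))
    have hadj := zig_adj hn0 (s + L)
    rw [show s + ((L + 1 : ℕ) : ℤ) - 1 = s + L by push_cast; ring] at hturn
    rw [show s + (L : ℤ) + 1 = s + (L + 1 : ℕ) by push_cast; ring] at hadj
    by_cases hsame : i = zig n (s + (L + 1 : ℕ))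
    · rw [← hsame, ← mul_assoc, H.sq _ hi, smul_mul_assoc]
      exact Submodule.smul_mem _ _ (mul_mem_wordSpan (gen_mem_wordSpan hi)
        (zigProd_mem_wordSpan hn0 b s L) (by omega))
    have hr : ∃ r, s < r ∧ r ≤ s + L ∧ zig n r = i := by
      obtain ⟨r, h, h', h''⟩ := h2
      refine ⟨r, h, ?_, h''⟩
      by_contra hcon
      apply hsame
      rw [← h'']
      congr 1
      push_cast at h' ⊢
      omega
    by_cases hfar : i + 2 ≤ zig n (s + (L + 1 : ℕ)) ∨ zig n (s + (L + 1 : ℕ)) + 2 ≤ i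
    · have hc : b i * b (zig n (s + (L + 1 : ℕ))) = b (zig n (s + (L + 1 : ℕ))) * b i := by
        rcases hfar with hf | hf
        · exact H.comm _ _ hf hle
        · exact (H.comm _ _ hf hi).symm
      rw [← mul_assoc, hc, mul_assoc]
      refine mul_mem_wordSpan (gen_mem_wordSpan hle) (ih ?_ hr) (by omega)
      rw [show s + (L : ℤ) + 1 = s + (L + 1 : ℕ) by push_cast; ring]
      exact hsame
    -- The letter `i` is a neighbour of the top letter but not the one that continues the zigzag, so
    -- it repeats the letter just below the top. The occurrence strictly after position `s`
    -- guarantees one further letter below that.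
    · have hi1 : i = zig n (s + L) := by omega
      obtain ⟨L, rfl⟩ : ∃ L', L = L' + 1 := by
        rcases L with _ | L
        · obtain ⟨r, h, h', -⟩ := hr
          simp at h'; omega
        · exact ⟨L, rfl⟩
      rw [zigProd, ← hi1]
      set m := zig n (s + ((L + 1 + 1 : ℕ) : ℤ)) with hm
      have hm1 : 0 < m ∧ m < n := by omega
      by_cases hint : 0 < i ∧ i < n
      · have hb : b i * b m * b i = q • b i := by
          have : m = i + 1 ∨ i = m + 1 := by omega
          rcases this with h | h
          · rw [h]; exact H.up _ (by omega) (by omega)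
          · rw [h]; exact H.down _ (by omega) (by omega)
        rw [← mul_assoc, ← mul_assoc, hb, smul_mul_assoc]
        exact Submodule.smul_mem _ _ (mul_mem_wordSpan (gen_mem_wordSpan hi)
          (zigProd_mem_wordSpan hn0 b s L) (by omega))
      -- Here `i` is `0` or `n`, where the zigzag turns, so the word starts with `i m i m` and the
      -- relation of degree four shortens it.
      · have hturn' := zig_turn hn0 (s + (L + 1 : ℕ))
        rw [show s + ((L + 1 : ℕ) : ℤ) + 1 = s + (L + 1 + 1 : ℕ) by push_cast; ring,
          show s + ((L + 1 : ℕ) : ℤ) - 1 = s + L by push_cast; ring, ← hi1] at hturn'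
        have hm2 : zig n (s + L) = m := by omega
        have key : ∀ X : A, b i * (b m * (b i * (b m * X))) = (2 * q) • (b i * (b m * X)) := by
          intro X
          have : b i * b m * b i * b m = (2 * q) • (b i * b m) := by
            rcases (show (i = 0 ∧ m = 1) ∨ (i = n ∧ m = n - 1) by omega) with ⟨h, h'⟩ | ⟨h, h'⟩
            · rw [h, h']; exact H.left01
            · rw [h, h']; exact H.right01
          simp only [← mul_assoc]
          rw [this, smul_mul_assoc]
        rcases L with _ | L
        · simp only [zigProd, CharP.cast_eq_zero, add_zero] at hm2 ⊢
          have := key 1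
          simp only [mul_one] at this
          rw [hm2, this]
          exact Submodule.smul_mem _ _ (mul_mem_wordSpan (gen_mem_wordSpan hi)
            (gen_mem_wordSpan hle) (by omega))
        · rw [zigProd, hm2, key, ← hm2, ← zigProd]
          exact Submodule.smul_mem _ _ (mul_mem_wordSpan (gen_mem_wordSpan hi)
            (zigProd_mem_wordSpan hn0 b s _) (by omega))

end Zigzag

end AffineTL

namespace AffineTL

/-! ### A spanning family -/

/-- A lowering sequence on the columns `j, …, k` in which the ends of the interval, when they are
inner columns, occur exactly once. -/
structure IsPeakSeq (n j k : ℕ) (h : ℕ → ℤ) (l : List ℕ) : Prop where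
  lt : j < k
  le : k ≤ n
  path : IsPath j k h
  low : Low j k h l
  left : 1 ≤ j → l.count j = 1
  right : k < n → l.count k = 1

section Family

variable {K A : Type*} [CommRing K] [Ring A] [Algebra K A]

/-- The members of length `N` of the spanning family: products along lowering sequences whose end
letters are replaced by peaks, and long zigzags. -/
def IsFam (n : ℕ) (b : ℕ → A) (N : ℕ) (a : A) : Prop :=
  (∃ j k h l, IsPeakSeq n j k h l ∧ a = (l.map (peakGen b n j k)).prod ∧
    N = (l.map (peakLen n j k)).sum) ∨
  ∃ s L, 2 * n ≤ L ∧ a = zigProd n b s L ∧ N = L + 1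

theorem IsPeakSeq.mem_le {n j k : ℕ} {h : ℕ → ℤ} {l : List ℕ} (D : IsPeakSeq n j k h l) :
    ∀ i ∈ l, i ≤ n := fun i hi => (D.low.mem i hi).2.trans D.le

theorem IsPeakSeq.reflect {n j k : ℕ} {h : ℕ → ℤ} {l : List ℕ} (D : IsPeakSeq n j k h l) :
    IsPeakSeq n (n - k) (n - j) (fun m => h (n - m)) (l.map (n - ·)) where
  lt := by have := D.lt; have := D.le; omega
  le := by omega
  path i h1 h2 := by
    have := D.path (n - (i + 1)) (by omega) (by have := D.le; omega)
    rw [show n - (i + 1) + 1 = n - i by omega] at this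
    dsimp only
    omega
  low := D.low.reflect D.le
  left h := by
    have := D.le
    rw [count_map_sub D.mem_le (by omega), show n - (n - k) = k by omega]
    exact D.right (by omega)
  right h := by
    have := D.le
    have := D.lt
    rw [count_map_sub D.mem_le (by omega), show n - (n - j) = j by omega]
    exact D.left (by omega)

theorem peakGen_reflect (b : ℕ → A) {n j k m : ℕ} (hj : j < k) (hk : k ≤ n) (hm : m ≤ n) :
    peakGen (fun i => b (n - i)) n (n - k) (n - j) (n - m) = peakGen b n j k m := by
  unfold peakGen
  rw [peakL_reflect, peakR_reflect b (by omega)]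
  dsimp only
  rw [show n - (n - m) = m by omega]
  split_ifs <;> first | rfl | omega

theorem peakLen_reflect {n j k m : ℕ} (hj : j < k) (hk : k ≤ n) (hm : m ≤ n) :
    peakLen n (n - k) (n - j) (n - m) = peakLen n j k m := by
  unfold peakLen
  split_ifs <;> omega

theorem IsPeakSeq.prod_reflect {n j k : ℕ} {h : ℕ → ℤ} {l : List ℕ} (D : IsPeakSeq n j k h l)
    (b : ℕ → A) :
    ((l.map (n - ·)).map (peakGen (fun i => b (n - i)) n (n - k) (n - j))).prod
      = (l.map (peakGen b n j k)).prod := by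
  rw [List.map_map]
  congr 1
  exact List.map_congr_left fun m hm => peakGen_reflect b D.lt D.le (D.mem_le m hm)

theorem IsPeakSeq.sum_reflect {n j k : ℕ} {h : ℕ → ℤ} {l : List ℕ} (D : IsPeakSeq n j k h l) :
    ((l.map (n - ·)).map (peakLen n (n - k) (n - j))).sum = (l.map (peakLen n j k)).sum := by
  rw [List.map_map]
  congr 1
  exact List.map_congr_left fun m hm => peakLen_reflect D.lt D.le (D.mem_le m hm)

theorem IsFam.reflect {n : ℕ} (hn : 0 < n) {b : ℕ → A} {N : ℕ} {a : A}
    (H : IsFam n (fun i => b (n - i)) N a) : IsFam n b N a := by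
  rcases H with ⟨j, k, h, l, D, rfl, rfl⟩ | ⟨s, L, hL, rfl, rfl⟩
  · refine .inl ⟨_, _, _, _, D.reflect, ?_, D.sum_reflect.symm⟩
    rw [← D.prod_reflect]
    congr 1
    refine List.map_congr_left fun m hm => ?_
    have := D.reflect.mem_le m hm
    have hlt := D.reflect.lt
    have := D.reflect.le
    unfold peakGen
    split_ifs
    · exact peakL_congr fun i hi => by rw [show n - (n - i) = i by omega]
    · exact peakL_congr fun i hi => by dsimp only; rw [show n - (n - (n - i)) = n - i by omega]
    · dsimp only; rw [show n - (n - m) = m by omega]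
  · exact .inr ⟨_, L, hL, zigProd_reflect hn b s L, rfl⟩

/-! ### Left multiplication of the family by generators -/

/-- A word of length `N + 1` reduces to shorter words, or belongs to the family. -/
def Closes (K : Type*) {A : Type*} [CommRing K] [Ring A] [Algebra K A] (n : ℕ) (b : ℕ → A)
    (N : ℕ) (a : A) : Prop :=
  a ∈ wordSpan K n b N ∨ IsFam n b (N + 1) a

theorem Closes.reflect {n : ℕ} (hn : 0 < n) {b : ℕ → A} {N : ℕ} {a : A}
    (H : Closes K n (fun i => b (n - i)) N a) : Closes K n b N a :=
  H.imp (fun h => wordSpan_reflect h) (fun h => h.reflect hn)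

/-- To close the family under multiplication by `b i`, one may reflect. -/
theorem closes_of_reflect {n : ℕ} (hn : 0 < n) {b : ℕ → A} {j k i : ℕ} {h : ℕ → ℤ} {l : List ℕ}
    (D : IsPeakSeq n j k h l) (hi : i ≤ n)
    (H : Closes K n (fun i => b (n - i)) (((l.map (n - ·)).map (peakLen n (n - k) (n - j))).sum)
      ((fun i => b (n - i)) (n - i) *
        ((l.map (n - ·)).map (peakGen (fun i => b (n - i)) n (n - k) (n - j))).prod)) :
    Closes K n b (l.map (peakLen n j k)).sum (b i * (l.map (peakGen b n j k)).prod) := by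
  have := H.reflect hn
  rw [D.prod_reflect, D.sum_reflect] at this
  simpa only [show n - (n - i) = i by omega] using this

theorem peakGen_left (b : ℕ → A) (n j k : ℕ) : peakGen b n j k j = peakL b j := by
  simp [peakGen]

theorem peakGen_right (b : ℕ → A) {n j k : ℕ} (h : j < k) :
    peakGen b n j k k = peakR b n k := by
  simp [peakGen, h.ne']

theorem peakGen_inner (b : ℕ → A) {n j k m : ℕ} (h1 : j < m) (h2 : m < k) :
    peakGen b n j k m = b m := by
  simp [peakGen, h1.ne', h2.ne]

theorem peakLen_inner {n j k m : ℕ} (h1 : j < m) (h2 : m < k) : peakLen n j k m = 1 := by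
  simp [peakLen, h1.ne', h2.ne]

theorem peakLen_pos {n j k m : ℕ} : 1 ≤ peakLen n j k m := by
  unfold peakLen; split_ifs <;> omega

theorem gen_comm_peakGen {n : ℕ} {q : K} {b : ℕ → A} (H : IsTL n q b) {j k i m : ℕ}
    (hk : k ≤ n) (him : i + 2 ≤ m) (hj : j < m) (hm : m ≤ k) :
    b i * peakGen b n j k m = peakGen b n j k m * b i := by
  unfold peakGen
  split_ifs with h1 h2
  · omega
  · exact peakR_comm H (by omega) hk
  · exact H.comm _ _ him (by omega)

theorem peakL_mul_left {n : ℕ} {q : K} {b : ℕ → A} (H : IsTL n q b) {j : ℕ} (h1 : 1 ≤ j)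
    (h2 : j ≤ n) : b j * peakL b j = (q + 1) • peakL b j := by
  obtain ⟨j, rfl⟩ : ∃ j', j = j' + 1 := ⟨j - 1, by omega⟩
  simp only [peakL, ← mul_assoc, H.sq _ h2, smul_mul_assoc]

theorem up_peakL {n : ℕ} {q : K} {b : ℕ → A} (H : IsTL n q b) {j : ℕ} (h1 : 1 ≤ j)
    (h2 : j + 2 ≤ n) : b j * (b (j + 1) * peakL b j) = q • peakL b j := by
  obtain ⟨j, rfl⟩ : ∃ j', j = j' + 1 := ⟨j - 1, by omega⟩
  simp only [peakL, ← mul_assoc, H.up _ h1 h2, smul_mul_assoc]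

/-- The letter `i` passes the larger letters of the descending leg until it forms `b_i b_{i+1} b_i`,
or `b_0 b_1 b_0 b_1` at the bottom. Either relation makes the product of `2j + 2` letters shorter.
-/
theorem mul_peakL_mem {n : ℕ} {q : K} {b : ℕ → A} (H : IsTL n q b) {i j : ℕ} (hi : i < j)
    (hj : j < n) : b i * peakL b j ∈ wordSpan K n b (2 * j + 1) := by
  induction j with
  | zero => omega
  | succ j ih =>
    by_cases hij : i = j
    · subst hij
      rcases i with _ | i
      · simp only [peakL, ← mul_assoc]
        rw [zero_add, H.left01]
        exact Submodule.smul_mem _ _ (mul_mem_wordSpan (gen_mem_wordSpan (by omega))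
          (gen_mem_wordSpan (by omega)) (by omega))
      · rw [peakL, ← mul_assoc, up_peakL H (by omega) (by omega), smul_mul_assoc]
        exact Submodule.smul_mem _ _ (mul_mem_wordSpan (peakL_mem_wordSpan (by omega))
          (gen_mem_wordSpan hj.le) (by omega))
    · rw [peakL, ← mul_assoc, ← mul_assoc, H.comm _ _ (by omega) hj.le, mul_assoc (b (j + 1))]
      exact mul_mem_wordSpan (mul_mem_wordSpan (gen_mem_wordSpan hj.le)
        (ih (by omega) (by omega)) le_rfl) (gen_mem_wordSpan hj.le) (by omega)

/-- Adding a letter at a local maximum. -/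
theorem closes_max {n : ℕ} {b : ℕ → A} {j k i : ℕ} {h : ℕ → ℤ} {l : List ℕ}
    (D : IsPeakSeq n j k h l) (hij : j ≤ i) (hik : i < k) (hj : j = i → j = 0)
    (hmax : IsMax j k (ht h l) i) :
    Closes K n b (l.map (peakLen n j k)).sum (b i * (l.map (peakGen b n j k)).prod) := by
  refine .inr (.inl ⟨j, k, h, i :: l, ⟨D.lt, D.le, D.path, ⟨D.low, hij, hik.le, hmax⟩, ?_, ?_⟩,
    ?_, ?_⟩)
  · intro h1
    rw [List.count_cons_of_ne (by omega)]
    exact D.left h1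
  · intro h1
    rw [List.count_cons_of_ne (by omega)]
    exact D.right h1
  · simp only [List.map_cons, List.prod_cons]
    congr 1
    by_cases hji : j = i
    · obtain rfl := hj hji
      subst hji
      simp [peakGen, peakL]
    · rw [peakGen_inner b (by omega) hik]
  · simp only [List.map_cons, List.sum_cons]
    have : peakLen n j k i = 1 := by
      unfold peakLen; split_ifs <;> omega
    omega

/-- Adding a letter that does not occur yet at a local minimum. -/
theorem closes_min_new {n : ℕ} {b : ℕ → A} {j k i : ℕ} {h : ℕ → ℤ} {l : List ℕ}
    (D : IsPeakSeq n j k h l) (hij : j ≤ i) (hik : i < k) (hj : j = i → j = 0)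
    (hmin : IsMin j k (ht h l) i) (hi : i ∉ l) :
    Closes K n b (l.map (peakLen n j k)).sum (b i * (l.map (peakGen b n j k)).prod) := by
  have hi0 := List.count_eq_zero_of_not_mem hi
  have hr : l.count (i + 1) = 0 := by
    have := D.path i hij hik
    have := hmin.2 hik
    simp only [ht] at this
    omega
  have hl : j < i → l.count (i - 1) = 0 := by
    intro hlt
    have := D.path (i - 1) (by omega) (by omega)
    have h2 := hmin.1 hlt
    rw [show i - 1 + 1 = i by omega] at this
    simp only [ht] at h2
    omega
  have hr' := List.count_eq_zero.mp hr
  have hl' := fun h => List.count_eq_zero.mp (hl h)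
  -- Neither `i` nor a neighbour has been lowered, so the valley at `i` was there from the start.
  -- Raising the initial path by `2` at `i` leaves the sequence valid and makes `i` a local maximum.
  have hD : IsPeakSeq n j k (fun m => h m + if m = i then 2 else 0) l := by
    refine ⟨D.lt, D.le, ?_, D.low.add ?_, D.left, D.right⟩
    · intro m h1 h2
      have := D.path m h1 h2
      simp only [IsMin, ht] at hmin
      grind
    · have := D.low.mem
      grind
  refine closes_max hD hij hik hj ?_
  simp only [IsMin, IsMax, ht] at hmin ⊢
  grind

theorem sum_peakLen_perm {n j k : ℕ} {l l' : List ℕ} (h : l.Perm l') :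
    (l.map (peakLen n j k)).sum = (l'.map (peakLen n j k)).sum :=
  (h.map _).sum_eq

/-- A letter that occurs already and is a local minimum. -/
theorem closes_min_old {n : ℕ} {q : K} {b : ℕ → A} (H : IsTL n q b) {j k i : ℕ} {h : ℕ → ℤ}
    {l : List ℕ} (D : IsPeakSeq n j k h l) (hij : j ≤ i) (hik : i < k)
    (hmin : IsMin j k (ht h l) i) (hi : i ∈ l) :
    Closes K n b (l.map (peakLen n j k)).sum (b i * (l.map (peakGen b n j k)).prod) := by
  have hk := D.le
  obtain ⟨l', h1, h2, h3⟩ := D.low.unflip (peakGen_comm H D.le) hij hik.le hmin hi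
  have hsq : b i * peakGen b n j k i = (q + 1) • peakGen b n j k i := by
    unfold peakGen
    split_ifs with hj hk
    · subst hj
      rcases Nat.eq_zero_or_pos i with rfl | hpos
      · exact H.sq _ (by omega)
      · exact peakL_mul_left H hpos (by omega)
    · omega
    · exact H.sq _ (by omega)
  left
  rw [h3, ← mul_assoc, hsq, smul_mul_assoc, sum_peakLen_perm h2, ← List.prod_cons, ← List.map_cons]
  exact Submodule.smul_mem _ _ (peakProd_mem_wordSpan (by omega)
    fun m hm => D.mem_le m (h2.mem_iff.mpr hm))

/-- Multiplication by a letter at a slope reduces if the letter occurs already and the end of the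
interval is not involved. -/
theorem slope_mem_wordSpan {n : ℕ} {q : K} {b : ℕ → A} (H : IsTL n q b) {j k i : ℕ} {h : ℕ → ℤ}
    {l : List ℕ} (hk : k ≤ n) (D : Low j k h l) (hij : j + 1 < i) (hik : i < k)
    (h1 : ht h l (i - 1) = ht h l i - 1) (h2 : ht h l (i + 1) = ht h l i + 1) (hi : i ∈ l) :
    b i * (l.map (peakGen b n j k)).prod ∈ wordSpan K n b (l.map (peakLen n j k)).sum := by
  induction l with
  | nil => simp at hi
  | cons m l ih =>
    have hmin := D.isMin_cons
    obtain ⟨D1, hjm, hmk, hmax⟩ := D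
    simp only [List.map_cons, List.prod_cons, List.sum_cons]
    have hmem := D1.mem
    -- If `i - 1` was lowered last, then `i` was a local minimum before. Its own last lowering can
    -- be moved next to `i - 1`, giving `b_i b_{i-1} b_i`. As `j + 1 < i`, the letter `i - 1` is
    -- inner and not a peak.
    by_cases hm1 : m = i - 1
    · subst hm1
      simp only [ht_cons] at h1 h2
      obtain ⟨l', h3, h4, h5⟩ := D1.unflip (peakGen_comm H hk) (i := i) (by omega) hik.le
        (by simp only [IsMin]; grind) (by grind)
      have hb : b i * b (i - 1) * b i = q • b i := by
        have := H.down (i - 1) (by omega) (by omega)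
        rwa [show i - 1 + 1 = i by omega] at this
      rw [h5, peakGen_inner b (by omega) (by omega), peakGen_inner b (by omega) hik, ← mul_assoc,
        ← mul_assoc, hb, smul_mul_assoc, sum_peakLen_perm h4]
      have := h3.mem
      refine Submodule.smul_mem _ _ (mul_mem_wordSpan (gen_mem_wordSpan (by omega))
        (peakProd_mem_wordSpan (by omega) (by grind)) ?_)
      simp only [List.map_cons, List.sum_cons]
      have := peakLen_pos (n := n) (j := j) (k := k) (m := i - 1)
      rw [peakLen_inner (m := i) (by omega) hik]
      omega
    -- A column just lowered is a local minimum. This is incompatible with the ascent through `i` if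
    -- that column is `i` or `i + 1`.
    have hfar : m + 2 ≤ i ∨ i + 2 ≤ m := by
      simp only [IsMin] at hmin
      by_contra hcon
      rcases (show m = i ∨ m = i + 1 by omega) with rfl | rfl
      · have := hmin.1 (by omega)
        omega
      · have := hmin.1 (by omega)
        rw [show i + 1 - 1 = i by omega] at this
        omega
    have hc : b i * peakGen b n j k m = peakGen b n j k m * b i := by
      have e := peakGen_comm H hk (j := j) (b := b)
      rw [← peakGen_inner b (n := n) (m := i) (by omega : j < i) hik]
      rcases hfar with hf | hf
      · exact (e _ _ hjm hf hik.le).symm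
      · exact e _ _ (by omega) hf hmk
    rw [← mul_assoc, hc, mul_assoc]
    refine mul_mem_wordSpan (peakGen_mem_wordSpan (by omega) (by omega)) (ih D1 ?_ ?_ ?_) le_rfl
    · simp only [ht_cons] at h1; grind
    · simp only [ht_cons] at h2; grind
    · grind

/-- Multiplication by a letter at an ascending slope. -/
theorem closes_slope {n : ℕ} {q : K} {b : ℕ → A} (H : IsTL n q b) {j k i : ℕ} {h : ℕ → ℤ}
    {l : List ℕ} (D : IsPeakSeq n j k h l) (hij : j < i) (hik : i < k)
    (h1 : ht h l (i - 1) = ht h l i - 1) (h2 : ht h l (i + 1) = ht h l i + 1) :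
    Closes K n b (l.map (peakLen n j k)).sum (b i * (l.map (peakGen b n j k)).prod) := by
  have hk := D.le
  by_cases hi : i ∈ l
  swap
  · have hi0 := List.count_eq_zero_of_not_mem hi
    have hr : l.count (i + 1) = 0 := by
      have := D.path i hij.le hik
      simp only [ht] at h2
      omega
    have hr' := List.count_eq_zero.mp hr
    -- Neither `i` nor `i + 1` has been used, so the part of the initial path to the right of `i`
    -- may be shifted down by `2`. The slope at `i` becomes a local maximum.
    have hD : IsPeakSeq n j k (fun m => h m + if m ≤ i then 0 else -2) l := by
      refine ⟨D.lt, D.le, ?_, D.low.add ?_, D.left, D.right⟩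
      · intro m h1 h2
        have := D.path m h1 h2
        simp only [ht] at *
        grind
      · intro m hm
        have : m ≠ i := fun e => hi (e ▸ hm)
        have : m ≠ i + 1 := fun e => hr' (e ▸ hm)
        constructor <;> intro <;> split_ifs <;> omega
    refine closes_max hD hij.le hik (by omega) ?_
    simp only [IsMax, ht] at h1 h2 ⊢
    grind
  by_cases hji : j + 1 < i
  · exact .inl (slope_mem_wordSpan H hk D.low hji hik h1 h2 hi)
  obtain rfl : i = j + 1 := by omega
  rw [show j + 1 - 1 = j by omega] at h1
  have hjl : j ∈ l := by
    rw [← List.count_pos_iff] at hi ⊢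
    have := D.path j le_rfl (by omega)
    simp only [ht] at h1
    omega
  obtain ⟨l1, d1, p1, e1⟩ := D.low.unflip (peakGen_comm H hk) le_rfl D.lt.le
    (by simp only [IsMin]; grind) hjl
  have hi1 : j + 1 ∈ l1 := by
    have := p1.mem_iff.mp hi
    simpa using this
  simp only [ht_perm p1, ht_cons] at h1 h2
  obtain ⟨l2, d2, p2, e2⟩ := d1.unflip (peakGen_comm H hk) (Nat.le_succ j) hik.le
    (by simp only [IsMin]; grind) hi1
  simp only [ht_perm p2, ht_cons] at h1 h2
  have p3 : l.Perm (j :: (j + 1) :: l2) := p1.trans (p2.cons j)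
  have hmem := d2.mem
  rw [e1, e2, sum_peakLen_perm p3, peakGen_left, peakGen_inner b (by omega) hik]
  simp only [List.map_cons, List.sum_cons]
  rw [peakLen_inner (m := j + 1) (by omega) hik]
  -- The word now starts with `b_{j+1}`, the peak at `j`, and `b_{j+1}`. A further `j` can occur
  -- only if `j = 0`, and then `b_1 b_0 b_1 b_0` shortens.
  by_cases hj2 : j ∈ l2
  · have hj0 : j = 0 := by
      by_contra hj0
      have := D.left (by omega)
      rw [p3.count_eq] at this
      have := List.count_pos_iff.mpr hj2
      grind
    subst hj0
    obtain ⟨l3, d3, p4, e3⟩ := d2.unflip (peakGen_comm H hk) le_rfl D.lt.le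
      (by simp only [IsMin]; grind) hj2
    have hb := H.left10
    left
    rw [e3, peakGen_left]
    simp only [peakL, zero_add]
    rw [← mul_assoc, ← mul_assoc, ← mul_assoc, hb, smul_mul_assoc]
    have := d3.mem
    refine Submodule.smul_mem _ _ (mul_mem_wordSpan (mul_mem_wordSpan
      (gen_mem_wordSpan (by omega)) (gen_mem_wordSpan (by omega)) le_rfl)
        (peakProd_mem_wordSpan (by omega) (by grind)) ?_)
    rw [sum_peakLen_perm p4]
    simp only [List.map_cons, List.sum_cons]
    have := peakLen_pos (n := n) (j := 0) (k := k) (m := 0)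
    omega
  · have hi2 : j + 1 ∉ l2 := by
      rw [← List.count_eq_zero]
      have := D.path j le_rfl D.lt
      have := List.count_eq_zero_of_not_mem hj2
      simp only [ht] at h1
      simp at h1
      omega
    -- Otherwise the three leading factors form the peak at `j + 1`. No other factor uses `j` or `j
    -- + 1`, so the product belongs to the shrunken interval `[j + 1, k]`.
    have hne : ∀ m ∈ l2, m ≠ j ∧ m ≠ j + 1 := by grind
    refine .inr (.inl ⟨j + 1, k, h, (j + 1) :: l2, ⟨hik, hk, fun m h1 h2 => D.path m (by omega) h2,
      ⟨d2.restrict (by omega) le_rfl (by grind), le_rfl, hik.le, ?_⟩, ?_, ?_⟩, ?_, ?_⟩)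
    · simp only [IsMax]; grind
    · intro _
      rw [List.count_cons_self, List.count_eq_zero_of_not_mem hi2]
    · intro hkn
      have := D.right hkn
      rw [p3.count_eq, List.count_cons_of_ne (by omega)] at this
      exact this
    · simp only [List.map_cons, List.prod_cons, peakGen_left, peakL, mul_assoc]
      congr 4
      refine List.map_congr_left fun m hm => ?_
      have := hne m hm
      unfold peakGen
      grind
    · simp only [List.map_cons, List.sum_cons]
      have : l2.map (peakLen n (j + 1) k) = l2.map (peakLen n j k) := by
        refine List.map_congr_left fun m hm => ?_
        have := hne m hm
        unfold peakLen
        grind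
      rw [this]
      simp only [peakLen]
      grind

/-- Multiplication by the left end letter reduces at a local maximum. -/
theorem left_mem_wordSpan {n : ℕ} {q : K} {b : ℕ → A} (H : IsTL n q b) {j k : ℕ} {h : ℕ → ℤ}
    {l : List ℕ} (hk : k ≤ n) (D : Low j k h l) (hj : 1 ≤ j) (hjk : j + 1 < k)
    (h1 : ht h l (j + 1) = ht h l j - 1) (hi : j ∈ l) :
    b j * (l.map (peakGen b n j k)).prod ∈ wordSpan K n b (l.map (peakLen n j k)).sum := by
  induction l with
  | nil => simp at hi
  | cons m l ih =>
    have hmin := D.isMin_cons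
    obtain ⟨D1, hjm, hmk, hmax⟩ := D
    simp only [List.map_cons, List.prod_cons, List.sum_cons]
    have hmem := D1.mem
    have hmj : m ≠ j := by
      rintro rfl
      have := hmin.2 (by omega)
      omega
    -- Before `j + 1` was lowered, `j` was a local minimum. Pulling out its lowering gives `b_j
    -- b_{j+1}` times the peak at `j`, which is `q` times that peak.
    by_cases hm1 : m = j + 1
    · subst hm1
      simp only [ht_cons] at h1
      obtain ⟨l', h3, h4, h5⟩ := D1.unflip (peakGen_comm H hk) le_rfl (by omega)
        (by simp only [IsMin]; grind) (by grind)
      rw [h5, peakGen_inner b (by omega) hjk, peakGen_left, ← mul_assoc, ← mul_assoc,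
        mul_assoc (b j), up_peakL H hj (by omega), smul_mul_assoc, sum_peakLen_perm h4]
      have := h3.mem
      refine Submodule.smul_mem _ _ (mul_mem_wordSpan (peakL_mem_wordSpan (by omega))
        (peakProd_mem_wordSpan (by omega) (by grind)) ?_)
      simp only [List.map_cons, List.sum_cons]
      have : peakLen n j k j = 2 * j + 1 := by simp [peakLen]
      omega
    rw [← mul_assoc, gen_comm_peakGen H hk (by omega) (by omega) hmk, mul_assoc]
    refine mul_mem_wordSpan (peakGen_mem_wordSpan (by omega) (by omega)) (ih D1 ?_ ?_) le_rfl
    · simp only [ht_cons] at h1; grind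
    · grind

/-- Multiplication by the left end letter. -/
theorem closes_left {n : ℕ} {q : K} {b : ℕ → A} (H : IsTL n q b) {j k : ℕ} {h : ℕ → ℤ}
    {l : List ℕ} (D : IsPeakSeq n j k h l) :
    Closes K n b (l.map (peakLen n j k)).sum (b j * (l.map (peakGen b n j k)).prod) := by
  have hk := D.le
  have hlt := D.lt
  rcases (D.low.isPath D.path) j le_rfl D.lt with hg | hg
  · have hmin : IsMin j k (ht h l) j := by simp only [IsMin]; grind
    by_cases hj : j ∈ l
    · exact closes_min_old H D le_rfl D.lt hmin hj
    · refine closes_min_new D le_rfl D.lt (fun _ => ?_) hmin hj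
      by_contra hj0
      have := D.left (by omega)
      rw [List.count_eq_zero_of_not_mem hj] at this
      omega
  rcases Nat.eq_zero_or_pos j with hj | hj
  · exact closes_max D le_rfl D.lt (fun _ => hj) (by simp only [IsMax]; grind)
  have hjl : j ∈ l := by
    rw [← List.count_pos_iff, D.left hj]; omega
  by_cases hjk : j + 1 < k
  · exact .inl (left_mem_wordSpan H hk D.low hj hjk hg hjl)
  -- With two columns left the interval cannot shrink further. The left end is used once and
  -- lowerings alternate, so the product has at most two occurrences of `k` and becomes a zigzag of
  -- `2n + 1` or `2n + 2` letters.
  obtain rfl : k = j + 1 := by omega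
  obtain ⟨lt, le, path, low, left, right⟩ := D
  rcases l with _ | ⟨m, l⟩
  · simp at hjl
  have hmin := low.isMin_cons
  obtain ⟨d1, hjm, hmk, hmax⟩ := low
  have hmj : m = j + 1 := by
    by_contra hne
    obtain rfl : m = j := by omega
    have := hmin.2 (by omega)
    omega
  subst hmj
  simp only [ht_cons] at hg
  obtain ⟨l2, d2, p2, e2⟩ := d1.unflip (peakGen_comm H hk) le_rfl (by omega)
    (by simp only [IsMin]; grind) (by grind)
  have hl2 : ∀ m ∈ l2, m = j + 1 := by
    intro m hm
    have h1 := d2.mem m hm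
    have h2 := left hj
    rw [List.count_cons_of_ne (by omega), p2.count_eq, List.count_cons_self] at h2
    have h3 : l2.count j = 0 := by omega
    have := List.count_eq_zero.mp h3
    by_contra
    have : m = j := by omega
    grind
  right
  right
  simp only [List.map_cons, List.prod_cons, List.sum_cons]
  rw [e2, sum_peakLen_perm p2, peakGen_left, peakGen_right b (by omega)]
  simp only [List.map_cons, List.sum_cons]
  have len1 : peakLen n j (j + 1) j = 2 * j + 1 := by simp [peakLen]
  have len2 : peakLen n j (j + 1) (j + 1) = 2 * (n - (j + 1)) + 1 := by simp [peakLen]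
  rcases l2 with _ | ⟨m, l3⟩
  · refine ⟨-j, 2 * n, le_rfl, ?_, ?_⟩
    · rw [List.map_nil, List.prod_nil, mul_one, peakR_mul_peakL b (by omega)]
    · simp only [len1, len2, List.map_nil, List.sum_nil]; omega
  · obtain rfl := hl2 m (by simp)
    have hjn : j + 1 = n := by
      by_contra hne
      have := right (by omega)
      rw [List.count_cons_self, p2.count_eq, List.count_cons_of_ne (by omega),
        List.count_cons_self] at this
      omega
    -- A column that has just been lowered is a local minimum, so it cannot be lowered twice in a
    -- row.
    have hl3 : l3 = [] := by
      rcases l3 with _ | ⟨m, l4⟩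
      · rfl
      · obtain rfl := hl2 m (by simp)
        have h1 := d2.2.2.2.1 (by omega)
        have h2 := d2.1.isMin_cons.1 (by omega)
        omega
    subst hl3
    refine ⟨-n, 2 * n + 1, Nat.le_succ _, ?_, ?_⟩
    · rw [← peakL_mul_right b hjn]
      simp only [List.map_cons, List.map_nil, List.prod_singleton]
      rw [peakGen_right b (by omega)]
      simp only [hjn, peakR_self]
    · simp only [len1, len2, List.map_cons, List.map_nil, List.sum_singleton]; omega

/-- Multiplication by a letter to the left of the interval reduces. -/
theorem outer_mem_wordSpan {n : ℕ} {q : K} {b : ℕ → A} (H : IsTL n q b) {j k i : ℕ}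
    {l : List ℕ} (hjk : j < k) (hk : k ≤ n) (hl : ∀ m ∈ l, j ≤ m ∧ m ≤ k) (hij : i < j)
    (hj : j ∈ l) :
    b i * (l.map (peakGen b n j k)).prod ∈ wordSpan K n b (l.map (peakLen n j k)).sum := by
  induction l with
  | nil => simp at hj
  | cons m l ih =>
    simp only [List.map_cons, List.prod_cons, List.sum_cons]
    have hm := hl m (by simp)
    by_cases hmj : m = j
    · subst hmj
      rw [peakGen_left, ← mul_assoc]
      exact mul_mem_wordSpan (mul_peakL_mem H hij (by omega))
        (peakProd_mem_wordSpan (by omega) (by grind)) (by simp [peakLen])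
    · rw [← mul_assoc, gen_comm_peakGen H hk (by omega) (by omega) hm.2, mul_assoc]
      exact mul_mem_wordSpan (peakGen_mem_wordSpan (by omega) (by omega))
        (ih (by grind) (by grind)) le_rfl

/-- Multiplication by letters that are not on the right end or a descending slope. -/
theorem closes_of_lt {n : ℕ} {q : K} {b : ℕ → A} (H : IsTL n q b) {j k i : ℕ} {h : ℕ → ℤ}
    {l : List ℕ} (D : IsPeakSeq n j k h l) (hik : i < k)
    (hs : j < i → ¬ (ht h l (i - 1) = ht h l i + 1 ∧ ht h l (i + 1) = ht h l i - 1)) :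
    Closes K n b (l.map (peakLen n j k)).sum (b i * (l.map (peakGen b n j k)).prod) := by
  rcases lt_trichotomy i j with hij | rfl | hij
  · refine .inl (outer_mem_wordSpan H D.lt D.le D.low.mem hij ?_)
    rw [← List.count_pos_iff, D.left (by omega)]; omega
  · exact closes_left H D
  · have p := D.low.isPath D.path
    have p1 := p (i - 1) (by omega) (by omega)
    have p2 := p i (by omega) hik
    rw [show i - 1 + 1 = i by omega] at p1
    have := hs hij
    by_cases hmax : IsMax j k (ht h l) i
    · exact closes_max D hij.le hik (by omega) hmax
    by_cases hmin : IsMin j k (ht h l) i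
    · by_cases hi : i ∈ l
      · exact closes_min_old H D hij.le hik hmin hi
      · exact closes_min_new D hij.le hik (by omega) hmin hi
    simp only [IsMax, IsMin] at hmax hmin
    exact closes_slope H D hij hik (by omega) (by omega)

theorem ht_reflect {n : ℕ} {h : ℕ → ℤ} {l : List ℕ} (hl : ∀ i ∈ l, i ≤ n) {m : ℕ} (hm : m ≤ n) :
    ht (fun m => h (n - m)) (l.map (n - ·)) m = ht h l (n - m) := by
  simp only [ht, count_map_sub hl hm]

/-- The family is closed under multiplication by generators, up to shorter words. -/
theorem IsFam.closes {n : ℕ} {q : K} {b : ℕ → A} (H : IsTL n q b) (hn : 2 ≤ n) {N i : ℕ}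
    (hi : i ≤ n) {a : A} (ha : IsFam n b N a) : Closes K n b N (b i * a) := by
  rcases ha with ⟨j, k, h, l, D, rfl, rfl⟩ | ⟨s, L, hL, rfl, rfl⟩
  · by_cases hs : i < k ∧
      (j < i → ¬ (ht h l (i - 1) = ht h l i + 1 ∧ ht h l (i + 1) = ht h l i - 1))
    · exact closes_of_lt H D hs.1 hs.2
    -- The remaining letters lie at or beyond the right end, or on a descending slope. Reflection
    -- moves them to the left end, or beyond it, or onto an ascending slope.
    · refine closes_of_reflect (by omega) D hi (closes_of_lt (H.reflect hn) D.reflect ?_ ?_)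
      · have := D.lt
        have := D.le
        by_contra
        apply hs
        exact ⟨by omega, by omega⟩
      · intro hlt
        rw [ht_reflect D.mem_le (by omega), ht_reflect D.mem_le (by omega),
          ht_reflect D.mem_le (by omega), show n - (n - i - 1) = i + 1 by have := D.le; omega,
          show n - (n - i) = i by omega, show n - (n - i + 1) = i - 1 by omega]
        have := D.le
        grind
  · by_cases h1 : i = zig n (s + L + 1)
    · refine .inr (.inr ⟨s, L + 1, by omega, ?_, rfl⟩)
      rw [zigProd, h1]
      congr 3
      push_cast; ring
    -- Since `2 * n ≤ L`, the zigzag after its first letter contains a full period, hence every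
    -- letter.
    · refine .inl (mul_zigProd_mem_wordSpan H hn hi s L h1 ?_)
      obtain ⟨r, h2, h3, h4⟩ := exists_zig_eq (by omega : 0 < n) s hi
      exact ⟨r, h2, by omega, h4⟩

theorem IsFam.one {n : ℕ} (hn : 0 < n) (b : ℕ → A) : IsFam n b 0 1 :=
  .inl ⟨0, n, fun i => i, [], ⟨hn, le_rfl, fun i _ _ => .inl (by push_cast; ring), trivial,
    by simp, by simp⟩, by simp, by simp⟩

/-- The family spans the algebra generated by `b 0, …, b n`. -/
theorem wordSpan_le_span_isFam {n : ℕ} {q : K} {b : ℕ → A} (H : IsTL n q b) (hn : 2 ≤ n)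
    (N : ℕ) : wordSpan K n b N ≤ Submodule.span K {a | ∃ M, M ≤ N ∧ IsFam n b M a} := by
  have hn0 : 0 < n := by omega
  induction N with
  | zero =>
    refine Submodule.span_le.mpr ?_
    rintro a ⟨l, -, h2, rfl⟩
    obtain rfl : l = [] := List.eq_nil_of_length_eq_zero (by omega)
    exact Submodule.subset_span ⟨0, le_rfl, by simpa using IsFam.one hn0 b⟩
  | succ N ih =>
    refine Submodule.span_le.mpr ?_
    rintro a ⟨l, h1, h2, rfl⟩
    rcases l with _ | ⟨i, l⟩
    · exact Submodule.subset_span ⟨0, by omega, by simpa using IsFam.one hn0 b⟩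
    have hi := h1 i (by simp)
    have hmono : Submodule.span K {a | ∃ M, M ≤ N ∧ IsFam n b M a}
        ≤ Submodule.span K {a | ∃ M, M ≤ N + 1 ∧ IsFam n b M a} :=
      Submodule.span_mono fun a ⟨M, hM, ha⟩ => ⟨M, by omega, ha⟩
    have hl : (l.map b).prod ∈ Submodule.span K {a | ∃ M, M ≤ N ∧ IsFam n b M a} :=
      ih (Submodule.subset_span ⟨l, by grind, by simpa using h2, rfl⟩)
    simp only [List.map_cons, List.prod_cons, SetLike.mem_coe]
    generalize (l.map b).prod = x at hl
    induction hl using Submodule.span_induction with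
    | mem x hx =>
      obtain ⟨M, hM, hx⟩ := hx
      rcases hx.closes H hn hi with h | h
      · exact hmono (ih (wordSpan_mono hM h))
      · exact Submodule.subset_span ⟨M + 1, by omega, h⟩
    | zero => simp
    | add y z _ _ h1 h2 => rw [mul_add]; exact add_mem h1 h2
    | smul c y _ h1 => rw [mul_smul_comm]; exact Submodule.smul_mem _ _ h1

end Family

end AffineTL

namespace AffineTL

/-! ### The zigzag representation -/

section ZigRep

variable {K : Type*} [CommRing K]

/-- The value of `bᵢ bⱼ bᵢ` in terms of `bᵢ` in the zigzag representation. -/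
def zigScalar (n : ℕ) (q : K) (i : ℕ) : K := if i = 0 ∨ i = n then 2 * q else q

/-- The image of a basis vector under a generator in the zigzag representation. -/
noncomputable def zigVec (n : ℕ) (q : K) (i : ℕ) (r : ℤ) : ℤ →₀ K :=
  if i = zig n r then Finsupp.single r (q + 1)
  -- At a turn the letters before and after `r` coincide. This branch takes precedence, so a walker
  -- at a turn always moves on and never goes back.
  else if i = zig n (r + 1) then Finsupp.single (r + 1) 1
  else if i = zig n (r - 1) then Finsupp.single (r - 1) (zigScalar n q i)
  else 0

/-- The generators in the zigzag representation: a walker on the periodic zigzag. -/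
noncomputable def zigOp (n : ℕ) (q : K) (i : ℕ) : Module.End K (ℤ →₀ K) :=
  Finsupp.linearCombination K (zigVec n q i)

variable {n : ℕ} {q : K}

theorem zigOp_same {i : ℕ} {r : ℤ} (h : zig n r = i) (c : K) :
    zigOp n q i (Finsupp.single r c) = (q + 1) • Finsupp.single r c := by
  rw [zigOp, Finsupp.linearCombination_single, zigVec, if_pos h.symm, Finsupp.smul_single,
    Finsupp.smul_single, smul_eq_mul, smul_eq_mul, mul_comm]

theorem zigOp_next (hn : 0 < n) {i : ℕ} {r : ℤ} (h : zig n (r + 1) = i) (c : K) :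
    zigOp n q i (Finsupp.single r c) = Finsupp.single (r + 1) c := by
  have := zig_adj hn r
  simp [zigOp, zigVec, h, show i ≠ zig n r by omega]

theorem zigOp_prev (hn : 0 < n) {i : ℕ} {r : ℤ} (h : zig n (r - 1) = i)
    (h' : zig n (r + 1) ≠ i) (c : K) :
    zigOp n q i (Finsupp.single r c) = zigScalar n q i • Finsupp.single (r - 1) c := by
  have := zig_adj hn (r - 1)
  rw [sub_add_cancel] at this
  simp [zigOp, zigVec, h, h'.symm, show i ≠ zig n r by omega, mul_comm]

theorem zigOp_far {i : ℕ} {r : ℤ} (h1 : zig n r ≠ i) (h2 : zig n (r + 1) ≠ i)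
    (h3 : zig n (r - 1) ≠ i) (c : K) : zigOp n q i (Finsupp.single r c) = 0 := by
  simp [zigOp, zigVec, h1.symm, h2.symm, h3.symm]

theorem zigOp_image (hn : 0 < n) (i : ℕ) (r : ℤ) (c : K) :
    zigOp n q i (Finsupp.single r c) = 0 ∨
      ∃ r' c', zig n r' = i ∧ zigOp n q i (Finsupp.single r c) = Finsupp.single r' c' := by
  by_cases h1 : zig n r = i
  · exact .inr ⟨r, (q + 1) * c, h1, by rw [zigOp_same h1, Finsupp.smul_single, smul_eq_mul]⟩
  by_cases h2 : zig n (r + 1) = i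
  · exact .inr ⟨r + 1, c, h2, zigOp_next hn h2 c⟩
  by_cases h3 : zig n (r - 1) = i
  · exact .inr ⟨r - 1, _, h3, by rw [zigOp_prev hn h3 h2, Finsupp.smul_single]⟩
  · exact .inl (zigOp_far h1 h2 h3 c)

/-- To prove an identity `X * bᵢ = Y * bᵢ` it suffices to look at the image of `bᵢ`. -/
theorem zigOp_ext (hn : 0 < n) {i : ℕ} {X Y : Module.End K (ℤ →₀ K)}
    (h : ∀ r c, zig n r = i → X (Finsupp.single r c) = Y (Finsupp.single r c)) :
    X * zigOp n q i = Y * zigOp n q i := by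
  refine Finsupp.lhom_ext fun r c => ?_
  simp only [Module.End.mul_apply]
  rcases zigOp_image (q := q) hn i r c with h0 | ⟨r', c', h1, h2⟩
  · rw [h0, map_zero, map_zero]
  · rw [h2, h r' c' h1]

/-- After `b_j` the walker stands on a letter `j`, from which no letter `i` can be reached in one
step. -/
theorem zigOp_mul_of_far (hn : 0 < n) {i j : ℕ} (h : i + 2 ≤ j ∨ j + 2 ≤ i) :
    zigOp n q i * zigOp n q j = 0 := by
  rw [← zero_mul (zigOp n q j)]
  refine zigOp_ext hn fun r c hr => ?_
  have h1 := zig_adj hn r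
  have h2 := zig_adj hn (r - 1)
  rw [sub_add_cancel] at h2
  rw [zigOp_far (by omega) (by omega) (by omega), LinearMap.zero_apply]

/-- The walker leaves a letter `i` for the neighbouring `j` and returns. Of the two steps, the
forward one has weight `1` and the backward one the scalar of its target. Leaving backward is
possible only for inner `i`, where both scalars are `q`. -/
theorem zigOp_sandwich (hn : 2 ≤ n) {i j : ℕ} (hij : j = i + 1 ∨ i = j + 1) (h0 : 0 < j)
    (hj : j < n) : zigOp n q i * zigOp n q j * zigOp n q i = zigScalar n q i • zigOp n q i := by
  have hn0 : 0 < n := by omega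
  have e : zigScalar n q i • zigOp n q i
      = (zigScalar n q i • (1 : Module.End K (ℤ →₀ K))) * zigOp n q i := by
    rw [smul_mul_assoc, one_mul]
  rw [e]
  refine zigOp_ext hn0 fun r c hr => ?_
  rw [Module.End.mul_apply, LinearMap.smul_apply, Module.End.one_apply]
  have h1 := zig_turn hn0 r
  have h2 := zig_turn hn0 (r + 1)
  rw [add_sub_cancel_right] at h2
  by_cases hnext : zig n (r + 1) = j
  · have hne : zig n (r + 1 + 1) ≠ i := by omega
    rw [zigOp_next hn0 hnext, zigOp_prev (i := i) hn0 (by rwa [add_sub_cancel_right]) hne,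
      add_sub_cancel_right]
  · have hprev : zig n (r - 1) = j := by have h3 := zig_adj hn0 r; omega
    rw [zigOp_prev hn0 hprev hnext, map_smul, zigOp_next hn0 (by rwa [sub_add_cancel]),
      sub_add_cancel]
    congr 1
    unfold zigScalar
    rw [if_neg (by omega), if_neg (by omega)]

theorem isTL_zigOp (hn : 2 ≤ n) (q : K) : IsTL n q (zigOp n q) := by
  have hn0 : 0 < n := by omega
  have hl : zigOp n q 0 * zigOp n q 1 * zigOp n q 0 = (2 * q) • zigOp n q 0 := by
    simpa [zigScalar] using zigOp_sandwich (q := q) hn (i := 0) (j := 1) (by simp) (by simp)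
      (by omega)
  have hr : zigOp n q n * zigOp n q (n - 1) * zigOp n q n = (2 * q) • zigOp n q n := by
    simpa [zigScalar] using zigOp_sandwich (q := q) hn (i := n) (j := n - 1) (by omega) (by omega)
      (by omega)
  constructor
  · intro i hi
    have e : (q + 1) • zigOp n q i
        = ((q + 1) • (1 : Module.End K (ℤ →₀ K))) * zigOp n q i := by
      rw [smul_mul_assoc, one_mul]
    rw [e]
    exact zigOp_ext hn0 fun r c hr => by
      rw [zigOp_same hr, LinearMap.smul_apply, Module.End.one_apply]
  · intro i j h1 h2
    rw [zigOp_mul_of_far hn0 (.inl h1), zigOp_mul_of_far hn0 (.inr h1)]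
  · intro i h1 h2
    rw [zigOp_sandwich hn (by simp) (by omega) (by omega), zigScalar, if_neg (by omega)]
  · intro i h1 h2
    rw [zigOp_sandwich hn (by simp) (by omega) (by omega), zigScalar, if_neg (by omega)]
  · rw [hl, smul_mul_assoc]
  · rw [mul_assoc, mul_assoc, ← mul_assoc (zigOp n q 0), hl, mul_smul_comm]
  · rw [hr, smul_mul_assoc]
  · rw [mul_assoc, mul_assoc, ← mul_assoc (zigOp n q n), hr, mul_smul_comm]

/-! ### Leading coefficients of words on the zigzag -/

/-- The word that moves the walker of the zigzag representation forward in each step. -/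
def zigWord (n : ℕ) (s : ℤ) : ℕ → List ℕ
  | 0 => []
  | L + 1 => zig n (s + (L + 1 : ℕ)) :: zigWord n s L

theorem zigWord_prod {A : Type*} [Monoid A] (n : ℕ) (b : ℕ → A) (s : ℤ) (L : ℕ) :
    ((zigWord n s (L + 1)).map b).prod = zigProd n b (s + 1) L := by
  induction L with
  | zero => simp [zigWord, zigProd]
  | succ L ih =>
    rw [zigWord, List.map_cons, List.prod_cons, ih, zigProd]
    congr 3
    push_cast; ring

theorem zigWord_length (n : ℕ) (s : ℤ) (L : ℕ) : (zigWord n s L).length = L := by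
  induction L with
  | zero => rfl
  | succ L ih => simp [zigWord, ih]

theorem zigWord_apply (hn : 0 < n) (s : ℤ) (L : ℕ) :
    ((zigWord n s L).map (zigOp n q)).prod (Finsupp.single s 1)
      = Finsupp.single (s + L) (1 : K) := by
  induction L with
  | zero => simp [zigWord]
  | succ L ih =>
    rw [zigWord, List.map_cons, List.prod_cons, Module.End.mul_apply, ih,
      zigOp_next hn (by push_cast; ring_nf)]
    push_cast; ring_nf

theorem zigOp_coeff (i : ℕ) (y : ℤ →₀ K) (t : ℤ)
    (h : zigOp n q i y t ≠ 0) : zig n t = i ∧ ∃ r, y r ≠ 0 ∧ t ≤ r + 1 := by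
  rw [zigOp, Finsupp.linearCombination_apply, Finsupp.sum, Finsupp.finsetSum_apply] at h
  obtain ⟨r, hr, hr'⟩ := Finset.exists_ne_zero_of_sum_ne_zero h
  have hy : y r ≠ 0 := Finsupp.mem_support_iff.mp hr
  have hv : zigVec n q i r t ≠ 0 := by
    intro h0; simp [h0] at hr'
  unfold zigVec at hv
  split_ifs at hv with h1 h2 h3
  · obtain rfl : t = r := by
      by_contra hne; exact hv (Finsupp.single_eq_of_ne hne)
    exact ⟨h1.symm, t, hy, by omega⟩
  · obtain rfl : t = r + 1 := by
      by_contra hne; exact hv (Finsupp.single_eq_of_ne hne)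
    exact ⟨h2.symm, r, hy, by omega⟩
  · obtain rfl : t = r - 1 := by
      by_contra hne; exact hv (Finsupp.single_eq_of_ne hne)
    exact ⟨h3.symm, r, hy, by omega⟩
  · simp at hv

/-- A word moves the walker forward by at most its length, with equality for one word only. -/
theorem zigOp_word_coeff (l : List ℕ) (s t : ℤ)
    (h : (l.map (zigOp n q)).prod (Finsupp.single s 1) t ≠ 0) :
    t ≤ s + l.length ∧ (t = s + l.length → l = zigWord n s l.length) := by
  induction l generalizing t with
  | nil =>
    have : t = s := by
      by_contra hne
      apply h
      simp only [List.map_nil, List.prod_nil, Module.End.one_apply]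
      exact Finsupp.single_eq_of_ne hne
    simp [this, zigWord]
  | cons i l ih =>
    rw [List.map_cons, List.prod_cons, Module.End.mul_apply] at h
    obtain ⟨h1, r, hr, htr⟩ := zigOp_coeff i _ t h
    obtain ⟨h2, h3⟩ := ih r hr
    simp only [List.length_cons, zigWord]
    push_cast
    refine ⟨by omega, fun ht => ?_⟩
    rw [← h3 (by omega), ← h1, ht]

end ZigRep

/-! ### The path representations -/

section PathRep

variable {K : Type*} [CommRing K]

/-- Changing the height of a path at the column `i`. -/
def bump (h : ℕ → ℤ) (i : ℕ) (c : ℤ) (m : ℕ) : ℤ := h m + if m = i then c else 0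

theorem bump_bump_same (h : ℕ → ℤ) (i : ℕ) (c d : ℤ) :
    bump (bump h i c) i d = bump h i (c + d) := by
  funext m; simp only [bump]; grind

theorem bump_comm (h : ℕ → ℤ) (i j : ℕ) (c d : ℤ) :
    bump (bump h i c) j d = bump (bump h j d) i c := by
  funext m; simp only [bump]; ring

theorem bump_zero (h : ℕ → ℤ) (i : ℕ) : bump h i 0 = h := by
  funext m; simp [bump]

open Classical in
/-- The coefficient with which a generator acts on a path. -/
noncomputable def pathCoef (n : ℕ) (q : K) (i : ℕ) (h : ℕ → ℤ) : K :=
  if IsPath 0 n h then if IsMax 0 n h i then 1 else if IsMin 0 n h i then q else 0 else 0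

open Classical in
/-- The height by which a generator changes a path. -/
noncomputable def pathStep (n i : ℕ) (h : ℕ → ℤ) : ℤ :=
  if IsMax 0 n h i then -2 else if IsMin 0 n h i then 2 else 0

/-- The generators in the path representation. -/
noncomputable def pathOp (n : ℕ) (q : K) (i : ℕ) : Module.End K ((ℕ → ℤ) →₀ K) :=
  Finsupp.linearCombination K fun h =>
    pathCoef n q i h • (Finsupp.single h 1 + Finsupp.single (bump h i (pathStep n i h)) 1)

variable {n : ℕ} {q : K}

theorem pathOp_single (i : ℕ) (h : ℕ → ℤ) :
    pathOp n q i (Finsupp.single h 1) =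
      pathCoef n q i h • (Finsupp.single h 1 + Finsupp.single (bump h i (pathStep n i h)) 1) := by
  simp [pathOp]

theorem IsMax.not_isMin (hn : 0 < n) {h : ℕ → ℤ} {i : ℕ} (H : IsMax 0 n h i) :
    ¬ IsMin 0 n h i := by
  intro H'
  simp only [IsMax, IsMin] at H H'
  rcases Nat.eq_zero_or_pos i with rfl | hi
  · have := H.2 hn; have := H'.2 hn; omega
  · have := H.1 hi; have := H'.1 hi; omega

theorem IsMax.isPath_bump {h : ℕ → ℤ} {i : ℕ} (H : IsMax 0 n h i) (hp : IsPath 0 n h) :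
    IsPath 0 n (bump h i (-2)) := by
  intro m h1 h2
  have := hp m h1 h2
  simp only [IsMax, bump] at H ⊢
  grind

theorem IsMin.isPath_bump {h : ℕ → ℤ} {i : ℕ} (H : IsMin 0 n h i) (hp : IsPath 0 n h) :
    IsPath 0 n (bump h i 2) := by
  intro m h1 h2
  have := hp m h1 h2
  simp only [IsMin, bump] at H ⊢
  grind

theorem IsMax.bump {h : ℕ → ℤ} {i : ℕ} (H : IsMax 0 n h i) : IsMin 0 n (bump h i (-2)) i := by
  simp only [IsMax, IsMin, AffineTL.bump] at H ⊢
  grind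

theorem IsMin.bump {h : ℕ → ℤ} {i : ℕ} (H : IsMin 0 n h i) : IsMax 0 n (bump h i 2) i := by
  simp only [IsMax, IsMin, AffineTL.bump] at H ⊢
  grind

theorem pathOp_max {i : ℕ} {h : ℕ → ℤ} (hp : IsPath 0 n h) (H : IsMax 0 n h i) :
    pathOp n q i (Finsupp.single h 1)
      = Finsupp.single h 1 + Finsupp.single (bump h i (-2)) 1 := by
  rw [pathOp_single, pathCoef, pathStep, if_pos hp, if_pos H, if_pos H, one_smul]

theorem pathOp_min (hn : 0 < n) {i : ℕ} {h : ℕ → ℤ} (hp : IsPath 0 n h) (H : IsMin 0 n h i) :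
    pathOp n q i (Finsupp.single h 1)
      = q • (Finsupp.single h 1 + Finsupp.single (bump h i 2) 1) := by
  have H' : ¬ IsMax 0 n h i := fun h' => h'.not_isMin hn H
  rw [pathOp_single, pathCoef, pathStep, if_pos hp, if_neg H', if_pos H, if_neg H', if_pos H]

theorem pathOp_slope {i : ℕ} {h : ℕ → ℤ} (H : ¬ IsMax 0 n h i) (H' : ¬ IsMin 0 n h i) :
    pathOp n q i (Finsupp.single h 1) = 0 := by
  rw [pathOp_single, pathCoef, if_neg H, if_neg H', ite_self, zero_smul]

theorem pathOp_not_path {i : ℕ} {h : ℕ → ℤ} (H : ¬ IsPath 0 n h) :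
    pathOp n q i (Finsupp.single h 1) = 0 := by
  rw [pathOp_single, pathCoef, if_neg H, zero_smul]

theorem end_ext_single {X Y : Module.End K ((ℕ → ℤ) →₀ K)}
    (h : ∀ g, X (Finsupp.single g 1) = Y (Finsupp.single g 1)) : X = Y :=
  Finsupp.lhom_ext' fun g => LinearMap.ext_ring (h g)

/-- To prove an identity `X * bᵢ = Y * bᵢ` it suffices to look at the image of `bᵢ`. -/
theorem pathOp_ext (hn : 0 < n) {i : ℕ} {X Y : Module.End K ((ℕ → ℤ) →₀ K)}
    (H : ∀ g, IsPath 0 n g → IsMax 0 n g i →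
      X (Finsupp.single g 1 + Finsupp.single (bump g i (-2)) 1)
        = Y (Finsupp.single g 1 + Finsupp.single (bump g i (-2)) 1)) :
    X * pathOp n q i = Y * pathOp n q i := by
  refine end_ext_single fun g => ?_
  simp only [Module.End.mul_apply]
  by_cases hp : IsPath 0 n g
  swap
  · rw [pathOp_not_path hp, map_zero, map_zero]
  by_cases h1 : IsMax 0 n g i
  · rw [pathOp_max hp h1, H g hp h1]
  by_cases h2 : IsMin 0 n g i
  · have := H _ (h2.isPath_bump hp) h2.bump
    rw [bump_bump_same, show (2 : ℤ) + -2 = 0 by norm_num, bump_zero, add_comm] at this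
    rw [pathOp_min hn hp h2, map_smul, map_smul, this]
  · rw [pathOp_slope h1 h2, map_zero, map_zero]

theorem pathOp_sq (hn : 0 < n) (i : ℕ) :
    pathOp n q i * pathOp n q i = (q + 1) • pathOp n q i := by
  have e : (q + 1) • pathOp n q i
      = ((q + 1) • (1 : Module.End K ((ℕ → ℤ) →₀ K))) * pathOp n q i := by
    rw [smul_mul_assoc, one_mul]
  rw [e]
  refine pathOp_ext hn fun g hp hmax => ?_
  rw [map_add, pathOp_max hp hmax, pathOp_min hn (hmax.isPath_bump hp) hmax.bump, bump_bump_same,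
    show (-2 : ℤ) + 2 = 0 by norm_num, bump_zero, LinearMap.smul_apply, Module.End.one_apply,
    add_smul, one_smul, add_comm (Finsupp.single (bump g i (-2)) (1 : K)), add_comm (q • _)]

theorem pathOp_comm {i j : ℕ} (h : i + 2 ≤ j) :
    pathOp n q i * pathOp n q j = pathOp n q j * pathOp n q i := by
  refine end_ext_single fun g => ?_
  simp only [Module.End.mul_apply]
  by_cases hp : IsPath 0 n g
  swap
  · rw [pathOp_not_path hp, pathOp_not_path hp, map_zero, map_zero]
  -- Being an extremum at `a` involves only the columns `a - 1`, `a`, `a + 1`, and a change at `b`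
  -- touches `a ± 1` alike only for columns too close.
  have key : ∀ a b : ℕ, a + 2 ≤ b ∨ b + 2 ≤ a → pathStep n a (bump g b (pathStep n b g))
      = pathStep n a g ∧ pathCoef n q a (bump g b (pathStep n b g)) = pathCoef n q a g := by
    intro a b hab
    have hp' : IsPath 0 n (bump g b (pathStep n b g)) := by
      unfold pathStep
      split_ifs with h1 h2
      · exact h1.isPath_bump hp
      · exact h2.isPath_bump hp
      · rwa [bump_zero]
    have e1 : IsMax 0 n (bump g b (pathStep n b g)) a ↔ IsMax 0 n g a := by
      simp only [IsMax, bump]; grind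
    have e2 : IsMin 0 n (bump g b (pathStep n b g)) a ↔ IsMin 0 n g a := by
      simp only [IsMin, bump]; grind
    generalize bump g b (pathStep n b g) = g' at hp' e1 e2 ⊢
    unfold pathStep pathCoef
    rw [if_pos hp', if_pos hp]
    by_cases h1 : IsMax 0 n g a
    · simp only [if_pos h1, if_pos (e1.mpr h1), and_self]
    · have h1' := fun h => h1 (e1.mp h)
      by_cases h2 : IsMin 0 n g a
      · simp only [if_neg h1, if_neg h1', if_pos h2, if_pos (e2.mpr h2), and_self]
      · have h2' := fun h => h2 (e2.mp h)
        simp only [if_neg h1, if_neg h1', if_neg h2, if_neg h2', and_self]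
  obtain ⟨k1, k2⟩ := key i j (.inl h)
  obtain ⟨k3, k4⟩ := key j i (.inr h)
  rw [pathOp_single, pathOp_single, map_smul, map_smul, map_add, map_add, pathOp_single,
    pathOp_single, pathOp_single, pathOp_single, k1, k2, k3, k4, bump_comm]
  module

/-- The image of `b_j` is spanned by sums of a path with a peak at `j` and its lowered version. For
inner `j + 1`, exactly one of the two has an extremum at `j + 1`, and it returns `q` times the sum.
At the end column both do, whence `2 * q`. -/
theorem pathOp_sandwich_up {j : ℕ} (h0 : 0 < j) (hj : j < n) :
    pathOp n q j * pathOp n q (j + 1) * pathOp n q j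
      = (if j + 1 = n then 2 * q else q) • pathOp n q j := by
  have hn : 0 < n := by omega
  set κ : K := if j + 1 = n then 2 * q else q with hκ
  have e : κ • pathOp n q j = (κ • (1 : Module.End K ((ℕ → ℤ) →₀ K))) * pathOp n q j := by
    rw [smul_mul_assoc, one_mul]
  rw [e]
  refine pathOp_ext hn fun g hp hmax => ?_
  have hp' := hmax.isPath_bump hp
  have hmin := hmax.bump
  have m1 := hmax.1 h0
  have m2 := hmax.2 hj
  have hback : bump (bump g j (-2)) j 2 = g := by
    rw [bump_bump_same]; exact bump_zero g j
  have hA : pathOp n q j (Finsupp.single (bump g j (-2)) 1)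
      = q • (Finsupp.single g 1 + Finsupp.single (bump g j (-2)) 1) := by
    rw [pathOp_min hn hp' hmin, hback, add_comm]
  rw [LinearMap.smul_apply, Module.End.one_apply, Module.End.mul_apply, map_add]
  have lower : j + 1 < n → g (j + 2) = g (j + 1) + 1 →
      pathOp n q (j + 1) (Finsupp.single (bump g j (-2)) 1) = 0 := by
    intro h1 h2
    apply pathOp_slope <;> (simp only [IsMax, IsMin, bump]; grind)
  have upper : j + 1 < n → g (j + 2) = g (j + 1) - 1 →
      pathOp n q (j + 1) (Finsupp.single g 1) = 0 := by
    intro h1 h2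
    apply pathOp_slope <;> (simp only [IsMax, IsMin]; grind)
  have lower' : (j + 1 < n → g (j + 2) = g (j + 1) - 1) →
      pathOp n q j (pathOp n q (j + 1) (Finsupp.single (bump g j (-2)) 1))
        = q • (Finsupp.single g 1 + Finsupp.single (bump g j (-2)) 1) := by
    intro h1
    have hm : IsMax 0 n (bump g j (-2)) (j + 1) := by simp only [IsMax, bump]; grind
    rw [pathOp_max hp' hm, map_add, hA, pathOp_slope (h := bump (bump g j (-2)) (j + 1) (-2)),
      add_zero] <;> (simp only [IsMax, IsMin, bump]; grind)
  have upper' : (j + 1 < n → g (j + 2) = g (j + 1) + 1) →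
      pathOp n q j (pathOp n q (j + 1) (Finsupp.single g 1))
        = q • (Finsupp.single g 1 + Finsupp.single (bump g j (-2)) 1) := by
    intro h1
    have hm : IsMin 0 n g (j + 1) := by simp only [IsMin]; grind
    rw [pathOp_min hn hp hm, map_smul, map_add, pathOp_max hp hmax,
      pathOp_slope (h := bump g (j + 1) 2), add_zero] <;>
      (simp only [IsMax, IsMin, bump]; grind)
  rw [map_add]
  rcases eq_or_lt_of_le (Nat.succ_le_of_lt hj) with hjn | hjn
  · rw [lower' (by omega), upper' (by omega), hκ, if_pos hjn]
    module
  · rw [hκ, if_neg hjn.ne]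
    rcases hp (j + 1) (by omega) hjn with h2 | h2
    · rw [lower hjn h2, upper' (fun _ => h2), map_zero, add_zero]
    · rw [upper hjn h2, lower' (fun _ => h2), map_zero, zero_add]

/-- Mirror image of `pathOp_sandwich_up`; both summands contribute when the middle column is `0`. -/
theorem pathOp_sandwich_down {i : ℕ} (hi : i + 1 < n) :
    pathOp n q (i + 1) * pathOp n q i * pathOp n q (i + 1)
      = (if i = 0 then 2 * q else q) • pathOp n q (i + 1) := by
  have hn : 0 < n := by omega
  set κ : K := if i = 0 then 2 * q else q with hκ
  have e : κ • pathOp n q (i + 1)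
      = (κ • (1 : Module.End K ((ℕ → ℤ) →₀ K))) * pathOp n q (i + 1) := by
    rw [smul_mul_assoc, one_mul]
  rw [e]
  refine pathOp_ext hn fun g hp hmax => ?_
  have hp' := hmax.isPath_bump hp
  have hmin := hmax.bump
  have m1 := hmax.1 (by omega)
  have m2 := hmax.2 hi
  rw [show i + 1 - 1 = i by omega] at m1
  have hback : bump (bump g (i + 1) (-2)) (i + 1) 2 = g := by
    rw [bump_bump_same]; exact bump_zero g _
  have hA : pathOp n q (i + 1) (Finsupp.single (bump g (i + 1) (-2)) 1)
      = q • (Finsupp.single g 1 + Finsupp.single (bump g (i + 1) (-2)) 1) := by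
    rw [pathOp_min hn hp' hmin, hback, add_comm]
  rw [LinearMap.smul_apply, Module.End.one_apply, Module.End.mul_apply, map_add]
  have lower : 0 < i → g (i - 1) = g i + 1 →
      pathOp n q i (Finsupp.single (bump g (i + 1) (-2)) 1) = 0 := by
    intro h1 h2
    apply pathOp_slope <;> (simp only [IsMax, IsMin, bump]; grind)
  have upper : 0 < i → g (i - 1) = g i - 1 →
      pathOp n q i (Finsupp.single g 1) = 0 := by
    intro h1 h2
    apply pathOp_slope <;> (simp only [IsMax, IsMin]; grind)
  have lower' : (0 < i → g (i - 1) = g i - 1) →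
      pathOp n q (i + 1) (pathOp n q i (Finsupp.single (bump g (i + 1) (-2)) 1))
        = q • (Finsupp.single g 1 + Finsupp.single (bump g (i + 1) (-2)) 1) := by
    intro h1
    have hm : IsMax 0 n (bump g (i + 1) (-2)) i := by simp only [IsMax, bump]; grind
    rw [pathOp_max hp' hm, map_add, hA, pathOp_slope (h := bump (bump g (i + 1) (-2)) i (-2)),
      add_zero] <;> (simp only [IsMax, IsMin, bump]; grind)
  have upper' : (0 < i → g (i - 1) = g i + 1) →
      pathOp n q (i + 1) (pathOp n q i (Finsupp.single g 1))
        = q • (Finsupp.single g 1 + Finsupp.single (bump g (i + 1) (-2)) 1) := by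
    intro h1
    have hm : IsMin 0 n g i := by simp only [IsMin]; grind
    rw [pathOp_min hn hp hm, map_smul, map_add, pathOp_max hp hmax,
      pathOp_slope (h := bump g i 2), add_zero] <;>
      (simp only [IsMax, IsMin, bump]; grind)
  rw [map_add]
  rcases Nat.eq_zero_or_pos i with hi0 | hi0
  · rw [lower' (by omega), upper' (by omega), hκ, if_pos hi0]
    module
  · rw [hκ, if_neg hi0.ne']
    have := hp (i - 1) (by omega) (by omega)
    rw [show i - 1 + 1 = i by omega] at this
    rcases this with h2 | h2
    · rw [upper hi0 (by omega), lower' (by omega), map_zero, zero_add]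
    · rw [lower hi0 (by omega), upper' (by omega), map_zero, add_zero]

/-- The path representations: the two outer generators may be replaced by zero. -/
theorem isTL_smul_pathOp (hn : 2 ≤ n) (q : K) {e : ℕ → K} (he : ∀ i, e i * e i = e i)
    (he' : ∀ i, 0 < i → i < n → e i = 1) : IsTL n q (fun i => e i • pathOp n q i) := by
  have hn0 : 0 < n := by omega
  have hl : pathOp n q 1 * pathOp n q 0 * pathOp n q 1 = (2 * q) • pathOp n q 1 := by
    simpa using pathOp_sandwich_down (q := q) (n := n) (i := 0) (by omega)
  have hr : pathOp n q (n - 1) * pathOp n q n * pathOp n q (n - 1)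
      = (2 * q) • pathOp n q (n - 1) := by
    have := pathOp_sandwich_up (q := q) (n := n) (j := n - 1) (by omega) (by omega)
    rwa [if_pos (by omega), show n - 1 + 1 = n by omega] at this
  have e1 := he' 1 (by omega) (by omega)
  have en := he' (n - 1) (by omega) (by omega)
  constructor
  · intro i hi
    simp only [smul_mul_smul_comm, he, pathOp_sq hn0, smul_comm (q + 1)]
  · intro i j h1 h2
    simp only [smul_mul_smul_comm, pathOp_comm h1, mul_comm (e i)]
  · intro i h1 h2
    simp only [he' i h1 (by omega), he' (i + 1) (by omega) h2, one_smul]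
    rw [pathOp_sandwich_up h1 (by omega), if_neg (by omega)]
  · intro i h1 h2
    simp only [he' i h1 (by omega), he' (i + 1) (by omega) h2, one_smul]
    rw [pathOp_sandwich_down (by omega), if_neg (by omega)]
  · simp only [smul_mul_smul_comm, e1, mul_one, he]
    rw [mul_assoc, mul_assoc, ← mul_assoc (pathOp n q 1), hl, mul_smul_comm, smul_comm]
  · simp only [smul_mul_smul_comm, e1, mul_one, one_mul, he]
    rw [hl, smul_mul_assoc, smul_comm]
  · simp only [smul_mul_smul_comm, en, mul_one, he]
    rw [mul_assoc, mul_assoc, ← mul_assoc (pathOp n q (n - 1)), hr, mul_smul_comm, smul_comm]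
  · simp only [smul_mul_smul_comm, en, mul_one, one_mul, he]
    rw [hr, smul_mul_assoc, smul_comm]

/-! ### Area and leading coefficients of words on paths -/

/-- The area below a path. -/
def area (n : ℕ) (h : ℕ → ℤ) : ℤ := ∑ m ∈ Finset.range (n + 1), h m

theorem area_bump {i : ℕ} (hi : i ≤ n) (h : ℕ → ℤ) (c : ℤ) :
    area n (bump h i c) = area n h + c := by
  simp only [area, bump, Finset.sum_add_distrib, Finset.sum_ite_eq', Finset.mem_range]
  rw [if_pos (by omega)]

theorem ht_cons_eq_bump (h : ℕ → ℤ) (l : List ℕ) (i : ℕ) :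
    ht h (i :: l) = bump (ht h l) i (-2) := by
  funext m
  rw [ht_cons, bump]
  split_ifs <;> ring

theorem area_ht {h : ℕ → ℤ} {l : List ℕ} (hl : ∀ i ∈ l, i ≤ n) :
    area n (ht h l) = area n h - 2 * l.length := by
  induction l with
  | nil => simp [ht_nil]
  | cons i l ih =>
    rw [ht_cons_eq_bump, area_bump (hl i (by simp)), ih (by grind), List.length_cons]
    push_cast; ring

theorem pathOp_coeff {i : ℕ} {y : (ℕ → ℤ) →₀ K} {g : ℕ → ℤ}
    (h : pathOp n q i y g ≠ 0) :
    ∃ r, y r ≠ 0 ∧ (g = r ∨ g = bump r i (pathStep n i r)) := by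
  rw [pathOp, Finsupp.linearCombination_apply, Finsupp.sum, Finsupp.finsetSum_apply] at h
  obtain ⟨r, hr, hr'⟩ := Finset.exists_ne_zero_of_sum_ne_zero h
  refine ⟨r, Finsupp.mem_support_iff.mp hr, ?_⟩
  by_contra hcon
  rw [not_or] at hcon
  apply hr'
  simp [Finsupp.single_eq_of_ne hcon.1, Finsupp.single_eq_of_ne hcon.2]

theorem pathStep_ge (i : ℕ) (h : ℕ → ℤ) : -2 ≤ pathStep n i h := by
  unfold pathStep; split_ifs <;> norm_num

theorem isMax_of_pathStep {i : ℕ} {h : ℕ → ℤ} (H : pathStep n i h = -2) : IsMax 0 n h i := by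
  unfold pathStep at H
  split_ifs at H with h1
  exact h1

/-- A word lowers a path by at most its length, with equality for lowering sequences only. -/
theorem pathOp_word_coeff {l : List ℕ} (hl : ∀ i ∈ l, i ≤ n) {h g : ℕ → ℤ}
    (H : (l.map (pathOp n q)).prod (Finsupp.single h 1) g ≠ 0) :
    area n h - area n g ≤ 2 * l.length ∧
      (area n h - area n g = 2 * l.length → Low 0 n h l ∧ g = ht h l) := by
  induction l generalizing g with
  | nil =>
    have : g = h := by
      by_contra hne
      apply H
      simp only [List.map_nil, List.prod_nil, Module.End.one_apply]
      exact Finsupp.single_eq_of_ne hne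
    simp [this, Low, ht_nil]
  | cons i l ih =>
    rw [List.map_cons, List.prod_cons, Module.End.mul_apply] at H
    obtain ⟨r, hr, hgr⟩ := pathOp_coeff H
    obtain ⟨h1, h2⟩ := ih (by grind) hr
    have hi := hl i (by simp)
    have hstep := pathStep_ge (n := n) i r
    rw [List.length_cons]
    push_cast
    rcases hgr with rfl | rfl
    · exact ⟨by omega, by omega⟩
    · rw [area_bump hi]
      refine ⟨by omega, fun heq => ?_⟩
      obtain ⟨h3, rfl⟩ := h2 (by omega)
      have h4 : pathStep n i (ht h l) = -2 := by omega
      exact ⟨⟨h3, Nat.zero_le _, hi, isMax_of_pathStep h4⟩, by rw [h4, ht_cons_eq_bump]⟩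

/-- The area bound leaves only one way to reach the extremal path: each letter must lower the path
by `2`, so before the last letter it was `ht h l`. Lowering a peak has coefficient `1`. -/
theorem pathOp_word_coeff_low {l : List ℕ} {h : ℕ → ℤ} (hp : IsPath 0 n h) (H : Low 0 n h l) :
    (l.map (pathOp n q)).prod (Finsupp.single h 1) (ht h l) = 1 := by
  induction l with
  | nil => simp [ht_nil]
  | cons i l ih =>
    have hl : ∀ m ∈ l, m ≤ n := fun m hm => (H.1.mem m hm).2
    have hi : i ≤ n := H.2.2.1
    have hpath := H.1.isPath hp
    rw [List.map_cons, List.prod_cons, Module.End.mul_apply]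
    set y := (l.map (pathOp n q)).prod (Finsupp.single h (1 : K)) with hy
    rw [pathOp, Finsupp.linearCombination_apply, Finsupp.sum_apply, Finsupp.sum,
      Finset.sum_eq_single (ht h l)]
    · have hne : ht h (i :: l) ≠ ht h l := by
        intro h0
        have := congrFun h0 i
        rw [ht_cons, if_pos rfl] at this
        omega
      rw [ih H.1, one_smul, pathCoef, pathStep, if_pos hpath, if_pos H.2.2.2, if_pos H.2.2.2,
        one_smul, Finsupp.add_apply, Finsupp.single_eq_of_ne hne, ← ht_cons_eq_bump,
        Finsupp.single_eq_same, zero_add]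
    · intro r hr hrne
      by_contra hcon
      have hcon' : Finsupp.single r (1 : K) (ht h (i :: l)) ≠ 0 ∨
          Finsupp.single (bump r i (pathStep n i r)) (1 : K) (ht h (i :: l)) ≠ 0 := by
        by_contra hc
        rw [not_or, not_not, not_not] at hc
        apply hcon
        rw [Finsupp.smul_apply, Finsupp.smul_apply, Finsupp.add_apply, hc.1, hc.2, add_zero,
          smul_zero, smul_zero]
      have hgr : ht h (i :: l) = r ∨ ht h (i :: l) = bump r i (pathStep n i r) :=
        hcon'.imp (fun h => by_contra fun hc => h (Finsupp.single_eq_of_ne hc))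
          (fun h => by_contra fun hc => h (Finsupp.single_eq_of_ne hc))
      obtain ⟨h1, h2⟩ := pathOp_word_coeff (q := q) hl (Finsupp.mem_support_iff.mp hr)
      have h3 := area_ht (h := h) (n := n) (fun m hm => (H.mem m hm).2)
      rw [List.length_cons] at h3
      push_cast at h3
      have hstep := pathStep_ge (n := n) i r
      rcases hgr with hg | hg
      · rw [hg] at h3; omega
      · rw [hg, area_bump hi] at h3
        exact hrne (h2 (by omega)).2
    · intro hns
      rw [Finsupp.notMem_support_iff.mp hns, zero_smul, Finsupp.zero_apply]

end PathRep

end AffineTL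

namespace AffineTL

/-! ### The universal property of the Temperley–Lieb algebra -/

section Universal

variable {K A : Type*} [CommRing K] [Ring A] [Algebra K A]

theorem quad_sub_one {q : K} {x : A} :
    (x - 1) * (x - 1) = algebraMap K A q + (q - 1) • (x - 1) ↔ x * x = (q + 1) • x := by
  have e : (x - 1) * (x - 1) - (algebraMap K A q + (q - 1) • (x - 1)) = x * x - (q + 1) • x := by
    rw [Algebra.algebraMap_eq_smul_one]
    have : (x - 1) * (x - 1) = x * x - x - x + 1 := by noncomm_ring
    rw [this]
    module
  rw [← sub_eq_zero, e, sub_eq_zero]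

theorem dihedralSum_three_sub_one {q : K} {x y : A} (hy : y * y = (q + 1) • y) :
    dihedralSum (x - 1) (y - 1) 3 = y * x * y - q • y := by
  have : dihedralSum (x - 1) (y - 1) 3 = y * x * y - y * y + y := by
    rw [dihedralSum_three]; noncomm_ring
  rw [this, hy]
  module

theorem dihedralSum_four_sub_one {q : K} {x y : A} (hx : x * x = (q + 1) • x)
    (hy : y * y = (q + 1) • y) :
    dihedralSum (x - 1) (y - 1) 4 = y * x * y * x - (2 * q) • (y * x) := by
  have : dihedralSum (x - 1) (y - 1) 4
      = y * x * y * x - y * y * x - y * (x * x) + (2 : K) • (y * x) := by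
    rw [dihedralSum_four, two_smul]; noncomm_ring
  rw [this, hx, hy, smul_mul_assoc, mul_smul_comm]
  module

theorem alt_two_sub_one {x y : A} : alt (x - 1) (y - 1) 2 = alt (y - 1) (x - 1) 2 ↔
    x * y = y * x := by
  have e : alt (x - 1) (y - 1) 2 - alt (y - 1) (x - 1) 2 = x * y - y * x := by
    simp only [alt]; noncomm_ring
  rw [← sub_eq_zero, e, sub_eq_zero]

/-- The sums for the two orders of `x` and `y` differ only in the product of full length. So the
vanishing of both sums implies the braid relation, which therefore need not be part of `IsTL`. -/
theorem alt_eq_of_dihedralSum {x y : A} {m : ℕ} (h : dihedralSum x y m = dihedralSum y x m) :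
    alt x y m = alt y x m := by
  have e : ∀ u v : A, dihedralSum u v m + 1
      = ∑ k ∈ Finset.range m, alt u v k + ∑ k ∈ Finset.range m, alt v u k + alt v u m := by
    intro u v
    have := Finset.sum_range_succ' (fun k => alt v u k) m
    rw [Finset.sum_range_succ] at this
    rw [dihedralSum, add_assoc, add_assoc]
    congr 1
    exact this.symm
  have h1 := e x y
  rw [h, e y x, add_comm (∑ k ∈ Finset.range m, alt y x k)] at h1
  exact add_left_cancel h1

/-- The rescaled generators of the Temperley–Lieb algebra, indexed by natural numbers. -/
noncomputable def tlB (n : ℕ) (q : K) (i : ℕ) : TLC n q :=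
  if h : i ≤ n then tlGen (affineC n) q ⟨i, Nat.lt_succ_of_le h⟩ + 1 else 0

theorem tlB_sub_one {n : ℕ} {q : K} {i : ℕ} (h : i ≤ n) :
    tlB n q i - 1 = tlGen (affineC n) q ⟨i, Nat.lt_succ_of_le h⟩ := by
  rw [tlB, dif_pos h]
  exact add_sub_cancel_right (G := TLC n q) _ _

theorem tlB_fin {n : ℕ} {q : K} (i : Fin (n + 1)) :
    tlB n q i - 1 = tlGen (affineC n) q i := tlB_sub_one (Nat.le_of_lt_succ i.2)

theorem affineC_of_far {n : ℕ} {i j : Fin (n + 1)} (h : (i : ℕ) + 2 ≤ j) :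
    affineC n i j = 2 := by
  rw [affineC_apply, if_neg (by rintro rfl; omega), if_neg (by omega)]

theorem affineC_of_near {n : ℕ} {i j : Fin (n + 1)} (h : (i : ℕ) + 1 = j ∨ (j : ℕ) + 1 = i) :
    affineC n i j
      = if (i : ℕ) = 0 ∨ (j : ℕ) = 0 ∨ (i : ℕ) = n ∨ (j : ℕ) = n then 4 else 3 := by
  rw [affineC_apply, if_neg (by rintro rfl; omega), if_pos h]

theorem isTL_of_relations {n : ℕ} (hn : 2 ≤ n) {q : K} {b : ℕ → A}
    (hquad : ∀ i : Fin (n + 1), (b i - 1) * (b i - 1)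
      = algebraMap K A q + (q - 1) • (b i - 1))
    (hbraid : ∀ i j : Fin (n + 1), affineC n i j = 2 →
      alt (b i - 1) (b j - 1) 2 = alt (b j - 1) (b i - 1) 2)
    (hsum : ∀ i j : Fin (n + 1), 2 < affineC n i j →
      dihedralSum (b i - 1) (b j - 1) (affineC n i j) = 0) : IsTL n q b := by
  have sq : ∀ i, i ≤ n → b i * b i = (q + 1) • b i := fun i hi =>
    quad_sub_one.mp (hquad ⟨i, Nat.lt_succ_of_le hi⟩)
  have three : ∀ i j, i ≤ n → j ≤ n → (i + 1 = j ∨ j + 1 = i) → 0 < i → 0 < j → i < n → j < n →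
      b i * b j * b i = q • b i := by
    intro i j hi hj h h1 h2 h3 h4
    have hM : affineC n ⟨j, Nat.lt_succ_of_le hj⟩ ⟨i, Nat.lt_succ_of_le hi⟩ = 3 := by
      rw [affineC_of_near h.symm, if_neg (by simp only; omega)]
    have := hsum ⟨j, Nat.lt_succ_of_le hj⟩ ⟨i, Nat.lt_succ_of_le hi⟩ (by omega)
    rw [hM, dihedralSum_three_sub_one (sq i hi), sub_eq_zero] at this
    exact this
  have four : ∀ i j, i ≤ n → j ≤ n → (i + 1 = j ∨ j + 1 = i) → (i = 0 ∨ j = 0 ∨ i = n ∨ j = n) →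
      b i * b j * b i * b j = (2 * q) • (b i * b j) := by
    intro i j hi hj h h1
    have hM : affineC n ⟨j, Nat.lt_succ_of_le hj⟩ ⟨i, Nat.lt_succ_of_le hi⟩ = 4 := by
      rw [affineC_of_near h.symm, if_pos (by simp only; omega)]
    have := hsum ⟨j, Nat.lt_succ_of_le hj⟩ ⟨i, Nat.lt_succ_of_le hi⟩ (by omega)
    rw [hM, dihedralSum_four_sub_one (sq j hj) (sq i hi), sub_eq_zero] at this
    exact this
  constructor
  · exact sq
  · intro i j h1 h2
    exact alt_two_sub_one.mp
      (hbraid ⟨i, by omega⟩ ⟨j, Nat.lt_succ_of_le h2⟩ (affineC_of_far (by exact h1)))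
  · intro i h1 h2
    exact three _ _ (by omega) (by omega) (by omega) (by omega) (by omega) (by omega) (by omega)
  · intro i h1 h2
    exact three _ _ (by omega) (by omega) (by omega) (by omega) (by omega) (by omega) (by omega)
  · exact four _ _ (by omega) (by omega) (by omega) (by omega)
  · exact four _ _ (by omega) (by omega) (by omega) (by omega)
  · exact four _ _ (by omega) (by omega) (by omega) (by omega)
  · exact four _ _ (by omega) (by omega) (by omega) (by omega)

theorem isTL_tlB {n : ℕ} (hn : 2 ≤ n) (q : K) : IsTL n q (tlB n q) := by
  refine isTL_of_relations hn (fun i => ?_) (fun i j h => ?_) (fun i j h => ?_)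
  · have := congrArg (toTL (affineC n) q) (heckeGen_quad (affineC n) q i)
    rw [map_mul, map_add, map_smul, AlgHom.commutes] at this
    rw [tlB_fin]
    exact this
  · have := congrArg (toTL (affineC n) q) (heckeGen_braid (affineC n) q i j)
    rw [map_alt, map_alt, h] at this
    rw [tlB_fin, tlB_fin]
    exact this
  · have := toTL_dihedralSum (affineC n) q i j h
    rw [map_dihedralSum] at this
    rw [tlB_fin, tlB_fin]
    exact this

theorem IsTL.dihedralSum_eq_zero {n : ℕ} {q : K} {b : ℕ → A} (H : IsTL n q b) (hn : 2 ≤ n)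
    (i j : Fin (n + 1)) (h : 2 < affineC n i j) :
    dihedralSum (b i - 1) (b j - 1) (affineC n i j) = 0 := by
  have hi := i.2
  have hj := j.2
  have near : (i : ℕ) + 1 = j ∨ (j : ℕ) + 1 = i := by
    rw [affineC_apply] at h
    by_contra hc
    rw [if_neg hc] at h
    split_ifs at h <;> omega
  rw [affineC_of_near near]
  split_ifs with h1
  · rw [dihedralSum_four_sub_one (H.sq _ (by omega)) (H.sq _ (by omega)), sub_eq_zero]
    have : ((i : ℕ) = 0 ∧ (j : ℕ) = 1) ∨ ((i : ℕ) = 1 ∧ (j : ℕ) = 0) ∨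
        ((i : ℕ) = n ∧ (j : ℕ) = n - 1) ∨ ((i : ℕ) = n - 1 ∧ (j : ℕ) = n) := by omega
    rcases this with ⟨e1, e2⟩ | ⟨e1, e2⟩ | ⟨e1, e2⟩ | ⟨e1, e2⟩ <;> rw [e1, e2]
    · exact H.left10
    · exact H.left01
    · exact H.right10
    · exact H.right01
  · rw [dihedralSum_three_sub_one (H.sq _ (by omega)), sub_eq_zero]
    rcases near with e | e
    · rw [← e]; exact H.down _ (by omega) (by omega)
    · rw [← e]; exact H.up _ (by omega) (by omega)

/-- The homomorphism from the Hecke algebra given by Temperley–Lieb generators. -/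
noncomputable def IsTL.heckeLift {n : ℕ} {q : K} {b : ℕ → A} (H : IsTL n q b) (hn : 2 ≤ n) :
    HeckeC n q →ₐ[K] A :=
  RingQuot.liftAlgHom K ⟨FreeAlgebra.lift K fun i : Fin (n + 1) => b i - 1, by
    intro x y h
    cases h with
    | quad i =>
      simp only [map_mul, map_add, map_smul, AlgHom.commutes, FreeAlgebra.lift_ι_apply]
      exact quad_sub_one.mpr (H.sq _ (by omega))
    | braid i j =>
      simp only [map_alt, FreeAlgebra.lift_ι_apply]
      by_cases h : 2 < affineC n i j
      · apply alt_eq_of_dihedralSum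
        have h1 := H.dihedralSum_eq_zero hn j i (by rwa [CoxeterMatrix.symmetric])
        rw [CoxeterMatrix.symmetric] at h1
        rw [h1, H.dihedralSum_eq_zero hn i j h]
      by_cases hij : i = j
      · rw [hij]
      have hM : affineC n i j = 2 := by
        rw [affineC_apply] at h ⊢
        split_ifs at h ⊢ <;> omega
      have hfar : (i : ℕ) + 2 ≤ j ∨ (j : ℕ) + 2 ≤ i := by
        by_contra hc
        have : (i : ℕ) ≠ j := fun h => hij (Fin.ext h)
        rw [affineC_of_near (by omega)] at hM
        split_ifs at hM <;> omega
      rw [hM, alt_two_sub_one]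
      rcases hfar with hf | hf
      · exact H.comm _ _ hf (by omega)
      · exact (H.comm _ _ hf (by omega)).symm⟩

theorem IsTL.heckeLift_gen {n : ℕ} {q : K} {b : ℕ → A} (H : IsTL n q b) (hn : 2 ≤ n)
    (i : Fin (n + 1)) : H.heckeLift hn (heckeGen (affineC n) q i) = b i - 1 := by
  simp [heckeLift, heckeGen]

/-- The homomorphism from the Temperley–Lieb algebra given by Temperley–Lieb generators. -/
noncomputable def IsTL.lift {n : ℕ} {q : K} {b : ℕ → A} (H : IsTL n q b) (hn : 2 ≤ n) :
    TLC n q →ₐ[K] A :=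
  RingQuot.liftAlgHom K ⟨H.heckeLift hn, by
    intro x y h
    cases h with
    | mk i j hij =>
      rw [map_dihedralSum, H.heckeLift_gen, H.heckeLift_gen, map_zero,
        H.dihedralSum_eq_zero hn i j hij]⟩

theorem IsTL.lift_gen {n : ℕ} {q : K} {b : ℕ → A} (H : IsTL n q b) (hn : 2 ≤ n)
    (i : Fin (n + 1)) : H.lift hn (tlGen (affineC n) q i) = b i - 1 := by
  simp only [lift, tlGen, toTL, RingQuot.liftAlgHom_mkAlgHom_apply]
  exact H.heckeLift_gen hn i

theorem IsTL.lift_tlB {n : ℕ} {q : K} {b : ℕ → A} (H : IsTL n q b) (hn : 2 ≤ n) {i : ℕ}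
    (hi : i ≤ n) : H.lift hn (tlB n q i) = b i := by
  rw [tlB, dif_pos hi, map_add, H.lift_gen, map_one]
  simp

/-- The Temperley–Lieb algebra is generated by its generators. -/
theorem tlC_induction {n : ℕ} {q : K} {p : TLC n q → Prop} (hK : ∀ c, p (algebraMap K _ c))
    (hg : ∀ i, i ≤ n → p (tlB n q i)) (hadd : ∀ x y, p x → p y → p (x + y))
    (hmul : ∀ x y, p x → p y → p (x * y)) (x : TLC n q) : p x := by
  obtain ⟨x, rfl⟩ := RingQuot.mkAlgHom_surjective K (TLRel (affineC n) q) x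
  obtain ⟨x, rfl⟩ := RingQuot.mkAlgHom_surjective K (HeckeRel (affineC n) q) x
  induction x using FreeAlgebra.induction with
  | grade0 c => simpa using hK c
  | grade1 i =>
    have e : tlB n q i + algebraMap K _ (-1) = tlGen (affineC n) q i := by
      rw [← tlB_fin, map_neg, map_one]
      exact (sub_eq_add_neg _ _).symm
    have := hadd _ _ (hg i (Nat.le_of_lt_succ i.2)) (hK (-1))
    rw [e] at this
    exact this
  | mul x y hx hy => rw [map_mul, map_mul]; exact hmul _ _ hx hy
  | add x y hx hy => rw [map_add, map_add]; exact hadd _ _ hx hy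

theorem exists_mem_wordSpan {n : ℕ} {q : K} (x : TLC n q) :
    ∃ N, x ∈ wordSpan K n (tlB n q) N := by
  induction x using tlC_induction with
  | hK c =>
    exact ⟨0, by rw [Algebra.algebraMap_eq_smul_one]; exact Submodule.smul_mem _ _ one_mem_wordSpan⟩
  | hg i hi => exact ⟨1, gen_mem_wordSpan hi⟩
  | hadd x y hx hy =>
    obtain ⟨M, hM⟩ := hx
    obtain ⟨N, hN⟩ := hy
    exact ⟨M + N, add_mem (wordSpan_mono (by omega) hM) (wordSpan_mono (by omega) hN)⟩
  | hmul x y hx hy =>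
    obtain ⟨M, hM⟩ := hx
    obtain ⟨N, hN⟩ := hy
    exact ⟨M + N, mul_mem_wordSpan hM hN le_rfl⟩

end Universal

end AffineTL

namespace AffineTL

/-! ### Faithfulness: the zigzag representation -/

section Words

variable {A : Type*} [Ring A]

/-- The leading-coefficient bound on the zigzag is about words in the generators, so peaks, and with
them all peak products, are written out as words of the expected length. -/
theorem peakL_word (b : ℕ → A) (j : ℕ) :
    ∃ w : List ℕ, (∀ i ∈ w, i ≤ j) ∧ w.length = 2 * j + 1 ∧ peakL b j = (w.map b).prod := by
  induction j with
  | zero => exact ⟨[0], by simp, by simp, by simp [peakL]⟩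
  | succ j ih =>
    obtain ⟨w, h1, h2, h3⟩ := ih
    refine ⟨(j + 1) :: w ++ [j + 1], by grind, by simp [h2]; omega, by simp [peakL, h3, mul_assoc]⟩

theorem peakR_word (b : ℕ → A) (n k : ℕ) :
    ∃ w : List ℕ, (∀ i ∈ w, i ≤ n) ∧ w.length = 2 * (n - k) + 1 ∧
      peakR b n k = (w.map b).prod := by
  obtain ⟨w, h1, h2, h3⟩ := peakL_word (fun i => b (n - i)) (n - k)
  exact ⟨w.map (n - ·), by grind, by simpa using h2, by rw [peakR, h3]; simp [Function.comp_def]⟩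

theorem peakGen_word (b : ℕ → A) {n j k m : ℕ} (hj : j ≤ n) (hm : m ≤ n) :
    ∃ w : List ℕ, (∀ i ∈ w, i ≤ n) ∧ w.length = peakLen n j k m ∧
      peakGen b n j k m = (w.map b).prod := by
  unfold peakGen peakLen
  split_ifs
  · obtain ⟨w, h1, h2, h3⟩ := peakL_word b j
    exact ⟨w, fun i hi => (h1 i hi).trans hj, h2, h3⟩
  · exact peakR_word b n k
  · exact ⟨[m], by simpa, by simp, by simp⟩

theorem peakProd_word (b : ℕ → A) {n j k : ℕ} (hj : j ≤ n) {l : List ℕ} (hl : ∀ i ∈ l, i ≤ n) :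
    ∃ w : List ℕ, (∀ i ∈ w, i ≤ n) ∧ w.length = (l.map (peakLen n j k)).sum ∧
      (l.map (peakGen b n j k)).prod = (w.map b).prod := by
  induction l with
  | nil => exact ⟨[], by simp, by simp, by simp⟩
  | cons m l ih =>
    obtain ⟨w, h1, h2, h3⟩ := ih (by grind)
    obtain ⟨v, h4, h5, h6⟩ := peakGen_word b (j := j) (k := k) hj (hl m (by simp))
    exact ⟨v ++ w, by grind, by simp [h2, h5], by simp [h3, h6]⟩

theorem peakL_eq_mul (b : ℕ → A) (j : ℕ) : ∃ u v, peakL b j = b j * u ∧ peakL b j = v * b j := by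
  rcases j with _ | j
  · exact ⟨1, 1, by simp [peakL], by simp [peakL]⟩
  · exact ⟨peakL b j * b (j + 1), b (j + 1) * peakL b j, by simp [peakL, mul_assoc], rfl⟩

theorem peakGen_eq_mul (b : ℕ → A) {n j k m : ℕ} (hk : k ≤ n) :
    ∃ u v, peakGen b n j k m = b m * u ∧ peakGen b n j k m = v * b m := by
  unfold peakGen
  split_ifs with h1 h2
  · rw [h1]; exact peakL_eq_mul b j
  · obtain ⟨u, v, h3, h4⟩ := peakL_eq_mul (fun i => b (n - i)) (n - k)
    rw [show n - (n - k) = m by omega] at h3 h4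
    exact ⟨u, v, h3, h4⟩
  · exact ⟨1, 1, by simp, by simp⟩

end Words

/-- Neighbouring letters of the list are neighbours in the diagram. -/
def AdjChain (l : List ℕ) : Prop := l.IsChain fun a b => a = b + 1 ∨ b = a + 1

/-- A peak begins and ends with its index letter, and distant letters multiply to zero on the
zigzag. Equal letters never stand next to each other in a lowering sequence, so only neighbours
survive. -/
theorem prod_zigOp_eq_zero {K : Type*} [CommRing K] {n j k : ℕ} {q : K} (hn : 0 < n) (hjk : j < k)
    (hk : k ≤ n) {h : ℕ → ℤ} {l : List ℕ} (D : Low j k h l) (hl : ¬ AdjChain l) :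
    (l.map (peakGen (zigOp n q) n j k)).prod = 0 := by
  induction l with
  | nil => exact absurd List.IsChain.nil hl
  | cons a l ih =>
    by_cases hl' : AdjChain l
    swap
    · rw [List.map_cons, List.prod_cons, ih D.1 hl', mul_zero]
    rcases l with _ | ⟨b, l⟩
    · exact absurd (List.IsChain.singleton a) hl
    have hab : ¬ (a = b + 1 ∨ b = a + 1) := by
      intro hab
      exact hl (List.isChain_cons_cons.mpr ⟨hab, hl'⟩)
    have hne : a ≠ b := by
      rintro rfl
      have h1 := D.1.isMin_cons
      obtain ⟨-, h3, h4, h2⟩ := D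
      simp only [IsMin, IsMax] at h1 h2
      rcases h3.lt_or_eq with h5 | h5
      · have := h1.1 h5; have := h2.1 h5; omega
      · have := h1.2 (by omega); have := h2.2 (by omega); omega
    obtain ⟨-, v, -, h1⟩ := peakGen_eq_mul (zigOp n q) (j := j) (m := a) hk
    obtain ⟨u, -, h2, -⟩ := peakGen_eq_mul (zigOp n q) (j := j) (m := b) hk
    rw [List.map_cons, List.prod_cons, List.map_cons, List.prod_cons, h1, h2, mul_assoc v,
      ← mul_assoc (zigOp n q a), ← mul_assoc (zigOp n q a), zigOp_mul_of_far hn (by omega), zero_mul,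
      zero_mul, mul_zero]

/-- A lowering sequence can only turn at the ends of the interval. -/
theorem Low.turn {j k a b : ℕ} {h : ℕ → ℤ} {l : List ℕ} (D : Low j k h (a :: b :: a :: l)) :
    (b = a + 1 → a = j) ∧ (a = b + 1 → a = k) := by
  obtain ⟨⟨⟨-, -, -, h1⟩, -⟩, h2, h3, h4⟩ := D
  simp only [IsMax, ht_cons] at h1 h4
  constructor
  · rintro rfl
    by_contra hc
    have := h1.1 (by omega)
    have := h4.1 (by omega)
    grind
  · rintro rfl
    by_contra hc
    have := h1.2 (by omega)
    have := h4.2 (by omega)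
    grind

/-- A turn `a, b, a` uses an end of the interval twice, so that end is `0` or `n`. Continuing past
the turn would leave the range of columns or require a second turn, which `2 ≤ n` excludes. -/
theorem AdjChain.cases {n j k : ℕ} (hn : 2 ≤ n) (hjk : j < k) (hk : k ≤ n) {h : ℕ → ℤ}
    {l : List ℕ} (D : Low j k h l) (hj : 1 ≤ j → l.count j ≤ 1) (hk' : k < n → l.count k ≤ 1)
    (hl : AdjChain l) :
    l.IsChain (fun a b => b = a + 1) ∨ l.IsChain (fun a b => a = b + 1) ∨
      (j = 0 ∧ l = [0, 1, 0]) ∨ (k = n ∧ l = [n, n - 1, n]) := by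
  induction l with
  | nil => exact .inl List.IsChain.nil
  | cons a l ih =>
    rcases l with _ | ⟨b, l⟩
    · exact .inl (List.IsChain.singleton a)
    obtain ⟨hab, hl'⟩ := List.isChain_cons_cons.mp hl
    have hcj : (b :: l).count j ≤ (a :: b :: l).count j := List.count_le_count_cons
    have hck : (b :: l).count k ≤ (a :: b :: l).count k := List.count_le_count_cons
    have hmem := D.mem
    have ha := hmem a (by simp)
    rcases l with _ | ⟨c, l⟩
    · rcases hab with hab | hab
      · exact .inr (.inl (List.isChain_cons_cons.mpr ⟨hab, List.IsChain.singleton b⟩))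
      · exact .inl (List.isChain_cons_cons.mpr ⟨hab, List.IsChain.singleton b⟩)
    have turn : c = a → (b = a + 1 → j = 0 ∧ a = 0) ∧ (a = b + 1 → k = n ∧ a = n) := by
      rintro rfl
      have ht := D.turn
      constructor
      · intro hb
        have := ht.1 hb
        subst this
        have : c = 0 := by
          by_contra hc
          have := hj (by omega)
          have h2 : 2 ≤ (c :: b :: c :: l).count c := by
            rw [List.count_cons_self]
            exact Nat.succ_le_succ (List.count_pos_iff.mpr (by simp))
          omega
        exact ⟨this, this⟩
      · intro hb
        have := ht.2 hb
        subst this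
        have : c = n := by
          by_contra hc
          have := hk' (by omega)
          have h2 : 2 ≤ (c :: b :: c :: l).count c := by
            rw [List.count_cons_self]
            exact Nat.succ_le_succ (List.count_pos_iff.mpr (by simp))
          omega
        exact ⟨this, this⟩
    rcases ih D.1 (fun h => hcj.trans (hj h)) (fun h => hck.trans (hk' h)) hl' with
      h1 | h1 | ⟨h0, h1⟩ | ⟨h0, h1⟩
    · obtain ⟨hbc, h2⟩ := List.isChain_cons_cons.mp h1
      rcases hab with hab | hab
      · obtain ⟨hkn, han⟩ := (turn (by omega)).2 hab
        refine .inr (.inr (.inr ⟨hkn, ?_⟩))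
        rcases l with _ | ⟨d, l⟩
        · rw [show a = n by omega, show b = n - 1 by omega, show c = n by omega]
        · have := (List.isChain_cons_cons.mp h2).1
          have := hmem d (by simp)
          omega
      · exact .inl (List.isChain_cons_cons.mpr ⟨hab, h1⟩)
    · obtain ⟨hbc, h2⟩ := List.isChain_cons_cons.mp h1
      rcases hab with hab | hab
      · exact .inr (.inl (List.isChain_cons_cons.mpr ⟨hab, h1⟩))
      · obtain ⟨hj0, ha0⟩ := (turn (by omega)).1 hab
        refine .inr (.inr (.inl ⟨hj0, ?_⟩))
        rcases l with _ | ⟨d, l⟩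
        · rw [show a = 0 by omega, show b = 1 by omega, show c = 0 by omega]
        · have := (List.isChain_cons_cons.mp h2).1
          omega
    · simp only [List.cons.injEq] at h1
      have := turn (by omega)
      omega
    · simp only [List.cons.injEq] at h1
      have := turn (by omega)
      omega

/-- Using every column once costs `(2j + 1) + (2(n - k) + 1) + (k - j - 1)` letters, that is, `2n +
1 - (k - j)`. -/
theorem sum_peakLen_le {n j k : ℕ} (hjk : j < k) (hk : k ≤ n) {l : List ℕ} (hl : l.Nodup)
    (hmem : ∀ i ∈ l, j ≤ i ∧ i ≤ k) : (l.map (peakLen n j k)).sum ≤ 2 * n := by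
  rw [← List.sum_toFinset _ hl]
  calc ∑ m ∈ l.toFinset, peakLen n j k m ≤ ∑ m ∈ Finset.Icc j k, peakLen n j k m := by
        apply Finset.sum_le_sum_of_subset
        intro m hm
        rw [List.mem_toFinset] at hm
        exact Finset.mem_Icc.mpr (hmem m hm)
    _ ≤ 2 * n := by
        obtain ⟨d, rfl⟩ : ∃ d, k = j + d + 1 := ⟨k - j - 1, by omega⟩
        have e1 : Finset.Icc j (j + d + 1)
            = insert j (insert (j + d + 1) (Finset.Ioo j (j + d + 1))) := by
          ext m; simp; omega
        rw [e1, Finset.sum_insert (by simp), Finset.sum_insert (by simp),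
          Finset.sum_congr rfl (g := fun _ => 1)
            (fun m hm => peakLen_inner (Finset.mem_Ioo.mp hm).1 (Finset.mem_Ioo.mp hm).2)]
        simp only [peakLen, if_true, if_neg (show j + d + 1 ≠ j by omega), Finset.sum_const,
          Nat.card_Ioo, smul_eq_mul]
        omega

/-- Peak products that act nontrivially on the zigzag are thus no longer than the shortest long
zigzag, and cannot disturb the leading coefficient of a longest one. -/
theorem IsPeakSeq.zigOp_eq_zero_or {K : Type*} [CommRing K] {n j k : ℕ} {q : K} (hn : 2 ≤ n)
    {h : ℕ → ℤ} {l : List ℕ} (D : IsPeakSeq n j k h l) :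
    (l.map (peakGen (zigOp n q) n j k)).prod = 0 ∨ (l.map (peakLen n j k)).sum ≤ 2 * n + 1 := by
  have hlt := D.lt
  have hle := D.le
  by_cases hl : AdjChain l
  swap
  · exact .inl (prod_zigOp_eq_zero (by omega) D.lt D.le D.low hl)
  right
  rcases hl.cases hn D.lt D.le D.low (fun h => (D.left h).le) (fun h => (D.right h).le) with
    h1 | h1 | ⟨h1, rfl⟩ | ⟨h1, rfl⟩
  · have h2 : l.Pairwise (· < ·) := List.isChain_iff_pairwise.mp (h1.imp fun a b h => by omega)
    exact (sum_peakLen_le D.lt D.le (h2.imp fun h => h.ne) D.low.mem).trans (by omega)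
  · have h2 : l.Pairwise (· > ·) := List.isChain_iff_pairwise.mp (h1.imp fun a b h => by omega)
    exact (sum_peakLen_le D.lt D.le (h2.imp fun h => h.ne') D.low.mem).trans (by omega)
  · simp only [List.map_cons, List.map_nil, List.sum_cons, List.sum_nil, peakLen]
    split_ifs <;> omega
  · simp only [List.map_cons, List.map_nil, List.sum_cons, List.sum_nil, peakLen]
    split_ifs <;> omega

end AffineTL

namespace AffineTL

/-! ### Isolating a longest zigzag -/

section Faithful

variable {K : Type*} [CommRing K]

theorem map_prod_map {A B F : Type*} [Monoid A] [Monoid B] [FunLike F A B] [MonoidHomClass F A B]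
    {f : F} {b : ℕ → A} {b' : ℕ → B} {n : ℕ} (hf : ∀ i ≤ n, f (b i) = b' i) {w : List ℕ}
    (hw : ∀ i ∈ w, i ≤ n) : f (w.map b).prod = (w.map b').prod := by
  rw [map_list_prod, List.map_map]
  congr 1
  exact List.map_congr_left fun i hi => hf i (hw i hi)

theorem map_peakL {A B : Type*} [Ring A] [Ring B] {F : Type*} [FunLike F A B]
    [MonoidHomClass F A B] {f : F} {b : ℕ → A} {b' : ℕ → B} {n : ℕ}
    (hf : ∀ i ≤ n, f (b i) = b' i) {j : ℕ} (hj : j ≤ n) : f (peakL b j) = peakL b' j := by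
  induction j with
  | zero => exact hf 0 hj
  | succ j ih => rw [peakL, peakL, map_mul, map_mul, ih (by omega), hf _ hj]

theorem map_peakGen {A B : Type*} [Ring A] [Ring B] {F : Type*} [FunLike F A B]
    [MonoidHomClass F A B] {f : F} {b : ℕ → A} {b' : ℕ → B} {n : ℕ}
    (hf : ∀ i ≤ n, f (b i) = b' i) {j k m : ℕ} (hj : j ≤ n) (hm : m ≤ n) :
    f (peakGen b n j k m) = peakGen b' n j k m := by
  unfold peakGen
  split_ifs
  · exact map_peakL hf hj
  · exact map_peakL (n := n) (fun i _ => hf _ (by omega)) (by omega)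
  · exact hf m hm

/-- A long zigzag is determined by its action on the zigzag representation. -/
theorem eq_zigProd_of_coeff {n : ℕ} {q : K} (hn : 2 ≤ n) {M : ℕ} {a : TLC n q}
    (ha : IsFam n (tlB n q) M a) {s : ℤ} {L : ℕ} (hL : 2 * n ≤ L)
    (hM : ∀ s' L', 2 * n ≤ L' → a = zigProd n (tlB n q) s' L' → ∃ s'' L'', L'' ≤ L ∧
      a = zigProd n (tlB n q) s'' L'')
    (h : (isTL_zigOp hn q).lift hn a (Finsupp.single (s - 1) 1) (s + L) ≠ 0) :
    a = zigProd n (tlB n q) s L := by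
  have hn0 : 0 < n := by omega
  have hlift : ∀ i ≤ n, (isTL_zigOp hn q).lift hn (tlB n q i) = zigOp n q i :=
    fun i hi => (isTL_zigOp hn q).lift_tlB hn hi
  have hw : ∃ w : List ℕ, (∀ i ∈ w, i ≤ n) ∧ w.length ≤ L + 1 ∧ a = (w.map (tlB n q)).prod := by
    rcases ha with ⟨j, k, g, l, D, ha, -⟩ | ⟨s', L', hL', ha, -⟩
    · have hlt := D.lt
      have hle := D.le
      obtain ⟨w, h1, h2, h3⟩ := peakProd_word (tlB n q) (j := j) (k := k) (by omega) D.mem_le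
      refine ⟨w, h1, ?_, by rw [← h3, ha]⟩
      rcases D.zigOp_eq_zero_or (q := q) hn with h4 | h4
      · exfalso
        apply h
        rw [ha, map_prod_map (b' := peakGen (zigOp n q) n j k) (n := n)
          (fun i hi => map_peakGen hlift (by omega) hi) D.mem_le, h4]
        simp
      · omega
    · obtain ⟨s'', L'', h1, h2⟩ := hM s' L' hL' ha
      refine ⟨zigWord n (s'' - 1) (L'' + 1), ?_, by rw [zigWord_length]; omega, ?_⟩
      · have : ∀ N : ℕ, ∀ i ∈ zigWord n (s'' - 1) N, i ≤ n := by
          intro N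
          induction N with
          | zero => simp [zigWord]
          | succ N ih =>
            intro i hi
            rcases List.mem_cons.mp hi with rfl | hi
            · exact zig_le hn0 _
            · exact ih i hi
        exact this _
      · rw [zigWord_prod, sub_add_cancel, h2]
  obtain ⟨w, h1, h2, h3⟩ := hw
  rw [h3, map_prod_map hlift h1] at h
  obtain ⟨h4, h5⟩ := zigOp_word_coeff w _ _ h
  have h6 : w.length = L + 1 := by omega
  rw [h3, h5 (by omega), h6, zigWord_prod, sub_add_cancel]

theorem zigProd_coeff {n : ℕ} {q : K} (hn : 2 ≤ n) (s : ℤ) (L : ℕ) :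
    (isTL_zigOp hn q).lift hn (zigProd n (tlB n q) s L) (Finsupp.single (s - 1) 1) (s + L)
      = 1 := by
  have hn0 : 0 < n := by omega
  have : ∀ N, (isTL_zigOp hn q).lift hn (zigProd n (tlB n q) s N) = zigProd n (zigOp n q) s N := by
    intro N
    induction N with
    | zero => exact (isTL_zigOp hn q).lift_tlB hn (zig_le hn0 _)
    | succ N ih => rw [zigProd, zigProd, map_mul, ih, (isTL_zigOp hn q).lift_tlB hn (zig_le hn0 _)]
  rw [this]
  have h2 := zigWord_prod n (zigOp n q) (s - 1) L
  rw [sub_add_cancel] at h2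
  rw [← h2, zigWord_apply hn0, show s - 1 + ((L + 1 : ℕ) : ℤ) = s + L by push_cast; ring,
    Finsupp.single_eq_same]

/-- An element acting as zero on the zigzag representation involves no long zigzags. -/
theorem isPeakSeq_of_zigOp {n : ℕ} {q : K} (hn : 2 ≤ n) {S : Finset (TLC n q)} {c : TLC n q → K}
    (hc : ∀ a ∈ S, c a ≠ 0) (hS : ∀ a ∈ S, ∃ M, IsFam n (tlB n q) M a)
    (h0 : (isTL_zigOp hn q).lift hn (∑ a ∈ S, c a • a) = 0) :
    ∀ a ∈ S, ∃ j k h l, IsPeakSeq n j k h l ∧ a = (l.map (peakGen (tlB n q) n j k)).prod := by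
  classical
  let Z := S.filter fun a => ∃ s L, 2 * n ≤ L ∧ a = zigProd n (tlB n q) s L
  by_cases hZ : Z.Nonempty
  swap
  · intro a ha
    obtain ⟨M, ⟨j, k, h, l, D, h1, -⟩ | ⟨s, L, hL, h1, -⟩⟩ := hS a ha
    · exact ⟨j, k, h, l, D, h1⟩
    · exact absurd ⟨a, Finset.mem_filter.mpr ⟨ha, s, L, hL, h1⟩⟩ hZ
  exfalso
  have hdata : ∀ a ∈ Z, ∃ s L, 2 * n ≤ L ∧ a = zigProd n (tlB n q) s L :=
    fun a ha => (Finset.mem_filter.mp ha).2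
  choose! s L hL ha using hdata
  -- The coefficient that moves the walker by `L a + 1` steps is then contributed by `a` alone.
  obtain ⟨a, haZ, hmax⟩ := Finset.exists_max_image Z L hZ
  have haS : a ∈ S := (Finset.mem_filter.mp haZ).1
  have hcoef := congrArg (fun T : Module.End K (ℤ →₀ K) =>
    T (Finsupp.single (s a - 1) 1) (s a + L a)) h0
  simp only [map_sum, map_smul, LinearMap.sum_apply, LinearMap.smul_apply,
    Finsupp.finsetSum_apply, Finsupp.smul_apply, LinearMap.zero_apply, Finsupp.zero_apply] at hcoef
  rw [Finset.sum_eq_single a] at hcoef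
  · have h1 := zigProd_coeff (q := q) hn (s a) (L a)
    rw [← ha a haZ] at h1
    rw [h1, smul_eq_mul, mul_one] at hcoef
    exact hc a haS hcoef
  · intro a' ha' hne
    by_contra hcon
    apply hne
    obtain ⟨M, hM⟩ := hS a' ha'
    rw [eq_zigProd_of_coeff hn hM (s := s a) (hL a haZ) _ fun h => hcon (by rw [h, smul_zero])]
    · exact (ha a haZ).symm
    -- Distinct expressions of the same element as a zigzag are not excluded at this point.
    -- Maximality concerns the chosen one, so that expression is used in place of `s'` and `L'`.
    · intro s' L' h1 h2
      have haZ' : a' ∈ Z := Finset.mem_filter.mpr ⟨ha', s', L', h1, h2⟩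
      exact ⟨s a', L a', hmax a' haZ', ha a' haZ'⟩
  · intro h; exact absurd haS h

end Faithful

end AffineTL

namespace AffineTL

/-! ### Faithfulness: the path representations -/

/-- The path `h` on the columns `j, …, k`, extended by slopes falling to both sides. -/
def extendPath (j k : ℕ) (h : ℕ → ℤ) (m : ℕ) : ℤ :=
  if m < j then h j - (j - m) else if k < m then h k - (m - k) else h m

theorem isPath_extendPath {n j k : ℕ} {h : ℕ → ℤ} (hjk : j < k) (hp : IsPath j k h) :
    IsPath 0 n (extendPath j k h) := by
  intro m _ _
  have h1 := hp m
  unfold extendPath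
  rcases lt_trichotomy (m + 1) j with h2 | rfl | h2 <;>
    rcases lt_trichotomy m k with h3 | rfl | h3 <;> split_ifs <;> push_cast <;> omega

/-- Columns outside the interval are never lowered and start one below its ends. An inner end is
therefore still a local maximum at its first lowering, and a second one does not happen. -/
theorem Low.extend {n j k : ℕ} {h : ℕ → ℤ} {l : List ℕ} (hjk : j < k) (hk : k ≤ n)
    (D : Low j k h l) (hj : 1 ≤ j → l.count j ≤ 1) (hk' : k < n → l.count k ≤ 1) :
    Low 0 n (extendPath j k h) l := by
  induction l with
  | nil => trivial
  | cons i l ih =>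
    have hcj : l.count j ≤ (i :: l).count j := List.count_le_count_cons
    have hck : l.count k ≤ (i :: l).count k := List.count_le_count_cons
    obtain ⟨D1, h1, h2, h3⟩ := D
    refine ⟨ih D1 (fun h => hcj.trans (hj h)) (fun h => hck.trans (hk' h)), by omega, by omega, ?_⟩
    have out : ∀ m, (m < j ∨ k < m) → l.count m = 0 := by
      intro m hm
      refine List.count_eq_zero.mpr fun hmem => ?_
      have := D1.mem m hmem
      omega
    simp only [IsMax, ht, extendPath] at h3 ⊢
    constructor
    · intro hi
      rcases h1.lt_or_eq with h4 | rfl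
      · have := h3.1 h4
        rw [if_neg (by omega), if_neg (by omega), if_neg (by omega), if_neg (by omega)]
        exact this
      · have := hj hi
        rw [List.count_cons_self] at this
        rw [if_pos (by omega), if_neg (by omega), if_neg (by omega), out _ (by omega)]
        omega
    · intro hi
      rcases h2.lt_or_eq with h4 | rfl
      · have := h3.2 h4
        rw [if_neg (by omega), if_neg (by omega), if_neg (by omega), if_neg (by omega)]
        exact this
      · have := hk' hi
        rw [List.count_cons_self] at this
        rw [if_neg (by omega), if_pos (by omega), if_neg (by omega), if_neg (by omega),
          out _ (by omega)]
        omega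

section PeakScalar

variable {K : Type*} [CommRing K] {n : ℕ} {q : K}

/-- The peak collapses from the inside: the sandwich around `b_0` gives `2 * q`, and each later one
gives `q`. -/
theorem peakL_pathOp (e : ℕ → K) (he' : ∀ i, 0 < i → i < n → e i = 1) {j : ℕ}
    (hj : j < n) : peakL (fun i => e i • pathOp n q i) j
      = (if j = 0 then e 0 else 2 * q ^ j * e 0) • pathOp n q j := by
  induction j with
  | zero => rw [peakL, if_pos rfl]
  | succ j ih =>
    rw [peakL, ih (by omega), he' (j + 1) (by omega) hj, one_smul, mul_smul_comm, smul_mul_assoc,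
      pathOp_sandwich_down hj, smul_smul, if_neg (Nat.succ_ne_zero j)]
    congr 1
    rcases j with _ | j
    · simp; ring
    · rw [if_neg (by omega), if_neg (by omega)]; ring

theorem peakR_pathOp (e : ℕ → K) (he' : ∀ i, 0 < i → i < n → e i = 1) {k : ℕ}
    (hk : 0 < k) (hkn : k ≤ n) : peakR (fun i => e i • pathOp n q i) n k
      = (if k = n then e n else 2 * q ^ (n - k) * e n) • pathOp n q k := by
  induction hkn using Nat.decreasingInduction with
  | self => rw [peakR_self, if_pos rfl]
  | of_succ k hkn ih =>
    rw [peakR_step _ hkn, ih (by omega), he' k (by omega) hkn, one_smul, mul_smul_comm,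
      smul_mul_assoc, pathOp_sandwich_up hk hkn, smul_smul, if_neg (show k ≠ n by omega)]
    congr 1
    have e1 : n - k = n - (k + 1) + 1 := by omega
    by_cases h : k + 1 = n
    · rw [if_pos h, if_pos h, e1, show n - (k + 1) = 0 by omega]; ring
    · rw [if_neg h, if_neg h, e1]; ring

/-- The factor by which a peak differs from a generator in the path representations. -/
def peakScalar (n : ℕ) (q : K) (e : ℕ → K) (j k m : ℕ) : K :=
  if m = j then (if j = 0 then e 0 else 2 * q ^ j * e 0)
  else if m = k then (if k = n then e n else 2 * q ^ (n - k) * e n) else 1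

theorem peakGen_pathOp (e : ℕ → K) (he' : ∀ i, 0 < i → i < n → e i = 1)
    {j k m : ℕ} (hjk : j < k) (hk : k ≤ n) (hjm : j ≤ m) (hmk : m ≤ k) :
    peakGen (fun i => e i • pathOp n q i) n j k m
      = peakScalar n q e j k m • pathOp n q m := by
  unfold peakGen peakScalar
  split_ifs with h1 h2
  · rw [peakL_pathOp e he' (by omega), if_pos h2, h1]
  · rw [peakL_pathOp e he' (by omega), if_neg h2, h1]
  · rename_i h3 h4
    rw [peakR_pathOp e he' (by omega) hk, if_pos h4, h3]
  · rename_i h3 h4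
    rw [peakR_pathOp e he' (by omega) hk, if_neg h4, h3]
  · dsimp only
    rw [he' m (by omega) (by omega)]

theorem prod_map_smul {A : Type*} [Ring A] [Algebra K A] {b b' : ℕ → A} {γ : ℕ → K} {l : List ℕ}
    (h : ∀ m ∈ l, b m = γ m • b' m) :
    (l.map b).prod = (l.map γ).prod • (l.map b').prod := by
  induction l with
  | nil => simp
  | cons m l ih =>
    simp only [List.map_cons, List.prod_cons]
    rw [h m (by simp), ih (by grind), smul_mul_smul_comm]

theorem IsPeakSeq.prod_pathOp {e : ℕ → K} (he' : ∀ i, 0 < i → i < n → e i = 1)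
    {j k : ℕ} {h : ℕ → ℤ} {l : List ℕ} (D : IsPeakSeq n j k h l) :
    (l.map (peakGen (fun i => e i • pathOp n q i) n j k)).prod
      = (l.map (peakScalar n q e j k)).prod • (l.map (pathOp n q)).prod :=
  prod_map_smul (A := Module.End K ((ℕ → ℤ) →₀ K)) fun m hm =>
    peakGen_pathOp e he' D.lt D.le (D.low.mem m hm).1 (D.low.mem m hm).2

theorem IsPeakSeq.extend_low {j k : ℕ} {h : ℕ → ℤ} {l : List ℕ} (D : IsPeakSeq n j k h l) :
    Low 0 n (extendPath j k h) l :=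
  D.low.extend D.lt D.le (fun h => (D.left h).le) (fun h => (D.right h).le)

theorem IsPeakSeq.mem_left {j k : ℕ} {h : ℕ → ℤ} {l : List ℕ} (D : IsPeakSeq n j k h l)
    (hj : 1 ≤ j) : j ∈ l := by
  rw [← List.count_pos_iff, D.left hj]; norm_num

theorem IsPeakSeq.mem_right {j k : ℕ} {h : ℕ → ℤ} {l : List ℕ} (D : IsPeakSeq n j k h l)
    (hk : k < n) : k ∈ l := by
  rw [← List.count_pos_iff, D.right hk]; norm_num

/-- The lift of the Temperley–Lieb algebra to the path representation with parameters `e`. -/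
noncomputable def pathRep (hn : 2 ≤ n) (q : K) {e : ℕ → K} (he : ∀ i, e i * e i = e i)
    (he' : ∀ i, 0 < i → i < n → e i = 1) : TLC n q →ₐ[K] Module.End K ((ℕ → ℤ) →₀ K) :=
  (isTL_smul_pathOp hn q he he').lift hn

theorem IsPeakSeq.pathRep_apply (hn : 2 ≤ n) {e : ℕ → K} (he : ∀ i, e i * e i = e i)
    (he' : ∀ i, 0 < i → i < n → e i = 1) {j k : ℕ} {h : ℕ → ℤ} {l : List ℕ}
    (D : IsPeakSeq n j k h l) :
    pathRep hn q he he' (l.map (peakGen (tlB n q) n j k)).prod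
      = (l.map (peakScalar n q e j k)).prod • (l.map (pathOp n q)).prod := by
  have hlt := D.lt
  have hle := D.le
  rw [← D.prod_pathOp he']
  exact map_prod_map (fun i hi =>
    map_peakGen (fun m hm => (isTL_smul_pathOp hn q he he').lift_tlB hn hm) (by omega) hi) D.mem_le

/-- The number of ends of the interval `[j, k]` which are inner columns. -/
def innerEnds (n j k : ℕ) : ℕ := (if j = 0 then 0 else 1) + if k = n then 0 else 1

/-- The parameters of the path representation that detects the product along a sequence. -/
def detector (K : Type*) [CommRing K] (n j k : ℕ) (l : List ℕ) (i : ℕ) : K :=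
  -- An outer generator that the given product does not involve is switched off. This kills
  -- competing products with the same leading path that reach the outer generator through a peak.
  if (i = 0 ∧ j = 0 ∧ 0 ∉ l) ∨ (i = n ∧ k = n ∧ n ∉ l) then 0 else 1

theorem detector_mul_self (j k : ℕ) (l : List ℕ) (i : ℕ) :
    detector K n j k l i * detector K n j k l i = detector K n j k l i := by
  unfold detector; split_ifs <;> simp

theorem detector_inner (j k : ℕ) (l : List ℕ) (i : ℕ) (h1 : 0 < i) (h2 : i < n) :
    detector K n j k l i = 1 := by
  unfold detector; rw [if_neg (by omega)]

/-- A switched-off parameter never enters: at an inner end it equals `1`, and at an outer end it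
appears only if the outer letter occurs. The factors `2` and `q` are nonzero by the assumptions on
`K` and `q`. -/
theorem detector_scalar_ne_zero [IsDomain K] [CharZero K] (hn : 0 < n) (hq : q ≠ 0) {j k : ℕ}
    {l : List ℕ} : (l.map (peakScalar n q (detector K n j k l) j k)).prod ≠ 0 := by
  rw [Ne, List.prod_eq_zero_iff, List.mem_map]
  rintro ⟨m, hm, h⟩
  unfold peakScalar detector at h
  split_ifs at h <;> simp_all

/-- An element acting as zero on all path representations is not a nontrivial combination of
products along lowering sequences. -/
theorem eq_empty_of_pathRep [IsDomain K] [CharZero K] (hn : 2 ≤ n) (hq : q ≠ 0)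
    {S : Finset (TLC n q)} {c : TLC n q → K} (hc : ∀ a ∈ S, c a ≠ 0)
    (hS : ∀ a ∈ S, ∃ j k h l, IsPeakSeq n j k h l ∧
      a = (l.map (peakGen (tlB n q) n j k)).prod)
    (h0 : ∀ (e : ℕ → K) (he : ∀ i, e i * e i = e i) (he' : ∀ i, 0 < i → i < n → e i = 1),
      pathRep hn q he he' (∑ a ∈ S, c a • a) = 0) : S = ∅ := by
  classical
  by_contra hne
  choose! j k h l D ha using hS
  -- There are at most two inner ends, so the weight `3` makes length the primary criterion. Among
  -- products of maximal length one with the fewest inner ends is taken.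
  obtain ⟨a, haS, hmax⟩ := Finset.exists_max_image S
    (fun a => 3 * ((l a).length : ℤ) - innerEnds n (j a) (k a))
    (Finset.nonempty_iff_ne_empty.mpr hne)
  have Da := D a haS
  have hlt := Da.lt
  have hle := Da.le
  set e := detector K n (j a) (k a) (l a) with hedef
  have hee : ∀ i, e i * e i = e i := detector_mul_self _ _ _
  have hee' : ∀ i, 0 < i → i < n → e i = 1 := detector_inner _ _ _
  set g := extendPath (j a) (k a) (h a) with hg
  have hgp : IsPath 0 n g := isPath_extendPath hlt Da.path
  have hgl : Low 0 n g (l a) := Da.extend_low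
  have hcoef := congrArg (fun T : Module.End K ((ℕ → ℤ) →₀ K) =>
    T (Finsupp.single g 1) (ht g (l a))) (h0 e hee hee')
  simp only [map_sum, map_smul, LinearMap.sum_apply, LinearMap.smul_apply,
    Finsupp.finsetSum_apply, Finsupp.smul_apply, LinearMap.zero_apply, Finsupp.zero_apply] at hcoef
  have hval : ∀ a' ∈ S, pathRep hn q hee hee' a' (Finsupp.single g 1) (ht g (l a))
      = ((l a').map (peakScalar n q e (j a') (k a'))).prod *
        ((l a').map (pathOp n q)).prod (Finsupp.single g 1) (ht g (l a)) := by
    intro a' ha'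
    conv_lhs => rw [ha a' ha', (D a' ha').pathRep_apply hn hee hee']
    rfl
  rw [Finset.sum_eq_single a] at hcoef
  · rw [hval a haS, pathOp_word_coeff_low hgp hgl, mul_one, smul_eq_mul] at hcoef
    exact mul_ne_zero (hc a haS)
      (detector_scalar_ne_zero (by omega) hq) hcoef
  · intro a' haS' hne'
    by_contra hcon
    apply hne'
    have Da' := D a' haS'
    have hlt' := Da'.lt
    have hle' := Da'.le
    have hcon' : pathRep hn q hee hee' a' (Finsupp.single g 1) (ht g (l a)) ≠ 0 :=
      fun h => hcon (by rw [h, smul_zero])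
    rw [hval a' haS'] at hcon'
    have hs := left_ne_zero_of_mul hcon'
    obtain ⟨h1, h2⟩ := pathOp_word_coeff Da'.mem_le (right_ne_zero_of_mul hcon')
    rw [area_ht Da.mem_le] at h1 h2
    have hm := hmax a' haS'
    have hie : innerEnds n (j a) (k a) ≤ 2 := by unfold innerEnds; split_ifs <;> omega
    have hie' : innerEnds n (j a') (k a') ≤ 2 := by unfold innerEnds; split_ifs <;> omega
    obtain ⟨hlow, hht⟩ := h2 (by omega)
    have hcount : ∀ m, (l a).count m = (l a').count m := by
      intro m
      have := congrFun hht m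
      simp only [ht] at this
      omega
    have hperm : (l a').Perm (l a) := List.perm_iff_count.mpr fun m => (hcount m).symm
    have hmem : ∀ m, m ∈ l a' ↔ m ∈ l a := fun m => hperm.mem_iff
    have hlen := hperm.length_eq
    have hzero : ∀ m ∈ l a', peakScalar n q e (j a') (k a') m ≠ 0 := by
      intro m hm h3
      exact hs (List.prod_eq_zero (List.mem_map.mpr ⟨m, hm, h3⟩))
    -- Both products use the same letters. If `a'` has an inner left end and `a` does not, then `0`
    -- is unused and the detector kills the peak of `a'`. The opposite discrepancy gives `a'` fewer
    -- inner ends and is excluded below by maximality.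
    have hj : j a' = j a ∨ j a' = 0 ∧ j a ≠ 0 := by
      by_cases hj' : j a' = 0
      · omega
      have m1 := Da'.mem_left (by omega)
      have m2 := Da.low.mem _ ((hmem _).mp m1)
      by_cases hja : j a = 0
      · exfalso
        by_cases m0 : 0 ∈ l a
        · have := Da'.low.mem _ ((hmem _).mpr m0); omega
        · apply hzero _ m1
          rw [peakScalar, if_pos rfl, if_neg hj', hedef, detector, if_pos (.inl ⟨rfl, hja, m0⟩),
            mul_zero]
      · have m3 := Da'.low.mem _ ((hmem _).mpr (Da.mem_left (by omega)))
        omega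
    have hk : k a' = k a ∨ k a' = n ∧ k a ≠ n := by
      by_cases hk' : k a' = n
      · omega
      have m1 := Da'.mem_right (by omega)
      have m2 := Da.low.mem _ ((hmem _).mp m1)
      by_cases hka : k a = n
      · exfalso
        by_cases m0 : n ∈ l a
        · have := Da'.low.mem _ ((hmem _).mpr m0); omega
        · apply hzero _ m1
          rw [peakScalar, if_neg hlt'.ne', if_pos rfl, if_neg hk', hedef, detector,
            if_pos (.inr ⟨rfl, hka, m0⟩), mul_zero]
      · have m3 := Da'.low.mem _ ((hmem _).mpr (Da.mem_right (by omega)))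
        omega
    have hends : j a' = j a ∧ k a' = k a := by
      rw [hlen] at hm
      unfold innerEnds at hm
      split_ifs at hm <;> omega
    rw [ha a' haS', ha a haS, hends.1, hends.2]
    exact Low.prod_eq (peakGen_comm (isTL_tlB hn q) hle)
      (hlow.restrict (Nat.zero_le _) hle fun i hi => Da.low.mem i ((hmem i).mp hi))
      (hgl.restrict (Nat.zero_le _) hle Da.low.mem) hperm
  · intro h; exact absurd haS h

/-- The zigzag representation and the path representations are jointly faithful. -/
theorem eq_zero_of_reps [IsDomain K] [CharZero K] (hn : 2 ≤ n) (hq : q ≠ 0) {x : TLC n q}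
    (hz : (isTL_zigOp hn q).lift hn x = 0)
    (hp : ∀ (e : ℕ → K) (he : ∀ i, e i * e i = e i) (he' : ∀ i, 0 < i → i < n → e i = 1),
      pathRep hn q he he' x = 0) : x = 0 := by
  obtain ⟨N, hN⟩ := exists_mem_wordSpan x
  obtain ⟨c, hc, hx⟩ := Submodule.mem_span_set.mp (wordSpan_le_span_isFam (isTL_tlB hn q) hn N hN)
  rw [Finsupp.sum] at hx
  have hne : ∀ a ∈ c.support, c a ≠ 0 := fun a ha => Finsupp.mem_support_iff.mp ha
  have hseq := isPeakSeq_of_zigOp hn hne (fun a ha => by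
    obtain ⟨M, -, hM⟩ := hc ha
    exact ⟨M, hM⟩) (by rw [← hz, ← hx])
  have hempty := eq_empty_of_pathRep hn hq hne hseq fun e he he' => by
    rw [← hp e he he', ← hx]
  rw [← hx, hempty, Finset.sum_empty]

end PeakScalar

end AffineTL

namespace AffineTL

/-! ### The tower on generators -/

section Tower

variable {K : Type*} [CommRing K]

/-- With `g = x - 1` the inverse of `g` is `c • x - 1`, and conjugation by `g` commutes with adding
`1`. This puts the image of the last generator into the form used by the intertwiners. -/
theorem conj_add_one {A : Type*} [Ring A] [Algebra K A] {q c : K} (hc : c * q = 1) {x y : A}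
    (hx : x * x = (q + 1) • x) :
    (x - 1) * (y - 1) * (c • (x - 1) + algebraMap K A (c - 1)) + 1
      = (x - 1) * y * (c • x - 1) := by
  have e1 : c • (x - 1) + algebraMap K A (c - 1) = c • x - 1 := by
    rw [Algebra.algebraMap_eq_smul_one]; module
  have e2 : (x - 1) * (c • x - 1) = 1 := by
    have : (x - 1) * (c • x - 1) = c • (x * x) - x - c • x + 1 := by
      rw [sub_mul, mul_sub, mul_smul_comm, one_mul, mul_one]; abel
    rw [this, hx, smul_smul, mul_add, hc]
    module
  rw [e1, mul_sub (x - 1) y 1, mul_one, sub_mul, e2, sub_add_cancel]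

theorem R_tlGen {n : ℕ} (hn : 2 ≤ n) (q : Kˣ) (i : Fin (n + 1)) :
    R n hn q (tlGen (affineC n) (q : K) i)
      = toTL (affineC (n + 1)) (q : K) (heckeMapGen n q i) := by
  rw [tlGen, R_toTL, heckeMap_gen]

theorem tlB_eq {n : ℕ} {q : K} {i : ℕ} (h : i ≤ n) :
    tlB n q i = tlGen (affineC n) q ⟨i, Nat.lt_succ_of_le h⟩ + 1 := by
  rw [tlB, dif_pos h]

theorem R_tlB_of_lt {n : ℕ} (hn : 2 ≤ n) (q : Kˣ) {i : ℕ} (hi : i < n) :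
    R n hn q (tlB n (q : K) i) = tlB (n + 1) (q : K) i := by
  rw [tlB_eq hi.le, tlB_eq (by omega), map_add, map_one, R_tlGen, heckeMapGen, if_neg]
  · rfl
  · intro h
    have := congrArg Fin.val h
    simp at this
    omega

theorem R_tlB_last {n : ℕ} (hn : 2 ≤ n) (q : Kˣ) :
    R n hn q (tlB n (q : K) n)
      = (tlB (n + 1) (q : K) n - 1) * tlB (n + 1) (q : K) (n + 1)
        * (((q⁻¹ : Kˣ) : K) • tlB (n + 1) (q : K) n - 1) := by
  rw [← conj_add_one (q := (q : K)) (by simp)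
    ((isTL_tlB (show 2 ≤ n + 1 by omega) (q : K)).sq n (by omega)),
    tlB_sub_one (show n ≤ n + 1 by omega), tlB_sub_one le_rfl, tlB_eq le_rfl, map_add, map_one,
    R_tlGen, heckeMapGen, if_pos (by rfl), map_mul, map_mul]
  have h : ((heckeUnit (affineC (n + 1)) q (Fin.last n).castSucc)⁻¹ : (HeckeC (n + 1) (q : K))ˣ)
      = ((q⁻¹ : Kˣ) : K) • heckeGen (affineC (n + 1)) (q : K) (Fin.last n).castSucc
        + algebraMap K (HeckeC (n + 1) (q : K)) (((q⁻¹ : Kˣ) : K) - 1) := rfl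
  rw [h, map_add, map_smul, AlgHom.commutes]
  rfl

/-- A representation that embeds into a restriction vanishes on the kernel of the restriction. -/
theorem eq_zero_of_intertwiner {n : ℕ} (hn : 2 ≤ n) (q : Kˣ) {V W : Type*} [AddCommGroup V]
    [Module K V] [AddCommGroup W] [Module K W] {b : ℕ → Module.End K V} {b' : ℕ → Module.End K W}
    (H : IsTL n (q : K) b) (H' : IsTL (n + 1) (q : K) b') (ι : V →ₗ[K] W)
    (hι : Function.Injective ι) (h1 : ∀ i < n, ι ∘ₗ b i = b' i ∘ₗ ι)
    (h2 : ι ∘ₗ b n = ((b' n - 1) * b' (n + 1) * (((q⁻¹ : Kˣ) : K) • b' n - 1)) ∘ₗ ι)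
    {x : TLC n (q : K)} (hx : R n hn q x = 0) : H.lift hn x = 0 := by
  have hn' : 2 ≤ n + 1 := by omega
  have key : ∀ x : TLC n (q : K), ι ∘ₗ H.lift hn x = H'.lift hn' (R n hn q x) ∘ₗ ι := by
    intro x
    induction x using tlC_induction with
    | hK c =>
      rw [AlgHom.commutes, AlgHom.commutes, AlgHom.commutes]
      ext v
      simp [Module.algebraMap_end_apply]
    | hg i hi =>
      rw [H.lift_tlB hn hi]
      rcases hi.lt_or_eq with hi | rfl
      · rw [R_tlB_of_lt hn q hi, H'.lift_tlB hn' (by omega), h1 i hi]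
      · have e1 : H'.lift hn' (tlB (i + 1) (q : K) i - 1) = b' i - 1 := by
          refine (map_sub (H'.lift hn') _ _).trans ?_
          rw [H'.lift_tlB hn' (by omega), map_one]
        have e2 : H'.lift hn' (((q⁻¹ : Kˣ) : K) • tlB (i + 1) (q : K) i - 1)
            = ((q⁻¹ : Kˣ) : K) • b' i - 1 := by
          refine (map_sub (H'.lift hn') _ _).trans ?_
          rw [map_smul, H'.lift_tlB hn' (by omega), map_one]
        rw [R_tlB_last, map_mul, map_mul, e1, e2, H'.lift_tlB hn' le_rfl, h2]
    | hadd x y hx hy => rw [map_add, map_add, map_add, LinearMap.comp_add, hx, hy, LinearMap.add_comp]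
    | hmul x y hx hy =>
      rw [map_mul, map_mul, map_mul, Module.End.mul_eq_comp, Module.End.mul_eq_comp,
        ← LinearMap.comp_assoc, hx, LinearMap.comp_assoc, hy, LinearMap.comp_assoc]
  have := key x
  rw [hx, map_zero, LinearMap.zero_comp] at this
  refine LinearMap.ext fun v => hι ?_
  rw [LinearMap.zero_apply, map_zero]
  exact LinearMap.congr_fun this v

/-- Each vector `f a` has a private coordinate `p a`, from which the coefficient of `a` can be read
off. -/
theorem linearCombination_injective [IsDomain K] {α β : Type*} {f : α → β →₀ K} {p : α → β}
    (h1 : ∀ a, f a (p a) ≠ 0) (h2 : ∀ a a', a ≠ a' → f a (p a') = 0) :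
    Function.Injective (Finsupp.linearCombination K f) := by
  rw [injective_iff_map_eq_zero]
  intro x hx
  ext a
  have := DFunLike.congr_fun hx (p a)
  rw [Finsupp.linearCombination_apply, Finsupp.sum, Finsupp.finsetSum_apply,
    Finset.sum_eq_single a] at this
  · exact (mul_eq_zero.mp this).resolve_right (h1 a)
  · intro a' _ hne
    rw [Finsupp.smul_apply, h2 a' a hne, smul_zero]
  · intro ha
    rw [Finsupp.notMem_support_iff.mp ha, zero_smul, Finsupp.zero_apply]

end Tower

/-! ### Embedding the path representations -/

section PathEmbedding

/-- Append an up-step to a path on the columns `0, …, n`. -/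
def appendUp (n : ℕ) (h : ℕ → ℤ) (m : ℕ) : ℤ :=
  -- Paths are functions on all of `ℕ`. The irrelevant values beyond column `n` are shifted, not
  -- overwritten, to keep the map injective.
  if m ≤ n then h m else if m = n + 1 then h n + 1 else h (m - 1)

theorem appendUp_injective (n : ℕ) : Function.Injective (appendUp n) := by
  intro h h' H
  funext m
  by_cases hm : m ≤ n
  · have := congrFun H m
    rwa [appendUp, appendUp, if_pos hm, if_pos hm] at this
  · have := congrFun H (m + 1)
    rwa [appendUp, appendUp, if_neg (by omega), if_neg (by omega), if_neg (by omega),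
      if_neg (by omega), Nat.add_sub_cancel] at this

theorem appendUp_bump_of_lt {n i : ℕ} (hi : i < n) (h : ℕ → ℤ) (c : ℤ) :
    appendUp n (bump h i c) = bump (appendUp n h) i c := by
  funext m; simp only [appendUp, bump]; grind

theorem appendUp_bump_last (n : ℕ) (h : ℕ → ℤ) (c : ℤ) :
    appendUp n (bump h n c) = bump (bump (appendUp n h) (n + 1) c) n c := by
  funext m; simp only [appendUp, bump]; grind

theorem isPath_appendUp {n : ℕ} {h : ℕ → ℤ} : IsPath 0 (n + 1) (appendUp n h) ↔ IsPath 0 n h := by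
  constructor
  · intro H m h1 h2
    have := H m h1 (by omega)
    simp only [appendUp] at this
    grind
  · intro H m h1 h2
    have := H m h1
    simp only [appendUp]
    grind

theorem isMax_appendUp {n i : ℕ} (hi : i < n) {h : ℕ → ℤ} :
    IsMax 0 (n + 1) (appendUp n h) i ↔ IsMax 0 n h i := by
  simp only [IsMax, appendUp]; grind

theorem isMin_appendUp {n i : ℕ} (hi : i < n) {h : ℕ → ℤ} :
    IsMin 0 (n + 1) (appendUp n h) i ↔ IsMin 0 n h i := by
  simp only [IsMin, appendUp]; grind

/-- A sign on heights, alternating in steps of `2`. -/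
def heightSign (x : ℤ) : ℤ := if x % 4 < 2 then 1 else -1

theorem heightSign_add (x : ℤ) : heightSign (x + 2) = -heightSign x := by
  unfold heightSign; split_ifs <;> omega

theorem heightSign_sub (x : ℤ) : heightSign (x + -2) = -heightSign x := by
  unfold heightSign; split_ifs <;> omega

variable {K : Type*} [CommRing K] {n : ℕ}

/-- The embedding of path representations by appending an up-step. -/
noncomputable def pathEmb (K : Type*) [CommRing K] (n : ℕ) :
    ((ℕ → ℤ) →₀ K) →ₗ[K] ((ℕ → ℤ) →₀ K) :=
  Finsupp.linearCombination K fun h =>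
    (heightSign (h n) : K) • Finsupp.single (appendUp n h) 1

theorem pathEmb_single (h : ℕ → ℤ) : pathEmb K n (Finsupp.single h 1)
    = (heightSign (h n) : K) • Finsupp.single (appendUp n h) 1 := by
  simp [pathEmb]

theorem pathEmb_injective [IsDomain K] : Function.Injective (pathEmb K n) := by
  apply linearCombination_injective (p := appendUp n)
  · intro h
    rw [Finsupp.smul_apply, Finsupp.single_eq_same]
    unfold heightSign
    split_ifs <;> simp
  · intro h h' hne
    rw [Finsupp.smul_apply, Finsupp.single_eq_of_ne ((appendUp_injective n).ne hne.symm), smul_zero]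

theorem pathEmb_comp_of_lt {q : K} {i : ℕ} (hi : i < n) :
    pathEmb K n ∘ₗ pathOp n q i = pathOp (n + 1) q i ∘ₗ pathEmb K n := by
  refine Finsupp.lhom_ext' fun h => LinearMap.ext_ring ?_
  have e1 : pathCoef (n + 1) q i (appendUp n h) = pathCoef n q i h := by
    rw [pathCoef, propext isPath_appendUp, propext (isMax_appendUp hi),
      propext (isMin_appendUp hi), ← pathCoef]
  have e2 : pathStep (n + 1) i (appendUp n h) = pathStep n i h := by
    rw [pathStep, propext (isMax_appendUp hi), propext (isMin_appendUp hi), ← pathStep]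
  have e3 : bump h i (pathStep n i h) n = h n := by
    simp [bump, hi.ne']
  simp only [LinearMap.comp_apply, Finsupp.lsingle_apply]
  rw [pathOp_single, map_smul, map_add, pathEmb_single, pathEmb_single, map_smul, pathOp_single, e1,
    e2, e3, appendUp_bump_of_lt hi]
  module

/-- On a path with an up-step appended, the conjugated generator changes the last two columns
together, but yields the difference of the old and the new path where `pathOp n q n` yields the sum.
The sign `heightSign` of the end height, which flips with each change by `2`, compensates. -/
theorem pathEmb_comp_last {q : Kˣ} (hn : 0 < n) (ε : K) :
    pathEmb K n ∘ₗ (ε • pathOp n (q : K) n)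
      = ((pathOp (n + 1) (q : K) n - 1) * (ε • pathOp (n + 1) (q : K) (n + 1))
          * (((q⁻¹ : Kˣ) : K) • pathOp (n + 1) (q : K) n - 1)) ∘ₗ pathEmb K n := by
  refine Finsupp.lhom_ext' fun h => LinearMap.ext_ring ?_
  simp only [LinearMap.comp_apply, Finsupp.lsingle_apply]
  rw [pathEmb_single, map_smul, LinearMap.smul_apply, map_smul]
  simp only [Module.End.mul_apply, LinearMap.sub_apply, LinearMap.smul_apply, Module.End.one_apply]
  by_cases hp : IsPath 0 n h
  swap
  · have hp' : ¬ IsPath 0 (n + 1) (appendUp n h) := fun H => hp (isPath_appendUp.mp H)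
    rw [pathOp_not_path hp, pathOp_not_path hp', smul_zero, zero_sub, map_neg,
      pathOp_not_path hp']
    simp
  set g := appendUp n h with hg
  have gn : g n = h n := by simp [hg, appendUp]
  have gn1 : g (n + 1) = h n + 1 := by simp [hg, appendUp]
  have gp : g (n - 1) = h (n - 1) := by simp [hg, appendUp]
  have hp' : IsPath 0 (n + 1) g := isPath_appendUp.mpr hp
  have cqq : ((q⁻¹ : Kˣ) : K) * (q : K) = 1 := by simp
  have hstep := hp (n - 1) (Nat.zero_le _) (by omega)
  rw [show n - 1 + 1 = n by omega] at hstep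
  rcases hstep with hs | hs
  · have hmax : IsMax 0 n h n := ⟨fun _ => by omega, fun h => by omega⟩
    have hslope : pathOp (n + 1) (q : K) n (Finsupp.single g 1) = 0 :=
      pathOp_slope (fun H => by have := H.2 (by omega); omega)
        (fun H => by have := H.1 hn; omega)
    have hmax1 : IsMax 0 (n + 1) g (n + 1) :=
      ⟨fun _ => by rw [Nat.add_sub_cancel]; omega, fun h => by omega⟩
    have hmax2 : IsMax 0 (n + 1) (bump g (n + 1) (-2)) n := by
      simp only [IsMax, bump]; grind
    rw [pathOp_max hp hmax, map_add, pathEmb_single, pathEmb_single, hslope, smul_zero,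
      zero_sub, map_neg, pathOp_max hp' hmax1, appendUp_bump_last, ← hg, map_smul, map_neg, map_add,
      hslope, pathOp_max (hmax1.isPath_bump hp') hmax2]
    rw [show bump h n (-2) n = h n + -2 by simp [bump], heightSign_sub]
    push_cast
    module
  · have hmin : IsMin 0 n h n := ⟨fun _ => by omega, fun h => by omega⟩
    have hmin' : IsMin 0 (n + 1) g n := ⟨fun _ => by omega, fun h => by omega⟩
    have hmin1 : IsMin 0 (n + 1) (bump g n 2) (n + 1) := by
      simp only [IsMin, bump]; grind
    have hmax := hmin'.bump
    have hpb := hmin'.isPath_bump hp'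
    have hslope : pathOp (n + 1) (q : K) n (Finsupp.single (bump (bump g n 2) (n + 1) 2) 1) = 0 := by
      apply pathOp_slope <;> (simp only [IsMax, IsMin, bump]; grind)
    have e1 : bump (bump g n 2) n (-2) = g := by rw [bump_bump_same]; exact bump_zero g n
    rw [pathOp_min hn hp hmin, map_smul, map_add, pathEmb_single, pathEmb_single,
      appendUp_bump_last, ← hg, pathOp_min (by omega) hp' hmin',
      smul_smul ((q⁻¹ : Kˣ) : K) (q : K), cqq, one_smul,
      add_sub_cancel_left, pathOp_min (by omega) hpb hmin1, map_smul, map_smul, map_add,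
      pathOp_max hpb hmax, e1, hslope, bump_comm g (n + 1) n]
    rw [show bump h n 2 n = h n + 2 by simp [bump], heightSign_add]
    push_cast
    module

end PathEmbedding

end AffineTL

namespace AffineTL

/-! ### Embedding the zigzag representations -/

section ZigEmbedding

variable {K : Type*} [CommRing K]

theorem zigOp_at {n : ℕ} {q : K} (hn : 0 < n) (i : ℕ) (p m : ℤ) (h1 : -(n : ℤ) < m)
    (h2 : m < n) :
    zigOp n q i (Finsupp.single (2 * n * p + m) 1) =
      if i = m.natAbs then (q + 1) • Finsupp.single (2 * n * p + m) 1
      else if i = (m + 1).natAbs then Finsupp.single (2 * n * p + (m + 1)) 1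
      else if i = (m - 1).natAbs then
        zigScalar n q i • Finsupp.single (2 * n * p + (m - 1)) 1
      else 0 := by
  have e1 := zig_eq p m h1 h2.le
  have e2 := zig_succ p m h1 h2.le hn
  have e3 := zig_pred p m h1 h2.le hn
  rw [if_neg h2.ne] at e2
  rw [zigOp, Finsupp.linearCombination_single, one_smul, zigVec, e1, e2, e3]
  simp only [add_assoc, add_sub_assoc, Finsupp.smul_single, smul_eq_mul, mul_one]

theorem zigOp_at_end {n : ℕ} {q : K} (hn : 0 < n) (i : ℕ) (p : ℤ) :
    zigOp n q i (Finsupp.single (2 * n * p + n) 1) =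
      if i = n then (q + 1) • Finsupp.single (2 * n * p + n) 1
      else if i = n - 1 then Finsupp.single (2 * n * (p + 1) + (-n + 1)) 1
      else 0 := by
  have e1 := zig_eq (n := n) p n (by omega) le_rfl
  have e2 := zig_succ p n (by omega) le_rfl hn
  have e3 := zig_pred p n (by omega) le_rfl hn
  rw [if_pos rfl] at e2
  rw [zigOp, Finsupp.linearCombination_single, one_smul, zigVec, e1, e2, e3,
    show 2 * (n : ℤ) * (p + 1) + (-n + 1) = 2 * n * p + n + 1 by ring]
  simp only [Finsupp.smul_single, smul_eq_mul, mul_one, Int.natAbs_natCast]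
  split_ifs <;> first | rfl | omega

/-- The image of a basis vector of the zigzag representation in the next one. -/
noncomputable def zigEmbVec (n : ℕ) (q : Kˣ) (r : ℤ) : ℤ →₀ K :=
  -- The turn goes to the `q + 1`-eigenvector of the conjugated generator formed by the new turn `n
  -- + 1` and the letter `n` after it. Stepping forward into it produces a factor `q⁻¹`, hence the
  -- power of `q` counting periods.
  if zigMod n r = n then
    ((q ^ (-((r - zigMod n r) / (2 * n)) - 1) : Kˣ) : K) •
      (Finsupp.single (2 * (n + 1 : ℕ) * ((r - zigMod n r) / (2 * n) + 1) + -n) 1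
        - Finsupp.single (2 * (n + 1 : ℕ) * ((r - zigMod n r) / (2 * n)) + (n + 1 : ℕ)) 1)
  else ((q ^ (-((r - zigMod n r) / (2 * n))) : Kˣ) : K) •
    Finsupp.single (2 * (n + 1 : ℕ) * ((r - zigMod n r) / (2 * n)) + zigMod n r) 1

variable {n : ℕ} {q : Kˣ}

theorem zig_quot (hn : 0 < n) (p m : ℤ) (h1 : -(n : ℤ) < m) (h2 : m ≤ n) :
    (2 * n * p + m - zigMod n (2 * n * p + m)) / (2 * n) = p := by
  rw [zigMod_eq p m h1 h2, add_sub_cancel_right]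
  exact Int.mul_ediv_cancel_left _ (by omega)

theorem zigEmbVec_inner (hn : 0 < n) (p m : ℤ) (h1 : -(n : ℤ) < m) (h2 : m < n) :
    zigEmbVec n q (2 * n * p + m) = ((q ^ (-p) : Kˣ) : K) •
      Finsupp.single (2 * (n + 1 : ℕ) * p + m) 1 := by
  rw [zigEmbVec, zig_quot hn p m h1 h2.le, zigMod_eq p m h1 h2.le, if_neg h2.ne]

theorem zigEmbVec_end (hn : 0 < n) (p : ℤ) :
    zigEmbVec n q (2 * n * p + n) = ((q ^ (-p - 1) : Kˣ) : K) •
      (Finsupp.single (2 * (n + 1 : ℕ) * (p + 1) + -n) 1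
        - Finsupp.single (2 * (n + 1 : ℕ) * p + (n + 1 : ℕ)) 1) := by
  rw [zigEmbVec, zig_quot hn p n (by omega) le_rfl, zigMod_eq p n (by omega) le_rfl, if_pos rfl]

/-- The embedding of a zigzag representation into the next one. -/
noncomputable def zigEmb (n : ℕ) (q : Kˣ) : (ℤ →₀ K) →ₗ[K] (ℤ →₀ K) :=
  Finsupp.linearCombination K (zigEmbVec n q)

theorem zigEmb_single (r : ℤ) : zigEmb n q (Finsupp.single r 1) = zigEmbVec n q r := by
  simp [zigEmb]

/-- A coordinate that detects one basis vector in the image of the embedding. -/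
def zigCoord (n : ℕ) (r : ℤ) : ℤ :=
  if zigMod n r = n then 2 * (n + 1 : ℕ) * ((r - zigMod n r) / (2 * n) + 1) + -n
  else 2 * (n + 1 : ℕ) * ((r - zigMod n r) / (2 * n)) + zigMod n r

theorem zigCoord_inner (hn : 0 < n) (p m : ℤ) (h1 : -(n : ℤ) < m) (h2 : m < n) :
    zigCoord n (2 * n * p + m) = 2 * (n + 1 : ℕ) * p + m := by
  rw [zigCoord, zig_quot hn p m h1 h2.le, zigMod_eq p m h1 h2.le, if_neg h2.ne]

theorem zigCoord_end (hn : 0 < n) (p : ℤ) :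
    zigCoord n (2 * n * p + n) = 2 * (n + 1 : ℕ) * (p + 1) + -n := by
  rw [zigCoord, zig_quot hn p n (by omega) le_rfl, zigMod_eq p n (by omega) le_rfl, if_pos rfl]

theorem mul_add_inj {n : ℕ} {p p' m m' : ℤ} (h1 : -(n : ℤ) < m) (h2 : m ≤ n)
    (h1' : -(n : ℤ) < m') (h2' : m' ≤ n) (h : 2 * n * p + m = 2 * n * p' + m') :
    p = p' ∧ m = m' := by
  have hm : m = m' := by
    rw [← zigMod_eq p m h1 h2, ← zigMod_eq p' m' h1' h2', h]
  subst hm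
  exact ⟨mul_left_cancel₀ (show (2 * n : ℤ) ≠ 0 by omega) (add_right_cancel h), rfl⟩

theorem zigEmb_injective [IsDomain K] (hn : 0 < n) : Function.Injective (zigEmb n q) := by
  have N0 : -((n + 1 : ℕ) : ℤ) < -n := by push_cast; omega
  apply linearCombination_injective (p := zigCoord n)
  · intro r
    obtain ⟨p, m, h1, h2, rfl⟩ := exists_zigMod hn r
    rcases h2.lt_or_eq with h2 | rfl
    · rw [zigCoord_inner hn p m h1 h2, zigEmbVec_inner hn p m h1 h2, Finsupp.smul_apply,
        Finsupp.single_eq_same, smul_eq_mul, mul_one]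
      exact Units.ne_zero _
    · rw [zigCoord_end hn p, zigEmbVec_end hn p, Finsupp.smul_apply, Finsupp.sub_apply,
        Finsupp.single_eq_same, Finsupp.single_eq_of_ne, sub_zero, smul_eq_mul, mul_one]
      · exact Units.ne_zero _
      · intro h
        have := mul_add_inj N0 (by omega) (by omega) le_rfl h
        omega
  · intro r r' hne
    obtain ⟨p, m, h1, h2, rfl⟩ := exists_zigMod hn r
    obtain ⟨p', m', h1', h2', rfl⟩ := exists_zigMod hn r'
    rcases h2.lt_or_eq with h2 | rfl <;> rcases h2'.lt_or_eq with h2' | rfl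
    · rw [zigEmbVec_inner hn p m h1 h2, zigCoord_inner hn p' m' h1' h2', Finsupp.smul_apply,
        Finsupp.single_eq_of_ne, smul_zero]
      intro h
      obtain ⟨rfl, rfl⟩ := mul_add_inj (by omega) (by omega) (by omega) (by omega) h
      exact hne rfl
    · rw [zigEmbVec_inner hn p m h1 h2, zigCoord_end hn p', Finsupp.smul_apply,
        Finsupp.single_eq_of_ne, smul_zero]
      intro h
      have := mul_add_inj (by omega) (by omega) (by omega) (by omega) h
      omega
    · rw [zigEmbVec_end hn p, zigCoord_inner hn p' m' h1' h2', Finsupp.smul_apply,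
        Finsupp.sub_apply, Finsupp.single_eq_of_ne, Finsupp.single_eq_of_ne, sub_zero, smul_zero]
      · intro h
        have := mul_add_inj (by omega) (by omega) (by omega) (by omega) h
        omega
      · intro h
        have := mul_add_inj (by omega) (by omega) (by omega) (by omega) h
        omega
    · rw [zigEmbVec_end hn p, zigCoord_end hn p', Finsupp.smul_apply,
        Finsupp.sub_apply, Finsupp.single_eq_of_ne, Finsupp.single_eq_of_ne, sub_zero, smul_zero]
      · intro h
        have := mul_add_inj (by omega) (by omega) (by omega) (by omega) h
        omega
      · intro h
        have := mul_add_inj (by omega) (by omega) (by omega) (by omega) h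
        apply hne
        rw [show p = p' by omega]

theorem zigEmb_comp_of_lt {i : ℕ} (hn : 2 ≤ n) (hi : i < n) :
    zigEmb n q ∘ₗ zigOp n (q : K) i = zigOp (n + 1) (q : K) i ∘ₗ zigEmb n q := by
  have hn0 : 0 < n := by omega
  have hs : zigScalar n (q : K) i = zigScalar (n + 1) (q : K) i := by
    unfold zigScalar
    by_cases h : i = 0
    · rw [if_pos (.inl h), if_pos (.inl h)]
    · rw [if_neg (by omega), if_neg (by omega)]
  refine Finsupp.lhom_ext' fun r => LinearMap.ext_ring ?_
  simp only [LinearMap.comp_apply, Finsupp.lsingle_apply]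
  obtain ⟨p, m, h1, h2, rfl⟩ := exists_zigMod hn0 r
  rw [zigEmb_single]
  rcases h2.lt_or_eq with h2 | rfl
  · rw [zigEmbVec_inner hn0 p m h1 h2, map_smul, zigOp_at hn0 i p m h1 h2,
      zigOp_at (n := n + 1) (by omega) i p m (by omega) (by omega)]
    split_ifs with c1 c2 c3
    · rw [map_smul, zigEmb_single, zigEmbVec_inner hn0 p m h1 h2, smul_comm]
    · rw [zigEmb_single, zigEmbVec_inner hn0 p _ (by omega) (by omega)]
    · rw [map_smul, zigEmb_single, zigEmbVec_inner hn0 p _ (by omega) (by omega), smul_comm, hs]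
    · rw [map_zero, smul_zero]
  · have e := zigOp_at_end (q := (q : K)) (show 0 < n + 1 by omega) i p
    rw [if_neg (by omega), if_neg (by omega)] at e
    rw [zigEmbVec_end hn0 p, map_smul, map_sub, zigOp_at_end hn0 i p, if_neg hi.ne, e, sub_zero,
      zigOp_at (n := n + 1) (by omega) i (p + 1) (-n) (by omega) (by omega),
      if_neg (show ¬ i = (-(n : ℤ)).natAbs by omega)]
    by_cases c : i = n - 1
    · rw [if_pos c, if_pos (by omega), zigEmb_single,
        zigEmbVec_inner hn0 (p + 1) _ (by omega) (by omega), neg_add']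
    · rw [if_neg c, if_neg (by omega), if_neg (by omega), map_zero, smul_zero]

theorem zigEmb_comp_last (hn : 2 ≤ n) :
    zigEmb n q ∘ₗ zigOp n (q : K) n
      = ((zigOp (n + 1) (q : K) n - 1) * zigOp (n + 1) (q : K) (n + 1)
          * (((q⁻¹ : Kˣ) : K) • zigOp (n + 1) (q : K) n - 1)) ∘ₗ zigEmb n q := by
  have hn0 : 0 < n := by omega
  have hN0 : 0 < n + 1 := by omega
  have cqq : ((q⁻¹ : Kˣ) : K) * (q : K) = 1 := by simp
  have hs1 : zigScalar (n + 1) (q : K) n = q := by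
    unfold zigScalar; rw [if_neg (by omega)]
  have hs2 : zigScalar (n + 1) (q : K) (n + 1) = 2 * q := by
    unfold zigScalar; rw [if_pos (by omega)]
  have hs3 : zigScalar n (q : K) n = 2 * q := by
    unfold zigScalar; rw [if_pos (by omega)]
  refine Finsupp.lhom_ext' fun r => LinearMap.ext_ring ?_
  simp only [LinearMap.comp_apply, Finsupp.lsingle_apply]
  obtain ⟨p, m, h1, h2, rfl⟩ := exists_zigMod hn0 r
  rw [zigEmb_single]
  have hpow : ∀ p : ℤ, ((q ^ (-p - 1) : Kˣ) : K) = ((q ^ (-p) : Kˣ) : K) * ((q⁻¹ : Kˣ) : K) := by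
    intro p
    rw [zpow_sub_one, Units.val_mul]
  have hnext : ∀ p : ℤ, (2 * ((n + 1 : ℕ) : ℤ) * (p + 1) + (-((n + 1 : ℕ) : ℤ) + 1))
      = 2 * ((n + 1 : ℕ) : ℤ) * (p + 1) + -n := by
    intro p; push_cast; ring
  rcases h2.lt_or_eq with h2 | rfl
  · have hnone : ∀ m' : ℤ, m' = m → zigOp (n + 1) (q : K) (n + 1)
        (Finsupp.single (2 * ((n + 1 : ℕ) : ℤ) * p + m') 1) = 0 := by
      rintro m' rfl
      rw [zigOp_at hN0 (n + 1) p m' (by omega) (by omega), if_neg (by omega), if_neg (by omega),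
        if_neg (by omega)]
    rw [zigEmbVec_inner hn0 p m h1 h2, map_smul]
    simp only [Module.End.mul_apply, LinearMap.sub_apply, LinearMap.smul_apply,
      Module.End.one_apply]
    by_cases c1 : m + 1 = n
    · rw [zigOp_at hn0 n p m h1 h2, if_neg (by omega), if_pos (by omega), c1, zigEmb_single,
        zigEmbVec_end hn0 p, zigOp_at hN0 n p m (by omega) (by omega), if_neg (by omega),
        if_pos (by omega), c1, map_sub, hnone m rfl, sub_zero, map_smul,
        zigOp_at hN0 (n + 1) p n (by omega) (by omega), if_neg (by omega), if_pos (by omega),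
        map_smul]
      have e := zigOp_at_end (q := (q : K)) hN0 n p
      rw [if_neg (by omega), if_pos (by omega), hnext] at e
      rw [show ((n : ℤ) + 1) = ((n + 1 : ℕ) : ℤ) by push_cast; ring, e, hpow]
      module
    by_cases c2 : m - 1 = -n
    -- A step back to `-n` lands on the turn of the previous period, where the representative modulo
    -- `2 * n` is `n`.
    · have hr : 2 * (n : ℤ) * p + -n = 2 * n * (p - 1) + n := by ring
      have hr' : 2 * ((n + 1 : ℕ) : ℤ) * p + (-(n : ℤ) - 1)
          = 2 * ((n + 1 : ℕ) : ℤ) * (p - 1) + ((n + 1 : ℕ) : ℤ) := by push_cast; ring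
      rw [zigOp_at hn0 n p m h1 h2, if_neg (by omega), if_neg (by omega), if_pos (by omega), c2,
        map_smul, zigEmb_single, hr, zigEmbVec_end hn0 (p - 1),
        zigOp_at hN0 n p m (by omega) (by omega), if_neg (by omega), if_neg (by omega),
        if_pos (by omega), c2, map_sub, hnone m rfl, sub_zero, hs1,
        smul_smul ((q⁻¹ : Kˣ) : K) (q : K), cqq, one_smul,
        zigOp_at hN0 (n + 1) p (-n) (by omega) (by omega), if_neg (by omega), if_neg (by omega),
        if_pos (by omega), map_smul, hr', hs2, hs3]
      have e := zigOp_at_end (q := (q : K)) hN0 n (p - 1)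
      rw [if_neg (by omega), if_pos (by omega), hnext, sub_add_cancel] at e
      rw [e, sub_add_cancel, show -(p - 1) - 1 = -p by ring]
      module
    · rw [zigOp_at hn0 n p m h1 h2, if_neg (by omega), if_neg (by omega), if_neg (by omega),
        map_zero, zigOp_at hN0 n p m (by omega) (by omega), if_neg (by omega), if_neg (by omega),
        if_neg (by omega), smul_zero, zero_sub, map_neg, hnone m rfl]
      simp
  · rw [zigEmbVec_end hn0 p, map_smul, zigOp_at_end hn0 n p, if_pos rfl, map_smul, zigEmb_single,
      zigEmbVec_end hn0 p]
    have eA := zigOp_at (q := (q : K)) hN0 n (p + 1) (-n) (by omega) (by omega)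
    rw [if_pos (by omega)] at eA
    have eC := zigOp_at_end (q := (q : K)) hN0 n p
    rw [if_neg (by omega), if_pos (by omega), hnext] at eC
    have eC' := zigOp_at_end (q := (q : K)) hN0 (n + 1) p
    rw [if_pos rfl] at eC'
    set A : ℤ →₀ K := Finsupp.single (2 * ((n + 1 : ℕ) : ℤ) * (p + 1) + -n) 1
    set C : ℤ →₀ K := Finsupp.single (2 * ((n + 1 : ℕ) : ℤ) * p + ((n + 1 : ℕ) : ℤ)) 1
    -- Here `C` is the turn and `A` the position after it. The inverse conjugator maps `A - C` to
    -- `C`, the generator `n + 1` scales `C` by `q + 1`, and the conjugator maps `C` back to `A -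
    -- C`.
    have e : (((q⁻¹ : Kˣ) : K) • zigOp (n + 1) (q : K) n - 1) (A - C) = C := by
      rw [LinearMap.sub_apply, LinearMap.smul_apply, Module.End.one_apply, map_sub, eA, eC,
        add_smul, one_smul, add_sub_cancel_right, smul_smul, cqq, one_smul, sub_sub_cancel]
    rw [Module.End.mul_apply, Module.End.mul_apply, e, eC', map_smul, LinearMap.sub_apply,
      Module.End.one_apply, eC, smul_comm]

/-! ### Injectivity of the arrows of the tower -/

/-- The map from the base ring is injective, as the zigzag representation is faithful on it. -/
theorem ofId_injective (hn : 2 ≤ n) (q : K) :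
    Function.Injective (Algebra.ofId K (TLC n q)) := by
  intro c d h
  have := congrArg (fun x => (isTL_zigOp hn q).lift hn x (Finsupp.single 0 1) 0) h
  simpa [Algebra.ofId_apply, AlgHom.commutes, Module.algebraMap_end_apply] using this

theorem R_injective [IsDomain K] [CharZero K] (hn : 2 ≤ n) (q : Kˣ) :
    Function.Injective (R n hn q) := by
  have hn0 : 0 < n := by omega
  have hn' : 2 ≤ n + 1 := by omega
  rw [injective_iff_map_eq_zero]
  intro x hx
  refine eq_zero_of_reps hn q.ne_zero ?_ fun e he he' => ?_
  · exact eq_zero_of_intertwiner hn q (isTL_zigOp hn (q : K)) (isTL_zigOp hn' (q : K)) (zigEmb n q)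
      (zigEmb_injective hn0) (fun i hi => zigEmb_comp_of_lt hn hi) (zigEmb_comp_last hn) hx
  -- The right-hand parameter moves to the new end column, since column `n` is now inner and needs
  -- parameter `1`.
  · let f : ℕ → K := fun i => if i = n + 1 then e n else if i = n then 1 else e i
    have hf1 : f (n + 1) = e n := if_pos rfl
    have hf2 : f n = 1 := by simp [f]
    have hf3 : ∀ i < n, f i = e i := fun i hi => by
      simp only [f]; rw [if_neg (by omega), if_neg (by omega)]
    have hf : ∀ i, f i * f i = f i := by
      intro i
      simp only [f]
      split_ifs
      · exact he n
      · exact mul_one 1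
      · exact he i
    have hf' : ∀ i, 0 < i → i < n + 1 → f i = 1 := by
      intro i h1 h2
      rcases (Nat.lt_succ_iff.mp h2).lt_or_eq with h | rfl
      · rw [hf3 i h, he' i h1 h]
      · exact hf2
    refine eq_zero_of_intertwiner hn q (isTL_smul_pathOp hn (q : K) he he')
      (isTL_smul_pathOp hn' (q : K) hf hf') (pathEmb K n) pathEmb_injective (fun i hi => ?_) ?_ hx
    · rw [hf3 i hi, LinearMap.comp_smul, LinearMap.smul_comp, pathEmb_comp_of_lt hi]
    · rw [hf1, hf2, one_smul]
      exact pathEmb_comp_last hn0 (e n)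

end ZigEmbedding

end AffineTL

theorem theorem6p4 (K : Type*) [CommRing K] [IsDomain K] [CharZero K] (q : Kˣ) :
    Function.Injective (Algebra.ofId K (AffineTL.TLC 2 (q : K))) ∧
      ∀ (n : ℕ) (hn : 2 ≤ n), Function.Injective (AffineTL.R n hn q) :=
  ⟨AffineTL.ofId_injective le_rfl (q : K), fun _ hn => AffineTL.R_injective hn q⟩
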